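/- Let $k$ be a field. **Words.** A word $\sigma=\sigma(1)\cdots\sigma(n)$ over the positive integers is *packed* if its set of letters is $\{1,\dots,\max\sigma\}$; the packed words without repeated letter are the permutations. $\mathrm{Pack}(w)$ is the packed word obtained from a word $w$ by replacing each letter by its rank among the letters of $w$, and $\sigma_{|I}$ is obtained from $\sigma$ by keeping only the letters in $I$. Let $\mathbf{QSh}$ (resp. $\mathbf{Sh}$) be the $k$-vector space with basis the nonempty packed words (resp. the nonempty permutations). On either space, for basis words $\sigma,\tau$ of lengths $p,q$, let $\sigma\prec\tau$ (resp. $\sigma\succ\tau$, $\sigma\bullet\tau$) be the sum of all basis words $u$ of length $p+q$ such that $\mathrm{Pack}(u(1)\cdots u(p))=\sigma$, $\mathrm{Pack}(u(p+1)\cdots u(p+q))=\tau$ and $\min(u(1),\dots,u(p))<\min(u(p+1),\dots,u(p+q))$ (resp. $>$, $=$); on $\mathbf{Sh}$ the product $\bullet$ vanishes. Put $\preceq\;=\;\prec+\bullet$ and $$\Delta_\prec(\sigma)=\sum_{i=\sigma(1)}^{\max\sigma-1}\sigma_{|\{1,\dots,i\}}\otimes \mathrm{Pack}(\sigma_{|\{i+1,\dots,\max\sigma\}}),\qquad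 \Delta_\succ(\sigma)=\sum_{i=1}^{\sigma(1)-1}\sigma_{|\{1,\dots,i\}}\otimes \mathrm{Pack}(\sigma_{|\{i+1,\dots,\max\sigma\}}).$$ For packed words $\sigma,\tau$ of the same length $n$, write $\tau\le\sigma$ if for all $i,j\in\{1,\dots,n\}$: $\sigma(i)\le\sigma(j)$ implies $\tau(i)\le\tau(j)$; and, if $i<j$, $\sigma(i)>\sigma(j)$ implies $\tau(i)>\tau(j)$. Let $\Psi:\mathbf{Sh}\to\mathbf{QSh}$ be the linear map with $\Psi(\sigma)=\sum_{\tau\le\sigma}\tau$, summed over packed words $\tau$. **Trees.** Let $\mathbf{ST}$ (resp. $\mathbf{PBT}$) be the $k$-vector space with basis the reduced planar rooted trees (resp. the planar binary trees) with at least two leaves, where *reduced* means that no vertex has exactly one child. For a reduced tree $t$, $R(t)$ is the set of edges of $t$ between two internal vertices that are the rightmost outgoing edge of their upper vertex, and $t'\le t$ means that $t'$ is obtained from $t$ by contracting the edges of some subset of $R(t)$. Let $\psi:\mathbf{PBT}\to\mathbf{ST}$ be the linear map with $\psi(t)=\sum_{t'\le t}t'$. Let $\varrho$ be the map from packed words to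 reduced planar trees which sends the empty word to the tree with one leaf, and a nonempty packed word $w=w_1\,1\,w_2\,1\cdots 1\,w_{r+1}$ (where no $w_i$ contains the letter $1$) to the tree whose root has, from left to right, the subtrees $\varrho(\mathrm{Pack}(w_1)),\dots,\varrho(\mathrm{Pack}(w_{r+1}))$. Let $\Omega:\mathbf{ST}\to\mathbf{QSh}$ and $\Omega':\mathbf{PBT}\to\mathbf{Sh}$ be the linear maps with $\Omega(t)=\sum_{\varrho(\sigma)=t}\sigma$ over packed words $\sigma$, and $\Omega'(t)=\sum_{\varrho(\sigma)=t}\sigma$ over permutations $\sigma$. **Bidendriform bialgebras.** A (nonunital) *bidendriform bialgebra* $(A,\prec,\succ,\Delta_\prec,\Delta_\succ)$ is a vector space with two bilinear products and two linear maps $A\to A\otimes A$ such that, writing $xy=x\prec y+x\succ y$, $\tilde\Delta=\Delta_\prec+\Delta_\succ$, $\tilde\Delta(a)=a'\otimes a''$, $\Delta_\prec(a)=a'_\prec\otimes a''_\prec$, $\Delta_\succ(a)=a'_\succ\otimes a''_\succ$: $(a\prec b)\prec c=a\prec(bc)$, $(a\succ b)\prec c=a\succ(b\prec c)$, $(ab)\succ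 c=a\succ(b\succ c)$; $(\Delta_\prec\otimes \mathrm{Id})\Delta_\prec=(\mathrm{Id}\otimes\tilde\Delta)\Delta_\prec$, $(\Delta_\succ\otimes \mathrm{Id})\Delta_\prec=(\mathrm{Id}\otimes\Delta_\prec)\Delta_\succ$, $(\tilde\Delta\otimes \mathrm{Id})\Delta_\succ=(\mathrm{Id}\otimes\Delta_\succ)\Delta_\succ$; and $$\begin{aligned}\Delta_\succ(a\succ b)&=a'b'_\succ\otimes a''\succ b''_\succ+a'\otimes a''\succ b+b'_\succ\otimes a\succ b''_\succ+ab'_\succ\otimes b''_\succ+a\otimes b,\\ \Delta_\succ(a\prec b)&=a'b'_\succ\otimes a''\prec b''_\succ+a'\otimes a''\prec b+b'_\succ\otimes a\prec b''_\succ,\\ \Delta_\prec(a\succ b)&=a'b'_\prec\otimes a''\succ b''_\prec+ab'_\prec\otimes b''_\prec+b'_\prec\otimes a\succ b''_\prec,\\ \Delta_\prec(a\prec b)&=a'b'_\prec\otimes a''\prec b''_\prec+a'b\otimes a''+b'_\prec\otimes a\prec b''_\prec+b\otimes a.\end{aligned}$$ **Statement.** $(\mathbf{Sh},\succ^{op},\prec^{op},\Delta_\succ^{op},\Delta_\prec^{op})$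 and $(\mathbf{QSh},\succ^{op},\preceq^{op},\Delta_\succ^{op},\Delta_\prec^{op})$ are bidendriform bialgebras, where $op$ means that the two arguments of a product, or the two tensor factors of a coproduct, are exchanged. The map $\Psi$ is a morphism of bidendriform bialgebras from $(\mathbf{Sh},\prec,\succ,\Delta_\prec,\Delta_\succ)$ to $(\mathbf{QSh},\preceq,\succ,\Delta_\prec,\Delta_\succ)$: for all $x,y\in\mathbf{Sh}$, $$\Psi(x\prec y)=\Psi(x)\preceq\Psi(y),\quad \Psi(x\succ y)=\Psi(x)\succ\Psi(y),\quad \Delta_\prec\circ\Psi=(\Psi\otimes\Psi)\circ\Delta_\prec,\quad \Delta_\succ\circ\Psi=(\Psi\otimes\Psi)\circ\Delta_\succ.$$ Moreover $\Psi\circ\Omega'=\Omega\circ\psi$ as linear maps $\mathbf{PBT}\to\mathbf{QSh}$. -/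

import Mathlib

open scoped TensorProduct

noncomputable section

namespace Bidendriform

/-! ### Bidendriform bialgebras -/

/-- Two products and two coproducts on a vector space. -/
structure Ops (K : Type*) [Field K] (A : Type*) [AddCommGroup A] [Module K A] where
  /-- the product `≺` -/
  prec : A →ₗ[K] A →ₗ[K] A
  /-- the product `≻` -/
  succ : A →ₗ[K] A →ₗ[K] A
  /-- the coproduct `Δ_≺` -/
  coprec : A →ₗ[K] A ⊗[K] A
  /-- the coproduct `Δ_≻` -/
  cosucc : A →ₗ[K] A ⊗[K] A

namespace Ops

variable {K : Type*} [Field K] {A : Type*} [AddCommGroup A] [Module K A]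

/-- The total product `≺ + ≻`. -/
def star (S : Ops K A) : A →ₗ[K] A →ₗ[K] A := S.prec + S.succ

/-- The total (reduced) coproduct `Δ_≺ + Δ_≻`. -/
def cotilde (S : Ops K A) : A →ₗ[K] A ⊗[K] A := S.coprec + S.cosucc

/-- `(≻ᵒᵖ, ≺ᵒᵖ, Δ_≻ᵒᵖ, Δ_≺ᵒᵖ)`: the operations are reversed and the two sides are exchanged. -/
def opposite (S : Ops K A) : Ops K A where
  prec := S.succ.flip
  succ := S.prec.flip
  coprec := (TensorProduct.comm K A A).toLinearMap ∘ₗ S.cosucc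
  cosucc := (TensorProduct.comm K A A).toLinearMap ∘ₗ S.coprec

/-- The axioms of a (nonunital, noncounital) bidendriform bialgebra: a dendriform algebra and
dendriform coalgebra, with four compatibilities. In Sweedler notation `a' ⊗ a''` is the total
coproduct and `a'_≺ ⊗ a''_≺`, `a'_≻ ⊗ a''_≻` are the two half-coproducts; juxtaposition is the
total product. -/
structure IsBidendriformBialgebra (S : Ops K A) : Prop where
  prec_prec : ∀ a b c, S.prec (S.prec a b) c = S.prec a (S.star b c)
  succ_prec : ∀ a b c, S.prec (S.succ a b) c = S.succ a (S.prec b c)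
  star_succ : ∀ a b c, S.succ (S.star a b) c = S.succ a (S.succ b c)
  coprec_coprec : (TensorProduct.assoc K A A A).toLinearMap ∘ₗ S.coprec.rTensor A ∘ₗ S.coprec
    = S.cotilde.lTensor A ∘ₗ S.coprec
  cosucc_coprec : (TensorProduct.assoc K A A A).toLinearMap ∘ₗ S.cosucc.rTensor A ∘ₗ S.coprec
    = S.coprec.lTensor A ∘ₗ S.cosucc
  cotilde_cosucc : (TensorProduct.assoc K A A A).toLinearMap ∘ₗ S.cotilde.rTensor A ∘ₗ S.cosucc
    = S.cosucc.lTensor A ∘ₗ S.cosucc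
  /-- `Δ_≻(a ≻ b) = a'b'_≻ ⊗ a''≻b''_≻ + a' ⊗ a''≻b + b'_≻ ⊗ a≻b''_≻ + ab'_≻ ⊗ b''_≻ + a ⊗ b` -/
  cosucc_succ : ∀ a b, S.cosucc (S.succ a b)
    = TensorProduct.map₂ S.star S.succ (S.cotilde a) (S.cosucc b)
      + (S.succ.flip b).lTensor A (S.cotilde a)
      + (S.succ a).lTensor A (S.cosucc b)
      + (S.star a).rTensor A (S.cosucc b)
      + a ⊗ₜ[K] b
  /-- `Δ_≻(a ≺ b) = a'b'_≻ ⊗ a''≺b''_≻ + a' ⊗ a''≺b + b'_≻ ⊗ a≺b''_≻` -/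
  cosucc_prec : ∀ a b, S.cosucc (S.prec a b)
    = TensorProduct.map₂ S.star S.prec (S.cotilde a) (S.cosucc b)
      + (S.prec.flip b).lTensor A (S.cotilde a)
      + (S.prec a).lTensor A (S.cosucc b)
  /-- `Δ_≺(a ≻ b) = a'b'_≺ ⊗ a''≻b''_≺ + ab'_≺ ⊗ b''_≺ + b'_≺ ⊗ a≻b''_≺` -/
  coprec_succ : ∀ a b, S.coprec (S.succ a b)
    = TensorProduct.map₂ S.star S.succ (S.cotilde a) (S.coprec b)
      + (S.star a).rTensor A (S.coprec b)
      + (S.succ a).lTensor A (S.coprec b)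
  /-- `Δ_≺(a ≺ b) = a'b'_≺ ⊗ a''≺b''_≺ + a'b ⊗ a'' + b'_≺ ⊗ a≺b''_≺ + b ⊗ a` -/
  coprec_prec : ∀ a b, S.coprec (S.prec a b)
    = TensorProduct.map₂ S.star S.prec (S.cotilde a) (S.coprec b)
      + (S.star.flip b).rTensor A (S.cotilde a)
      + (S.prec a).lTensor A (S.coprec b)
      + b ⊗ₜ[K] a

/-- A linear map compatible with both products and both coproducts. -/
structure IsBidendriformHom {B : Type*} [AddCommGroup B] [Module K B] (S : Ops K A) (T : Ops K B)
    (f : A →ₗ[K] B) : Prop where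
  map_prec : ∀ a b, f (S.prec a b) = T.prec (f a) (f b)
  map_succ : ∀ a b, f (S.succ a b) = T.succ (f a) (f b)
  map_coprec : T.coprec ∘ₗ f = TensorProduct.map f f ∘ₗ S.coprec
  map_cosucc : T.cosucc ∘ₗ f = TensorProduct.map f f ∘ₗ S.cosucc

end Ops

/-! ### Free vector spaces on subtypes -/

/-- The vector space with basis the elements satisfying `P`. -/
abbrev FreeOn (K : Type*) [Field K] {α : Type*} (P : α → Prop) : Type _ := {x : α // P x} →₀ K

open Classical in
/-- The basis vector attached to `x`. (It is only used for `x` satisfying `P`; the value elsewhere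
is irrelevant.) -/
def basisVec (K : Type*) [Field K] {α : Type*} (P : α → Prop) (x : α) : FreeOn K P :=
  if h : P x then Finsupp.single ⟨x, h⟩ 1 else 0

theorem basisVec_of (K : Type*) [Field K] {α : Type*} {P : α → Prop} {x : α} (h : P x) :
    basisVec K P x = Finsupp.single ⟨x, h⟩ 1 := dif_pos h

/-! ### Packed words -/

/-- A word over the positive integers is packed if its set of letters is `{1, …, m}`. -/
def IsPacked (w : List ℕ) : Prop := ∃ m, w.toFinset = Finset.Icc 1 m

/-- Nonempty packed words: the basis of `QSh`. -/
def IsSurj (w : List ℕ) : Prop := w ≠ [] ∧ IsPacked w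

/-- Nonempty permutations, written as words: the basis of `Sh`. -/
def IsPerm (w : List ℕ) : Prop := w ≠ [] ∧ IsPacked w ∧ w.Nodup

/-- Packing: a letter is replaced by its rank among the letters of the word. -/
def pack (w : List ℕ) : List ℕ := w.map fun x => (w.toFinset.filter (· ≤ x)).card

/-- The largest letter. -/
def maxLetter (w : List ℕ) : ℕ := w.toFinset.sup id

/-- `w_{|{1,…,i}}`: keep the letters `≤ i`. -/
def lower (w : List ℕ) (i : ℕ) : List ℕ := w.filter (· ≤ i)

/-- `Pack(w_{|{i+1,…,max}})`: keep the letters `> i` and pack. -/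
def upper (w : List ℕ) (i : ℕ) : List ℕ := pack (w.filter (i < ·))

open Classical in
/-- The packed words of length `n`. -/
def packedWords (n : ℕ) : Finset (List ℕ) :=
  (Finset.univ.image fun f : Fin n → Fin n => List.ofFn fun i => (f i : ℕ) + 1).filter IsPacked

theorem mem_packedWords {n : ℕ} {w : List ℕ} :
    w ∈ packedWords n ↔ IsPacked w ∧ w.length = n := by
  classical
  simp only [packedWords, Finset.mem_filter, Finset.mem_image, Finset.mem_univ, true_and]
  constructor
  · rintro ⟨⟨f, rfl⟩, h⟩
    exact ⟨h, by simp⟩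
  · rintro ⟨⟨m, hm⟩, rfl⟩
    refine ⟨?_, m, hm⟩
    have hmem : ∀ x, x ∈ w ↔ 1 ≤ x ∧ x ≤ m := fun x => by
      rw [← List.mem_toFinset, hm, Finset.mem_Icc]
    have hlen : m ≤ w.length := by
      have := w.toFinset_card_le
      rw [hm] at this
      simpa using this
    have hw : ∀ i : Fin w.length, 1 ≤ w[i] ∧ w[i] ≤ m := fun i => (hmem _).1 (List.getElem_mem _)
    refine ⟨fun i => ⟨w[i] - 1, by have := hw i; omega⟩, ?_⟩
    apply List.ext_getElem
    · simp
    · intro i h1 h2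
      have := hw ⟨i, h2⟩
      simp at this ⊢
      omega

theorem isPacked_pack (w : List ℕ) : IsPacked (pack w) := by
  refine ⟨w.toFinset.card, ?_⟩
  have hsub : (pack w).toFinset ⊆ Finset.Icc 1 w.toFinset.card := by
    intro y hy
    simp only [pack, List.mem_toFinset, List.mem_map] at hy
    obtain ⟨x, hx, rfl⟩ := hy
    rw [Finset.mem_Icc]
    refine ⟨Finset.card_pos.2 ⟨x, by simp [hx]⟩, Finset.card_filter_le _ _⟩
  refine Finset.eq_of_subset_of_card_le hsub ?_
  have himg : (pack w).toFinset
      = w.toFinset.image fun x => (w.toFinset.filter (· ≤ x)).card := by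
    ext y; simp [pack]
  rw [himg, Finset.card_image_of_injOn]
  · simp
  · have key : ∀ x ∈ w.toFinset, ∀ y ∈ w.toFinset, x < y →
        (w.toFinset.filter (· ≤ x)).card < (w.toFinset.filter (· ≤ y)).card := by
      intro x hx y hy h
      apply Finset.card_lt_card
      rw [Finset.ssubset_iff_of_subset]
      · exact ⟨y, by simpa using hy, by simp [h]⟩
      · intro z hz
        simp only [Finset.mem_filter] at hz ⊢
        exact ⟨hz.1, by omega⟩
    intro x hx y hy hxy
    by_contra hne
    rcases lt_or_gt_of_ne hne with h | h
    · have := key x hx y hy h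
      simp only at hxy
      omega
    · have := key y hy x hx h
      simp only at hxy
      omega

theorem IsPacked.lower {w : List ℕ} (h : IsPacked w) (i : ℕ) : IsPacked (lower w i) := by
  obtain ⟨m, hm⟩ := h
  refine ⟨min m i, ?_⟩
  ext x
  have : x ∈ w ↔ 1 ≤ x ∧ x ≤ m := by rw [← List.mem_toFinset, hm, Finset.mem_Icc]
  simp [Bidendriform.lower, this]
  omega

/-- The words occurring in the coproducts below are nonempty packed words. -/
theorem IsSurj.lower_upper {w : List ℕ} (h : IsSurj w) {i : ℕ} (h1 : 1 ≤ i)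
    (h2 : i < maxLetter w) : IsSurj (lower w i) ∧ IsSurj (upper w i) := by
  obtain ⟨m, hm⟩ := h.2
  have hmem : ∀ x, x ∈ w ↔ 1 ≤ x ∧ x ≤ m := fun x => by
    rw [← List.mem_toFinset, hm, Finset.mem_Icc]
  have him : i < m := by
    rw [maxLetter, Finset.lt_sup_iff] at h2
    obtain ⟨x, hx, hix⟩ := h2
    rw [hm, Finset.mem_Icc] at hx
    exact lt_of_lt_of_le hix hx.2
  refine ⟨⟨?_, h.2.lower i⟩, ?_, isPacked_pack _⟩
  · exact List.ne_nil_of_mem (a := 1) (by simp [lower, hmem, h1]; omega)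
  · have : m ∈ w.filter (i < ·) := by simp [hmem, him]; omega
    simpa [upper, pack] using List.ne_nil_of_mem this

/-- For a permutation, they are nonempty permutations. -/
theorem IsPerm.lower_upper {w : List ℕ} (h : IsPerm w) {i : ℕ} (h1 : 1 ≤ i)
    (h2 : i < maxLetter w) : IsPerm (lower w i) ∧ IsPerm (upper w i) := by
  have hs := IsSurj.lower_upper ⟨h.1, h.2.1⟩ h1 h2
  refine ⟨⟨hs.1.1, hs.1.2, h.2.2.filter _⟩, hs.2.1, hs.2.2, ?_⟩
  refine List.Nodup.map_on ?_ (h.2.2.filter _)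
  intro x hx y hy hxy
  by_contra hne
  have hx' := List.mem_toFinset.2 hx
  have hy' := List.mem_toFinset.2 hy
  have key : ∀ s : Finset ℕ, ∀ x y, y ∈ s → x < y →
      (s.filter (· ≤ x)).card < (s.filter (· ≤ y)).card := by
    intro s x y hy h
    apply Finset.card_lt_card
    rw [Finset.ssubset_iff_of_subset]
    · exact ⟨y, by simpa using hy, by simp [h]⟩
    · intro z hz
      simp only [Finset.mem_filter] at hz ⊢
      exact ⟨hz.1, by omega⟩
  rcases lt_or_gt_of_ne hne with h | h
  · have := key _ x y hy' h
    omega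
  · have := key _ y x hx' h
    omega

/-! ### The vector spaces `Sh` and `QSh` and their operations -/

open Classical in
/-- For words `σ, τ` of lengths `k, l`: the sum of the words `u` of length `k + l` (satisfying `P`)
with `Pack(u(1)…u(k)) = σ`, `Pack(u(k+1)…u(k+l)) = τ`, and such that
`min(u(1)…u(k))` and `min(u(k+1)…u(k+l))` are in the relation `r`. -/
def wordProd (K : Type*) [Field K] (P : List ℕ → Prop) (r : WithTop ℕ → WithTop ℕ → Prop) :
    FreeOn K P →ₗ[K] FreeOn K P →ₗ[K] FreeOn K P :=
  Finsupp.linearCombination K fun σ => Finsupp.linearCombination K fun τ =>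
    ∑ u ∈ (packedWords (σ.1.length + τ.1.length)).filter (fun u => P u ∧
        pack (u.take σ.1.length) = σ.1 ∧ pack (u.drop σ.1.length) = τ.1 ∧
        r (u.take σ.1.length).minimum (u.drop σ.1.length).minimum),
      basisVec K P u

/-- `Δ_≺(σ)`, the sum of `σ_{|{1,…,i}} ⊗ Pack(σ_{|{i+1,…,max σ}})` over `σ(1) ≤ i ≤ max σ - 1`. -/
def wordCoprec (K : Type*) [Field K] (P : List ℕ → Prop) :
    FreeOn K P →ₗ[K] FreeOn K P ⊗[K] FreeOn K P :=
  Finsupp.linearCombination K fun σ => ∑ i ∈ Finset.Ico (σ.1.headD 0) (maxLetter σ.1),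
    basisVec K P (lower σ.1 i) ⊗ₜ[K] basisVec K P (upper σ.1 i)

/-- `Δ_≻(σ)`, the sum of `σ_{|{1,…,i}} ⊗ Pack(σ_{|{i+1,…,max σ}})` over `1 ≤ i ≤ σ(1) - 1`. -/
def wordCosucc (K : Type*) [Field K] (P : List ℕ → Prop) :
    FreeOn K P →ₗ[K] FreeOn K P ⊗[K] FreeOn K P :=
  Finsupp.linearCombination K fun σ => ∑ i ∈ Finset.Ico 1 (σ.1.headD 0),
    basisVec K P (lower σ.1 i) ⊗ₜ[K] basisVec K P (upper σ.1 i)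

/-- The span of the nonempty permutations (augmentation ideal of the Malvenuto-Reutenauer
algebra). -/
abbrev Sh (K : Type*) [Field K] : Type _ := FreeOn K IsPerm

/-- The span of the nonempty packed words (augmentation ideal of the algebra of word
quasi-symmetric functions). -/
abbrev QSh (K : Type*) [Field K] : Type _ := FreeOn K IsSurj

/-- `(Sh, ≺, ≻, Δ_≺, Δ_≻)`. -/
def shOps (K : Type*) [Field K] : Ops K (Sh K) where
  prec := wordProd K IsPerm (· < ·)
  succ := wordProd K IsPerm (· > ·)
  coprec := wordCoprec K IsPerm
  cosucc := wordCosucc K IsPerm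

/-- `(QSh, ⪯, ≻, Δ_≺, Δ_≻)`, where `⪯` is `≺ + •`. -/
def qshOps (K : Type*) [Field K] : Ops K (QSh K) where
  prec := wordProd K IsSurj (· < ·) + wordProd K IsSurj (· = ·)
  succ := wordProd K IsSurj (· > ·)
  coprec := wordCoprec K IsSurj
  cosucc := wordCosucc K IsSurj

/-- The order `τ ≤ σ` on words: same length, every weak inequality between letters of `σ` holds
in `τ`, and every inversion of `σ` is an inversion of `τ`. -/
def WordLE (τ σ : List ℕ) : Prop :=
  τ.length = σ.length ∧ ∀ i < σ.length, ∀ j < σ.length,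
    (σ.getD i 0 ≤ σ.getD j 0 → τ.getD i 0 ≤ τ.getD j 0) ∧
    (i < j → σ.getD i 0 > σ.getD j 0 → τ.getD i 0 > τ.getD j 0)

open Classical in
/-- `Ψ(σ)` is the sum of the packed words `τ ≤ σ`. -/
def Psi (K : Type*) [Field K] : Sh K →ₗ[K] QSh K :=
  Finsupp.linearCombination K fun σ =>
    ∑ τ ∈ (packedWords σ.1.length).filter (fun τ => WordLE τ σ.1), basisVec K IsSurj τ

/-! ### Planar trees -/

/-- Planar rooted trees. -/
inductive PlanarTree : Type
  | node : List PlanarTree → PlanarTree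

namespace PlanarTree

/-- The tree with a single leaf. -/
abbrev leaf : PlanarTree := node []

/-- The subtrees attached to the root. -/
def children : PlanarTree → List PlanarTree
  | node ts => ts

/-- No vertex has exactly one child. -/
inductive Reduced : PlanarTree → Prop
  | node (ts : List PlanarTree) : ts.length ≠ 1 → (∀ t ∈ ts, Reduced t) → Reduced (node ts)

/-- Every vertex has zero or two children. -/
inductive Binary : PlanarTree → Prop
  | leaf : Binary (node [])
  | node (l r : PlanarTree) : Binary l → Binary r → Binary (node [l, r])

mutual
/-- The number of leaves. -/
def numLeaves : PlanarTree → ℕ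
  | node [] => 1
  | node (t :: ts) => numLeaves t + numLeavesList ts
/-- The total number of leaves of a list of trees. -/
def numLeavesList : List PlanarTree → ℕ
  | [] => 0
  | t :: ts => numLeaves t + numLeavesList ts
end

/-- The degree: the number of leaves minus one. -/
def degree (t : PlanarTree) : ℕ := t.numLeaves - 1

open Classical in
mutual
/-- The set `R(t)` of right internal edges: edges between two internal vertices that are the
rightmost outgoing edge of their upper vertex. An edge is given by the address of its lower vertex,
a vertex being addressed by the list of the child indices on the path from the root to it. -/
def rightEdges : PlanarTree → Finset (List ℕ)
  | node ts => rightEdgesList ts 0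
/-- The contribution to `R(t)` of the last children of the root, with indices starting at `i`. -/
def rightEdgesList : List PlanarTree → ℕ → Finset (List ℕ)
  | [], _ => ∅
  | t :: ts, i => (rightEdges t).image (i :: ·) ∪
      (if ts = [] ∧ t ≠ leaf then {[i]} else ∅) ∪ rightEdgesList ts (i + 1)
end

open Classical in
mutual
/-- `t/I`, obtained by contracting the edges in `I`. -/
def contract : PlanarTree → Set (List ℕ) → PlanarTree
  | node ts, I => node (contractList ts 0 I)
/-- The children of the root of `t/I` that come from the last children of the root of `t`, with
indices starting at `i`: when the edge to the child `i` is contracted, this child is replaced by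
the list of its own children. -/
def contractList : List PlanarTree → ℕ → Set (List ℕ) → List PlanarTree
  | [], _, _ => []
  | t :: ts, i, I =>
    (if [i] ∈ I then (contract t {p | i :: p ∈ I}).children else [contract t {p | i :: p ∈ I}])
      ++ contractList ts (i + 1) I
end

open Classical in
/-- The trees `t' ≤ t`, that is, the trees `t/I` with `I ⊆ R(t)`. -/
def treesBelow (t : PlanarTree) : Finset PlanarTree :=
  t.rightEdges.powerset.image fun I => t.contract I

theorem mem_treesBelow {t t' : PlanarTree} :
    t' ∈ t.treesBelow ↔ ∃ I ⊆ t.rightEdges, t' = t.contract I := by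
  classical
  simp [treesBelow, eq_comm]

/-- Schröder trees of degree at least one: the basis of `ST`. -/
def IsSchroder (t : PlanarTree) : Prop := t.Reduced ∧ t ≠ leaf

theorem exists_of_mem_rightEdgesList (ts : List PlanarTree) :
    ∀ (i : ℕ) (p : List ℕ), p ∈ rightEdgesList ts i → ∃ k q, p = k :: q ∧ i ≤ k := by
  induction ts with
  | nil => intro i p h; simp [rightEdgesList] at h
  | cons t ts ih =>
    intro i p h
    simp only [rightEdgesList, Finset.mem_union, Finset.mem_image] at h
    rcases h with (⟨q, -, rfl⟩ | h) | h
    · exact ⟨i, q, rfl, le_rfl⟩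
    · split_ifs at h
      · exact ⟨i, [], by simpa using h, le_rfl⟩
      · simp at h
    · obtain ⟨k, q, hp, hk⟩ := ih (i + 1) p h
      exact ⟨k, q, hp, by omega⟩

theorem cons_mem_rightEdgesList {t : PlanarTree} {ts : List PlanarTree} {i k : ℕ} {p : List ℕ}
    (h : k :: p ∈ rightEdgesList (t :: ts) i) :
    (k = i ∧ p ∈ t.rightEdges) ∨ (k = i ∧ p = [] ∧ t ≠ leaf) ∨
      (i + 1 ≤ k ∧ k :: p ∈ rightEdgesList ts (i + 1)) := by
  simp only [rightEdgesList, Finset.mem_union, Finset.mem_image] at h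
  rcases h with (⟨q, hq, he⟩ | h) | h
  · simp only [List.cons.injEq] at he
    exact Or.inl ⟨he.1.symm, he.2 ▸ hq⟩
  · split_ifs at h with hc
    · simp only [Finset.mem_singleton, List.cons.injEq] at h
      exact Or.inr (Or.inl ⟨h.1, h.2, hc.2⟩)
    · simp at h
  · obtain ⟨k', q, he, hk⟩ := exists_of_mem_rightEdgesList ts _ _ h
    simp only [List.cons.injEq] at he
    exact Or.inr (Or.inr ⟨by omega, h⟩)

theorem contractList_spec (ts : List PlanarTree)
    (hc : ∀ t ∈ ts, ∀ I : Set (List ℕ), (∀ p ∈ I, p ≠ [] → p ∈ t.rightEdges) →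
      (t.contract I).Reduced ∧ (t ≠ leaf → t.contract I ≠ leaf)) :
    ∀ (i : ℕ) (I : Set (List ℕ)),
      (∀ k p, i ≤ k → k :: p ∈ I → k :: p ∈ rightEdgesList ts i) →
      ts.length ≤ (contractList ts i I).length ∧ ∀ t ∈ contractList ts i I, t.Reduced := by
  induction ts with
  | nil => intro i I _; simp [contractList]
  | cons t ts ih =>
    intro i I hI
    have h1 := hc t (by simp) {p | i :: p ∈ I} (by
      intro p hp hne
      rcases cons_mem_rightEdgesList (hI i p le_rfl hp) with h | h | h
      · exact h.2
      · exact absurd h.2.1 hne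
      · omega)
    have h2 := ih (fun s hs => hc s (by simp [hs])) (i + 1) I (by
      intro k p hk hp
      rcases cons_mem_rightEdgesList (hI k p (by omega) hp) with h | h | h
      · omega
      · omega
      · exact h.2)
    rw [contractList]
    split_ifs with hi
    · have ht : t ≠ leaf := by
        rcases cons_mem_rightEdgesList (hI i [] le_rfl hi) with h | h | h
        · exact fun h' => by simp [h', rightEdges, rightEdgesList] at h
        · exact h.2.2
        · omega
      obtain ⟨h3, h4⟩ := h1
      replace h4 := h4 ht
      generalize t.contract {p | i :: p ∈ I} = c at h3 h4
      cases h3 with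
      | node cs hl hcs =>
        have : cs ≠ [] := fun h => h4 (by rw [h])
        have := List.length_pos_iff.2 this
        refine ⟨?_, ?_⟩
        · simp only [children, List.length_append, List.length_cons]
          omega
        · intro s hs
          rcases List.mem_append.1 hs with hs | hs
          · exact hcs s hs
          · exact h2.2 s hs
    · refine ⟨?_, ?_⟩
      · have := h2.1
        simp only [List.length_append, List.length_cons, List.length_nil]
        omega
      · intro s hs
        rcases List.mem_append.1 hs with hs | hs
        · rw [List.mem_singleton.1 hs]; exact h1.1
        · exact h2.2 s hs

/-- Contracting right internal edges of a Schröder tree gives a Schröder tree. -/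
theorem Reduced.contract {t : PlanarTree} (h : t.Reduced) :
    ∀ I : Set (List ℕ), (∀ p ∈ I, p ≠ [] → p ∈ t.rightEdges) →
      (t.contract I).Reduced ∧ (t ≠ leaf → t.contract I ≠ leaf) := by
  induction h with
  | node ts hl _ ih =>
    intro I hI
    have := contractList_spec ts ih 0 I (fun k p _ hp => by
      have := hI _ hp (by simp)
      rwa [rightEdges] at this)
    rw [PlanarTree.contract]
    cases ts with
    | nil => exact ⟨by simpa [contractList] using Reduced.node [] (by simp) (by simp), by simp⟩
    | cons t ts =>
      simp only [List.length_cons] at hl this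
      refine ⟨Reduced.node _ (by omega) this.2, fun _ he => ?_⟩
      rw [leaf, PlanarTree.node.injEq] at he
      rw [he] at this
      simp at this

/-- Planar binary trees of degree at least one: the basis of `PBT`. -/
def IsBin (t : PlanarTree) : Prop := t.Binary ∧ t ≠ leaf

theorem Binary.reduced {t : PlanarTree} (h : t.Binary) : t.Reduced := by
  induction h with
  | leaf => exact Reduced.node [] (by simp) (by simp)
  | node l r _ _ hl hr =>
    refine Reduced.node _ (by simp) fun t ht => ?_
    simp only [List.mem_cons, List.not_mem_nil, or_false] at ht
    rcases ht with rfl | rfl <;> assumption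

/-- All the trees below a planar binary tree are Schröder trees. -/
theorem IsBin.isSchroder {t t' : PlanarTree} (h : t.IsBin) (h' : t' ∈ t.treesBelow) :
    t'.IsSchroder := by
  obtain ⟨I, hI, rfl⟩ := mem_treesBelow.1 h'
  have := h.1.reduced.contract I fun p hp _ => hI hp
  exact ⟨this.1, this.2 h.2⟩

end PlanarTree

open PlanarTree

theorem length_lt_of_mem_splitOn {w b : List ℕ} {a : ℕ} (ha : a ∈ w) (hb : b ∈ w.splitOn a) :
    b.length < w.length := by
  have aux : ∀ (w b : List ℕ), b ∈ w.splitOn a → b.length ≤ w.length := by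
    intro w
    induction w with
    | nil => intro b hb; simp at hb; simp [hb]
    | cons x w ih =>
      intro b hb
      rw [List.splitOn_cons_eq_if_modifyHead] at hb
      split_ifs at hb
      · rcases List.mem_cons.1 hb with rfl | hb
        · simp
        · have := ih b hb
          simp only [List.length_cons]; omega
      · generalize hs : w.splitOn a = l at hb ih
        cases l with
        | nil => simp at hb
        | cons c l =>
          rcases List.mem_cons.1 hb with rfl | hb
          · have := ih c (by simp)
            simpa using this
          · have := ih b (by simp [hb])
            simp only [List.length_cons]; omega
  obtain ⟨xs, ys, rfl⟩ := List.append_of_mem ha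
  rw [List.splitOn_append_cons_self] at hb
  rcases List.mem_append.1 hb with hb | hb <;>
  · have := aux _ _ hb
    simp only [List.length_append, List.length_cons]; omega

/-- The map `ϱ` from packed words to reduced trees: a nonempty packed word is cut at all the
occurrences of the letter `1`, and the trees of the packed blocks are grafted on a common root. -/
def rho (w : List ℕ) : PlanarTree :=
  if _h : 1 ∈ w then node ((w.splitOn 1).attach.map fun b => rho (pack b.1)) else leaf
termination_by w.length
decreasing_by
  rw [pack, List.length_map]
  exact length_lt_of_mem_splitOn ‹_› b.2

/-- The span of planar binary trees (of degree at least one). -/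
abbrev PBT (K : Type*) [Field K] : Type _ := FreeOn K IsBin

/-- The span of Schröder trees (of degree at least one). -/
abbrev ST (K : Type*) [Field K] : Type _ := FreeOn K IsSchroder

/-- `ψ(t)` is the sum of the Schröder trees `t' ≤ t`. -/
def psi (K : Type*) [Field K] : PBT K →ₗ[K] ST K :=
  Finsupp.linearCombination K fun t => ∑ t' ∈ t.1.treesBelow, basisVec K IsSchroder t'

open Classical in
/-- `Ω(t)` is the sum of the packed words `σ` with `ϱ(σ) = t`. -/
def Omega (K : Type*) [Field K] : ST K →ₗ[K] QSh K :=
  Finsupp.linearCombination K fun t =>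
    ∑ σ ∈ (packedWords t.1.degree).filter (fun σ => rho σ = t.1), basisVec K IsSurj σ

open Classical in
/-- `Ω'(t)` is the sum of the permutations `σ` with `ϱ(σ) = t`. -/
def Omega' (K : Type*) [Field K] : PBT K →ₗ[K] Sh K :=
  Finsupp.linearCombination K fun t =>
    ∑ σ ∈ (packedWords t.1.degree).filter (fun σ => IsPerm σ ∧ rho σ = t.1), basisVec K IsPerm σ

end Bidendriform

end

open scoped TensorProduct

noncomputable section

-- Read an element x of `QSh` as a function on all words, packed or not: its value x(w) is the
-- coefficient of Pack(w) in x (`coeff`). Such a function sees only the relative order of letters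
-- and vanishes at the empty word. In this language the operations are dual to cutting and
-- shuffling. The value of a product at w is the sum of x(p)y(q) over the cuts w = pq, restricted by
-- a comparison of min p and min q (`coeff_wordProd`). If all letters of u lie below those of v, the
-- coefficient of the total coproduct of x at (u, v) is the sum of x over the shuffles of u and v;
-- Δ_≺ and Δ_≻ keep the shuffles whose first letter comes from u, respectively from v
-- (`coeff₂_wordCoprec`, `coeff₂_wordCosucc`). Pairs and triples of words of this kind separate
-- tensors, since the letters of the later words may be shifted upwards (`coeff₂_ext`,
-- `coeff₃_ext`).
--
-- For `QSh` the axioms then become facts about words. The dendriform ones are the associativity of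
-- cutting together with order facts about three minima (`minProd_assoc`). The codendriform ones are
-- the associativity of shuffling, sorted by the word that provides the first letter. The
-- compatibilities say that cutting a shuffle amounts to shuffling the cuts
-- (`shuffleSum_deconcSum`); their exceptional terms are those in which some of the pieces are
-- empty.
--
-- A packed word τ satisfies τ ≤ σ, for a permutation σ, exactly when σ is the standardization of τ,
-- ties being broken from left to right. Hence Ψ(x)(w) = x(std w) (`IsStd.coeff_Psi`).
-- Standardization is compatible with cuts and with shuffles of u below v, and it turns the weak
-- comparison of the minima of two consecutive words into a strict one, so Ψ is a morphism. It is
-- injective, and the axioms for `Sh` are pulled back along it from those of `QSh`.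
--
-- For the square, the point is that ϱ(std w) = t if and only if ϱ(w) ≤ t, for t binary
-- (`IsStd.packedTree_mem_treesBelow_iff`). Cut w at its leftmost minimum: the minimal letter occurs
-- again on the right exactly when the right edge at the root has been contracted.

namespace Bidendriform

/-! ### Sums over shuffles and over deconcatenations -/

section Shuffle

variable {K : Type*} [CommRing K] {α β : Type*}

/-- The sum of the values of `f` at all the shuffles of two words. -/
def shuffleSum (f : List α → K) : List α → List α → K
  | [], v => f v
  | a :: u, [] => f (a :: u)
  | a :: u, b :: v =>
    shuffleSum (fun p => f (a :: p)) u (b :: v) + shuffleSum (fun p => f (b :: p)) (a :: u) v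
termination_by u v => u.length + v.length

/-- The sum of the values of `f` at the shuffles starting with the first letter of the first
word. -/
def leftShuffleSum (f : List α → K) : List α → List α → K
  | [], _ => 0
  | a :: u, v => shuffleSum (fun p => f (a :: p)) u v

/-- The sum of the values of `f` at the shuffles starting with the first letter of the second
word. -/
def rightShuffleSum (f : List α → K) : List α → List α → K
  | _, [] => 0
  | u, b :: v => shuffleSum (fun p => f (b :: p)) u v

/-- The sum of the values of `F` at all the pairs `(p, q)` with `p ++ q = w`. -/
def deconcSum (F : List α → List α → K) : List α → K
  | [] => F [] []
  | a :: w => F [] (a :: w) + deconcSum (fun p q => F (a :: p) q) w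

@[simp] theorem shuffleSum_nil_left (f : List α → K) (v : List α) : shuffleSum f [] v = f v := by
  rw [shuffleSum]

@[simp] theorem shuffleSum_nil_right (f : List α → K) (u : List α) : shuffleSum f u [] = f u := by
  cases u <;> rw [shuffleSum]

theorem shuffleSum_cons_cons (f : List α → K) (a b : α) (u v : List α) :
    shuffleSum f (a :: u) (b :: v) =
      shuffleSum (fun p => f (a :: p)) u (b :: v)
        + shuffleSum (fun p => f (b :: p)) (a :: u) v := by
  rw [shuffleSum]

@[simp] theorem leftShuffleSum_nil (f : List α → K) (v : List α) : leftShuffleSum f [] v = 0 := rfl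

theorem leftShuffleSum_cons (f : List α → K) (a : α) (u v : List α) :
    leftShuffleSum f (a :: u) v = shuffleSum (fun p => f (a :: p)) u v := rfl

@[simp] theorem rightShuffleSum_nil (f : List α → K) (u : List α) : rightShuffleSum f u [] = 0 := by
  cases u <;> rfl

theorem rightShuffleSum_cons (f : List α → K) (b : α) (u v : List α) :
    rightShuffleSum f u (b :: v) = shuffleSum (fun p => f (b :: p)) u v := by
  cases u <;> rfl

/-- The empty shuffle of two empty words has no first letter and is in neither half, hence the
condition on `f []`. -/
theorem shuffleSum_eq_left_add_right {f : List α → K} (hf : f [] = 0) (u v : List α) :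
    shuffleSum f u v = leftShuffleSum f u v + rightShuffleSum f u v := by
  cases u <;> cases v <;>
    simp [shuffleSum_cons_cons, leftShuffleSum_cons, rightShuffleSum_cons, hf]

/-- A shuffle rearranges the letters of `u ++ v` and keeps the order inside each word. The relation
`R` is trivial in most uses; for the coproducts and Ψ it is `StdRel`, which has to hold along every
shuffle. -/
theorem shuffleSum_congr (R : α → α → Prop) {u v : List α} (hu : u.Pairwise R) (hv : v.Pairwise R)
    (huv : ∀ a ∈ u, ∀ b ∈ v, R a b ∧ R b a) {f g : List α → K}
    (h : ∀ p, p.Perm (u ++ v) → p.Pairwise R → f p = g p) :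
    shuffleSum f u v = shuffleSum g u v := by
  induction f, u, v using shuffleSum.induct generalizing g with
  | case1 f v => simpa using h v (by simp) hv
  | case2 f a u => simpa using h (a :: u) (by simp) hu
  | case3 f a u b v ih1 ih2 =>
    rw [shuffleSum_cons_cons, shuffleSum_cons_cons]
    have hu' := List.pairwise_cons.1 hu
    have hv' := List.pairwise_cons.1 hv
    congr 1
    · refine ih1 hu'.2 hv (fun x hx y hy => huv x (by simp [hx]) y hy) fun p hp hpR => ?_
      refine h _ (hp.cons a) (List.pairwise_cons.2 ⟨fun x hx => ?_, hpR⟩)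
      rcases List.mem_append.1 (hp.mem_iff.1 hx) with hx | hx
      · exact hu'.1 x hx
      · exact (huv a (by simp) x hx).1
    · refine ih2 hu hv'.2 (fun x hx y hy => huv x hx y (by simp [hy])) fun p hp hpR => ?_
      refine h _ ((hp.cons b).trans List.perm_middle.symm)
        (List.pairwise_cons.2 ⟨fun x hx => ?_, hpR⟩)
      rcases List.mem_append.1 (hp.mem_iff.1 hx) with hx | hx
      · exact (huv x hx b (by simp)).2
      · exact hv'.1 x hx

theorem leftShuffleSum_congr (R : α → α → Prop) {u v : List α} (hu : u.Pairwise R)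
    (hv : v.Pairwise R) (huv : ∀ a ∈ u, ∀ b ∈ v, R a b ∧ R b a) {f g : List α → K}
    (h : ∀ p, p.Perm (u ++ v) → p.Pairwise R → f p = g p) :
    leftShuffleSum f u v = leftShuffleSum g u v := by
  cases u with
  | nil => rfl
  | cons a u =>
    have hu' := List.pairwise_cons.1 hu
    refine shuffleSum_congr R hu'.2 hv (fun x hx y hy => huv x (by simp [hx]) y hy)
      fun p hp hpR => h _ (hp.cons a) (List.pairwise_cons.2 ⟨fun x hx => ?_, hpR⟩)
    rcases List.mem_append.1 (hp.mem_iff.1 hx) with hx | hx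
    · exact hu'.1 x hx
    · exact (huv a (by simp) x hx).1

theorem rightShuffleSum_congr (R : α → α → Prop) {u v : List α} (hu : u.Pairwise R)
    (hv : v.Pairwise R) (huv : ∀ a ∈ u, ∀ b ∈ v, R a b ∧ R b a) {f g : List α → K}
    (h : ∀ p, p.Perm (u ++ v) → p.Pairwise R → f p = g p) :
    rightShuffleSum f u v = rightShuffleSum g u v := by
  cases v with
  | nil => simp
  | cons b v =>
    rw [rightShuffleSum_cons, rightShuffleSum_cons]
    have hv' := List.pairwise_cons.1 hv
    refine shuffleSum_congr R hu hv'.2 (fun x hx y hy => huv x hx y (by simp [hy]))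
      fun p hp hpR => h _ ((hp.cons b).trans List.perm_middle.symm)
        (List.pairwise_cons.2 ⟨fun x hx => ?_, hpR⟩)
    rcases List.mem_append.1 (hp.mem_iff.1 hx) with hx | hx
    · exact (huv x hx b (by simp)).2
    · exact hv'.1 x hx

theorem shuffleSum_map (φ : β → α) (f : List α → K) (u v : List β) :
    shuffleSum f (u.map φ) (v.map φ) = shuffleSum (fun p => f (p.map φ)) u v := by
  induction u generalizing f v with
  | nil => simp
  | cons a u ihu =>
    induction v generalizing f with
    | nil => simp
    | cons b v ihv =>
    have ih1 := ihu (fun p => f (φ a :: p)) (b :: v)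
    have ih2 := ihv (fun p => f (φ b :: p))
    simp only [List.map_cons, shuffleSum_cons_cons] at ih1 ih2 ⊢
    rw [ih1, ih2]

theorem leftShuffleSum_map (φ : β → α) (f : List α → K) (u v : List β) :
    leftShuffleSum f (u.map φ) (v.map φ) = leftShuffleSum (fun p => f (p.map φ)) u v := by
  cases u <;> simp [leftShuffleSum_cons, shuffleSum_map]

theorem rightShuffleSum_map (φ : β → α) (f : List α → K) (u v : List β) :
    rightShuffleSum f (u.map φ) (v.map φ) = rightShuffleSum (fun p => f (p.map φ)) u v := by
  cases v <;> simp [rightShuffleSum_cons, shuffleSum_map]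

theorem shuffleSum_add (f g : List α → K) (u v : List α) :
    shuffleSum (fun p => f p + g p) u v = shuffleSum f u v + shuffleSum g u v := by
  induction f, u, v using shuffleSum.induct generalizing g with
  | case1 f v => simp
  | case2 f a u => simp
  | case3 f a u b v ih1 ih2 =>
    rw [shuffleSum_cons_cons, shuffleSum_cons_cons, shuffleSum_cons_cons, ih1, ih2]
    ring

theorem shuffleSum_mul_left (c : K) (f : List α → K) (u v : List α) :
    shuffleSum (fun p => c * f p) u v = c * shuffleSum f u v := by
  induction f, u, v using shuffleSum.induct with
  | case1 f v => simp
  | case2 f a u => simp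
  | case3 f a u b v ih1 ih2 => rw [shuffleSum_cons_cons, shuffleSum_cons_cons, ih1, ih2, mul_add]

theorem leftShuffleSum_add (f g : List α → K) (u v : List α) :
    leftShuffleSum (fun p => f p + g p) u v = leftShuffleSum f u v + leftShuffleSum g u v := by
  cases u <;> simp [leftShuffleSum_cons, shuffleSum_add]

theorem rightShuffleSum_add (f g : List α → K) (u v : List α) :
    rightShuffleSum (fun p => f p + g p) u v = rightShuffleSum f u v + rightShuffleSum g u v := by
  cases v <;> simp [rightShuffleSum_cons, shuffleSum_add]

theorem leftShuffleSum_mul_left (c : K) (f : List α → K) (u v : List α) :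
    leftShuffleSum (fun p => c * f p) u v = c * leftShuffleSum f u v := by
  cases u <;> simp [leftShuffleSum_cons, shuffleSum_mul_left]

theorem rightShuffleSum_mul_left (c : K) (f : List α → K) (u v : List α) :
    rightShuffleSum (fun p => c * f p) u v = c * rightShuffleSum f u v := by
  cases v <;> simp [rightShuffleSum_cons, shuffleSum_mul_left]

/-- Both sides run over the shuffles of three words; the induction separates them by the word that
provides the first letter. -/
theorem shuffleSum_assoc (f : List α → K) (u v w : List α) :
    shuffleSum (fun p => shuffleSum f p w) u v = shuffleSum (fun q => shuffleSum f u q) v w := by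
  induction h : u.length + v.length + w.length using Nat.strong_induction_on
    generalizing f u v w with
  | _ n ih =>
  subst h
  rcases u with - | ⟨a, u⟩
  · simp
  rcases v with - | ⟨b, v⟩
  · simp
  rcases w with - | ⟨c, w⟩
  · simp
  have e1 := ih _ (by simp) (fun p => f (a :: p)) u (b :: v) (c :: w) rfl
  have e2 := ih _ (by simp) (fun p => f (b :: p)) (a :: u) v (c :: w) rfl
  have e3 := ih _ (by simp) (fun p => f (c :: p)) (a :: u) (b :: v) w rfl
  rw [shuffleSum_cons_cons (f := fun p => shuffleSum f p (c :: w)),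
    shuffleSum_cons_cons (f := fun q => shuffleSum f (a :: u) q)]
  simp only [shuffleSum_cons_cons f, shuffleSum_add]
  rw [shuffleSum_cons_cons (f := fun p => shuffleSum (fun p => f (c :: p)) p w)] at e3
  rw [shuffleSum_cons_cons (f := fun q => shuffleSum (fun p => f (a :: p)) u q)] at e1
  linear_combination e1 + e2 + e3

/-- Here the first letter of the triple shuffle comes from `u`; in the next two lemmas it comes from
`v`, then from `w`. These are the dual forms of the three codendriform axioms. -/
theorem leftShuffleSum_left (f : List α → K) (u v w : List α) :
    leftShuffleSum (fun p => leftShuffleSum f p w) u v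
      = shuffleSum (fun q => leftShuffleSum f u q) v w := by
  cases u with
  | nil =>
    simpa using (shuffleSum_mul_left (0 : K) (fun _ => 0) v w).symm
  | cons a u => simp only [leftShuffleSum_cons, shuffleSum_assoc]

theorem rightShuffleSum_left (f : List α → K) (u v w : List α) :
    rightShuffleSum (fun p => leftShuffleSum f p w) u v
      = leftShuffleSum (fun q => rightShuffleSum f u q) v w := by
  cases v with
  | nil => simp
  | cons b v => simp only [leftShuffleSum_cons, rightShuffleSum_cons, shuffleSum_assoc]

theorem shuffleSum_right (f : List α → K) (u v w : List α) :
    shuffleSum (fun p => rightShuffleSum f p w) u v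
      = rightShuffleSum (fun q => rightShuffleSum f u q) v w := by
  cases w with
  | nil => simpa using (shuffleSum_mul_left (0 : K) (fun _ => 0) u v)
  | cons c w => simp only [rightShuffleSum_cons, shuffleSum_assoc]

-- Sums over cuts of a word, and their exchange with shuffles.

@[simp] theorem deconcSum_nil (F : List α → List α → K) : deconcSum F [] = F [] [] := rfl

theorem deconcSum_cons (F : List α → List α → K) (a : α) (w : List α) :
    deconcSum F (a :: w) = F [] (a :: w) + deconcSum (fun p q => F (a :: p) q) w := rfl

theorem deconcSum_eq_sum (F : List α → List α → K) (w : List α) :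
    deconcSum F w = ∑ i ∈ Finset.range (w.length + 1), F (w.take i) (w.drop i) := by
  induction w generalizing F with
  | nil => simp
  | cons a w ih => rw [deconcSum_cons, ih, List.length_cons, Finset.sum_range_succ' _ (w.length + 1), add_comm]; simp

theorem deconcSum_congr {F G : List α → List α → K} {w : List α}
    (h : ∀ p q, p ++ q = w → F p q = G p q) : deconcSum F w = deconcSum G w := by
  simp only [deconcSum_eq_sum]
  exact Finset.sum_congr rfl fun i _ => h _ _ (List.take_append_drop i w)

theorem deconcSum_add (F G : List α → List α → K) (w : List α) :
    deconcSum (fun p q => F p q + G p q) w = deconcSum F w + deconcSum G w := by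
  simp only [deconcSum_eq_sum, Finset.sum_add_distrib]

theorem deconcSum_mul_left (c : K) (F : List α → List α → K) (w : List α) :
    deconcSum (fun p q => c * F p q) w = c * deconcSum F w := by
  simp only [deconcSum_eq_sum, Finset.mul_sum]

theorem deconcSum_mul_right (c : K) (F : List α → List α → K) (w : List α) :
    deconcSum (fun p q => F p q * c) w = deconcSum F w * c := by
  simp only [deconcSum_eq_sum, Finset.sum_mul]

@[simp] theorem deconcSum_zero (w : List α) : deconcSum (fun _ _ => (0 : K)) w = 0 := by
  simp [deconcSum_eq_sum]

/-- Both sides run over the ways to cut `w` into three consecutive pieces. -/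
theorem deconcSum_assoc (G : List α → List α → List α → K) (w : List α) :
    deconcSum (fun p r => deconcSum (fun p₁ p₂ => G p₁ p₂ r) p) w
      = deconcSum (fun p q => deconcSum (fun q₁ q₂ => G p q₁ q₂) q) w := by
  induction w generalizing G with
  | nil => rfl
  | cons a w ih =>
    simp only [deconcSum_cons, deconcSum_nil, deconcSum_add, ih (fun p => G (a :: p)), add_assoc]

/-- A cut of a shuffle induces cuts of `u` and `v`; its front is a shuffle of the two fronts and its
back a shuffle of the two backs, and this correspondence is bijective. All the compatibilities
between products and coproducts come from here. -/
theorem shuffleSum_deconcSum (F : List α → List α → K) (u v : List α) :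
    shuffleSum (deconcSum F) u v = deconcSum (fun u₁ u₂ => deconcSum (fun v₁ v₂ =>
      shuffleSum (fun p => shuffleSum (F p) u₂ v₂) u₁ v₁) v) u := by
  induction u generalizing F v with
  | nil => simp
  | cons a u ihu =>
    induction v generalizing F with
    | nil => simp
    | cons b v ihv =>
    have ih1 := ihu (fun p => F (a :: p)) (b :: v)
    have ih2 := ihv (fun p => F (b :: p))
    rw [shuffleSum_cons_cons]
    simp only [deconcSum_cons (F := F), shuffleSum_add, ih1, ih2]
    simp only [deconcSum_cons, deconcSum_add, shuffleSum_cons_cons, shuffleSum_nil_left,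
      shuffleSum_nil_right]
    ring

/-- Once empty fronts are discarded by `hF`, the first letter of the shuffle lies in the front
piece, so the restriction on its origin concerns the fronts only. -/
theorem leftShuffleSum_deconcSum {F : List α → List α → K} (hF : ∀ q, F [] q = 0)
    (u v : List α) :
    leftShuffleSum (deconcSum F) u v = deconcSum (fun u₁ u₂ => deconcSum (fun v₁ v₂ =>
      leftShuffleSum (fun p => shuffleSum (F p) u₂ v₂) u₁ v₁) v) u := by
  cases u with
  | nil => simp
  | cons a u =>
    simp only [leftShuffleSum_cons, deconcSum_cons, hF, zero_add, leftShuffleSum_nil,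
      deconcSum_zero, shuffleSum_deconcSum]

theorem rightShuffleSum_deconcSum {F : List α → List α → K} (hF : ∀ q, F [] q = 0)
    (u v : List α) :
    rightShuffleSum (deconcSum F) u v = deconcSum (fun u₁ u₂ => deconcSum (fun v₁ v₂ =>
      rightShuffleSum (fun p => shuffleSum (F p) u₂ v₂) u₁ v₁) v) u := by
  cases v with
  | nil => simp
  | cons b v =>
    simp only [rightShuffleSum_cons, deconcSum_cons, hF, zero_add, rightShuffleSum_nil,
      shuffleSum_deconcSum]

open Classical in
/-- The indicator of a proposition. -/
def ind (K : Type*) [CommRing K] (p : Prop) : K := if p then 1 else 0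

theorem ind_true {p : Prop} (h : p) : ind K p = 1 := if_pos h

theorem ind_false {p : Prop} (h : ¬p) : ind K p = 0 := if_neg h

theorem ind_mul_ind (p q : Prop) : ind K p * ind K q = ind K (p ∧ q) := by
  by_cases hp : p <;> by_cases hq : q <;> simp [ind, hp, hq]

theorem ind_congr {p q : Prop} (h : p ↔ q) : ind K p = ind K q := by rw [propext h]

theorem deconcSum_ind_left (F : List α → List α → K) (w : List α) :
    deconcSum (fun p q => ind K (p = []) * F p q) w = F [] w := by
  cases w <;> simp [deconcSum_cons, ind]

theorem deconcSum_ind_right (F : List α → List α → K) (w : List α) :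
    deconcSum (fun p q => ind K (q = []) * F p q) w = F w [] := by
  induction w generalizing F with
  | nil => simp [ind]
  | cons a w ih => rw [deconcSum_cons, ih (fun p => F (a :: p))]; simp [ind]

end Shuffle

end Bidendriform

namespace Bidendriform

/-! ### Packing -/

section Pack

variable {α : Type*}

theorem card_image_le_of_forall [DecidableEq α] {β γ : Type*} [DecidableEq β] [DecidableEq γ]
    (T : Finset α) (f : α → β) (g : α → γ)
    (h : ∀ x ∈ T, ∀ y ∈ T, g x = g y → f x = f y) : (T.image f).card ≤ (T.image g).card := by
  refine Finset.card_le_card_of_forall_subsingleton (fun b c => ∃ x ∈ T, f x = b ∧ g x = c)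
    (fun b hb => ?_) fun c _ b hb b' hb' => ?_
  · obtain ⟨x, hx, rfl⟩ := Finset.mem_image.1 hb
    exact ⟨g x, Finset.mem_image_of_mem _ hx, x, hx, rfl, rfl⟩
  · obtain ⟨-, x, hx, rfl, hxc⟩ := hb
    obtain ⟨-, y, hy, rfl, hyc⟩ := hb'
    exact h x hx y hy (hxc.trans hyc.symm)

/-- Packing depends only on the relative order of the letters: the rank of `f x` counts the distinct
values of `f` on those `y` with `f y ≤ f x`, and neither this set nor the coincidences of values
change from `f` to `g`. -/
theorem pack_map_congr (z : List α) (f g : α → ℕ)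
    (h : ∀ x ∈ z, ∀ y ∈ z, f x ≤ f y ↔ g x ≤ g y) : pack (z.map f) = pack (z.map g) := by
  classical
  simp only [pack, List.map_map]
  refine List.map_congr_left fun x hx => ?_
  have key : ∀ k : α → ℕ, (z.map k).toFinset.filter (· ≤ k x)
      = (z.toFinset.filter fun y => k y ≤ k x).image k := by
    intro k
    ext b
    simp only [Finset.mem_filter, List.mem_toFinset, List.mem_map, Finset.mem_image]
    constructor
    · rintro ⟨⟨y, hy, rfl⟩, hb⟩; exact ⟨y, ⟨hy, hb⟩, rfl⟩
    · rintro ⟨y, ⟨hy, hb⟩, rfl⟩; exact ⟨⟨y, hy, rfl⟩, hb⟩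
  simp only [Function.comp_apply, key]
  have hT : (z.toFinset.filter fun y => f y ≤ f x) = z.toFinset.filter fun y => g y ≤ g x :=
    Finset.filter_congr fun y hy => h y (List.mem_toFinset.1 hy) x hx
  rw [hT]
  apply le_antisymm <;> refine card_image_le_of_forall _ _ _ fun y hy y' hy' e => ?_ <;>
  · simp only [Finset.mem_filter, List.mem_toFinset] at hy hy'
    have h1 := h y hy.1 y' hy'.1
    have h2 := h y' hy'.1 y hy.1
    omega

/-- The rank of a letter in a word. -/
def letterRank (w : List ℕ) (x : ℕ) : ℕ := (w.toFinset.filter (· ≤ x)).card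

theorem pack_eq_map (w : List ℕ) : pack w = w.map (letterRank w) := rfl

theorem letterRank_le_iff (w : List ℕ) {x y : ℕ} (hx : x ∈ w) :
    letterRank w x ≤ letterRank w y ↔ x ≤ y := by
  constructor
  · contrapose!
    intro h
    apply Finset.card_lt_card
    rw [Finset.ssubset_iff_of_subset]
    · exact ⟨x, by simpa using hx, by simp [h]⟩
    · intro z hz
      simp only [Finset.mem_filter] at hz ⊢
      exact ⟨hz.1, by omega⟩
  · intro h
    apply Finset.card_le_card
    intro z hz
    simp only [Finset.mem_filter] at hz ⊢
    exact ⟨hz.1, by omega⟩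

theorem pack_map_of_le_iff {w : List ℕ} {f : ℕ → ℕ}
    (h : ∀ x ∈ w, ∀ y ∈ w, f x ≤ f y ↔ x ≤ y) : pack (w.map f) = pack w := by
  simpa using pack_map_congr w f id h

theorem pack_map_letterRank {w v : List ℕ} (h : ∀ x ∈ v, x ∈ w) :
    pack (v.map (letterRank w)) = pack v :=
  pack_map_of_le_iff fun x hx _ _ => letterRank_le_iff w (h x hx)

@[simp] theorem length_pack (w : List ℕ) : (pack w).length = w.length := by simp [pack]

@[simp] theorem pack_nil : pack [] = [] := rfl

@[simp] theorem pack_eq_nil {w : List ℕ} : pack w = [] ↔ w = [] := by simp [pack]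

theorem pack_take_pack (w : List ℕ) (i : ℕ) : pack ((pack w).take i) = pack (w.take i) := by
  rw [pack_eq_map w, ← List.map_take, pack_map_letterRank fun x hx => List.mem_of_mem_take hx]

theorem pack_drop_pack (w : List ℕ) (i : ℕ) : pack ((pack w).drop i) = pack (w.drop i) := by
  rw [pack_eq_map w, ← List.map_drop, pack_map_letterRank fun x hx => List.mem_of_mem_drop hx]

theorem IsPacked.mem_iff {w : List ℕ} {m : ℕ} (h : w.toFinset = Finset.Icc 1 m) (x : ℕ) :
    x ∈ w ↔ 1 ≤ x ∧ x ≤ m := by rw [← List.mem_toFinset, h, Finset.mem_Icc]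

theorem IsPacked.pack_eq {w : List ℕ} (h : IsPacked w) : pack w = w := by
  obtain ⟨m, hm⟩ := h
  have : ∀ x ∈ w, letterRank w x = x := by
    intro x hx
    have hx' := (IsPacked.mem_iff hm x).1 hx
    have : (Finset.Icc 1 m).filter (· ≤ x) = Finset.Icc 1 x := by
      ext y; simp; omega
    rw [letterRank, hm, this]
    simp
  rw [pack_eq_map]
  exact (List.map_congr_left this).trans (List.map_id _)

theorem isSurj_pack {w : List ℕ} (h : w ≠ []) : IsSurj (pack w) :=
  ⟨by simpa using h, isPacked_pack w⟩

theorem nodup_pack {w : List ℕ} (h : w.Nodup) : (pack w).Nodup :=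
  h.map_on fun _ hx _ hy e =>
    le_antisymm ((letterRank_le_iff w hx).1 e.le) ((letterRank_le_iff w hy).1 e.ge)

theorem isPerm_pack {w : List ℕ} (h : w ≠ []) (h' : w.Nodup) : IsPerm (pack w) :=
  ⟨by simpa using h, isPacked_pack w, nodup_pack h'⟩

/-- Removes `WithTop` from the comparison, so that it can be transported letter by letter. Empty
words are covered, their minimum being ⊤. -/
theorem minimum_lt_minimum_iff {p q : List ℕ} :
    p.minimum < q.minimum ↔ ∃ a ∈ p, ∀ b ∈ q, a < b := by
  constructor
  · intro h
    obtain ⟨a, ha⟩ := WithTop.ne_top_iff_exists.1 (ne_top_of_lt h)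
    refine ⟨a, List.minimum_mem ha.symm, fun b hb => ?_⟩
    have := List.minimum_le_of_mem' hb
    rw [← ha] at h
    exact WithTop.coe_lt_coe.1 (h.trans_le this)
  · rintro ⟨a, ha, h⟩
    refine (List.minimum_le_of_mem' ha).trans_lt ?_
    rcases q with - | ⟨b, q⟩
    · simp
    · obtain ⟨c, hc⟩ := WithTop.ne_top_iff_exists.1
        (List.minimum_ne_top_of_ne_nil (List.cons_ne_nil b q))
      rw [← hc]
      exact WithTop.coe_lt_coe.2 (h c (List.minimum_mem hc.symm))

theorem minimum_map_lt_minimum_map {p q : List ℕ} {f : ℕ → ℕ}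
    (h : ∀ x ∈ p ++ q, ∀ y ∈ p ++ q, f x ≤ f y ↔ x ≤ y) :
    (p.map f).minimum < (q.map f).minimum ↔ p.minimum < q.minimum := by
  simp only [minimum_lt_minimum_iff, List.mem_map, exists_exists_and_eq_and,
    forall_exists_index, and_imp, forall_apply_eq_imp_iff₂]
  refine exists_congr fun a => and_congr_right fun ha => forall₂_congr fun b hb => ?_
  have := h b (by simp [hb]) a (by simp [ha])
  omega

theorem pack_eq_map_sub {w : List ℕ} {m n : ℕ} (h : ∀ x, x ∈ w ↔ m < x ∧ x ≤ n) :
    pack w = w.map (· - m) := by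
  rw [pack_eq_map]
  refine List.map_congr_left fun x hx => ?_
  have : w.toFinset.filter (· ≤ x) = Finset.Ioc m x := by
    ext y
    have := (h x).1 hx
    simp [h]
    omega
  simp [letterRank, this]

/-- When the letters fill an interval starting just above `m`, packing is translation by `m`, which
is reversible. -/
theorem eq_of_pack_eq {v w : List ℕ} {m n n' : ℕ} (hv : ∀ x, x ∈ v ↔ m < x ∧ x ≤ n)
    (hw : ∀ x, x ∈ w ↔ m < x ∧ x ≤ n') (h : pack v = pack w) : v = w := by
  rw [pack_eq_map_sub hv, pack_eq_map_sub hw] at h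
  have key : ∀ l : List ℕ, (∀ x ∈ l, m < x) → (l.map (· - m)).map (· + m) = l := by
    intro l hl
    rw [List.map_map]
    refine (List.map_congr_left fun x hx => ?_).trans (List.map_id _)
    have := hl x hx
    simp; omega
  rw [← key v fun x hx => ((hv x).1 hx).1, h, key w fun x hx => ((hw x).1 hx).1]

end Pack

/-! ### Coefficient functionals -/

section Coefficients

variable (K : Type*) [Field K] {P : List ℕ → Prop}

/-- The coefficient of the packing of `w`. -/
def coeff (P : List ℕ → Prop) (w : List ℕ) : FreeOn K P →ₗ[K] K :=
  Finsupp.linearCombination K fun σ => ind K (pack w = σ.1)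

theorem coeff_single (w : List ℕ) (σ : {x // P x}) (a : K) :
    coeff K P w (Finsupp.single σ a) = a * ind K (pack w = σ.1) := by
  simp [coeff]

theorem coeff_basisVec (w : List ℕ) {u : List ℕ} (h : P u) :
    coeff K P w (basisVec K P u) = ind K (pack w = u) := by
  rw [basisVec_of K h, coeff_single, one_mul]

theorem coeff_eq_apply {w : List ℕ} (x : FreeOn K P) (σ : {x // P x}) (h : pack w = σ.1) :
    coeff K P w x = x σ := by
  classical
  induction x using Finsupp.induction_linear with
  | zero => simp
  | add x y hx hy => rw [map_add, hx, hy, Finsupp.add_apply]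
  | single τ a =>
    rw [coeff_single, h, Finsupp.single_apply]
    by_cases hc : τ = σ
    · simp [ind, hc]
    · have : ¬ σ.1 = τ.1 := fun e => hc (Subtype.ext e.symm)
      simp [ind, hc, this]

variable {K}

theorem coeff_congr {v w : List ℕ} (h : pack v = pack w) : coeff K P v = coeff K P w := by
  rw [coeff, coeff, h]

theorem coeff_nil (hP : ∀ w, P w → w ≠ []) (x : FreeOn K P) : coeff K P [] x = 0 := by
  induction x using Finsupp.induction_linear with
  | zero => simp
  | add x y hx hy => rw [map_add, hx, hy, add_zero]
  | single σ a =>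
    rw [coeff_single, pack_nil, ind_false (fun h => hP _ σ.2 h.symm), mul_zero]

theorem coeff_sum_basisVec (w : List ℕ) {s : Finset (List ℕ)} (hs : ∀ u ∈ s, P u) :
    coeff K P w (∑ u ∈ s, basisVec K P u) = ind K (pack w ∈ s) := by
  classical
  rw [map_sum, Finset.sum_congr rfl fun u hu => coeff_basisVec K w (hs u hu)]
  simp only [ind]
  convert Finset.sum_ite_eq s (pack w) fun _ => (1 : K)

/-- A relation between the minima of two words which only depends on their relative order. -/
def MinInvariant (r : WithTop ℕ → WithTop ℕ → Prop) : Prop :=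
  ∀ (p q : List ℕ) (f : ℕ → ℕ), (∀ x ∈ p ++ q, ∀ y ∈ p ++ q, f x ≤ f y ↔ x ≤ y) →
    (r (p.map f).minimum (q.map f).minimum ↔ r p.minimum q.minimum)

theorem minInvariant_lt : MinInvariant (· < ·) := fun _ _ _ h => minimum_map_lt_minimum_map h

theorem minInvariant_gt : MinInvariant (· > ·) := fun p q _ h =>
  minimum_map_lt_minimum_map (p := q) (q := p) fun x hx y hy =>
    h x (List.perm_append_comm.mem_iff.1 hx) y (List.perm_append_comm.mem_iff.1 hy)

theorem minInvariant_eq : MinInvariant (· = ·) := fun p q f h => by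
  have h1 := minInvariant_lt p q f h
  have h2 := minInvariant_gt p q f h
  simp only [gt_iff_lt] at h1 h2
  constructor <;> intro e <;>
  · apply le_antisymm <;> rw [← not_lt] <;> simp_all

/-- The products are dual to deconcatenation: Pack(w) occurs in the product of σ and τ exactly when
w, cut after |σ| letters, packs to σ and τ with minima in the relation `r`. The condition `hw` is
needed because the sum defining the product only contains words satisfying `P`. -/
theorem coeff_wordProd (hP : ∀ w, P w → w ≠ []) {r : WithTop ℕ → WithTop ℕ → Prop}
    (hr : MinInvariant r) {w : List ℕ} (hw : w ≠ [] → P (pack w)) (x y : FreeOn K P) :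
    coeff K P w (wordProd K P r x y)
      = deconcSum (fun p q => ind K (r p.minimum q.minimum) * (coeff K P p x * coeff K P q y))
        w := by
  classical
  rcases eq_or_ne w [] with rfl | hne
  · simp [coeff_nil hP]
  replace hw := hw hne
  rw [deconcSum_eq_sum]
  induction x using Finsupp.induction_linear with
  | zero => simp
  | add x x' hx hx' =>
    simp only [map_add, LinearMap.add_apply, hx, hx', add_mul, mul_add, Finset.sum_add_distrib]
  | single σ a =>
  induction y using Finsupp.induction_linear with
  | zero => simp
  | add y y' hy hy' =>
    simp only [map_add, hy, hy', mul_add, Finset.sum_add_distrib]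
  | single τ b =>
  simp only [wordProd, Finsupp.linearCombination_single, LinearMap.smul_apply, map_smul,
    smul_eq_mul]
  -- Packing preserves lengths, so only the cut after |σ| letters can contribute.
  rw [coeff_sum_basisVec w (by simp +contextual), Finset.sum_eq_single σ.1.length]
  · have hr' : r ((pack w).take σ.1.length).minimum ((pack w).drop σ.1.length).minimum ↔
        r (w.take σ.1.length).minimum (w.drop σ.1.length).minimum := by
      rw [pack_eq_map, ← List.map_take, ← List.map_drop]
      refine hr _ _ _ ?_
      rw [List.take_append_drop]
      exact fun x hx y _ => letterRank_le_iff w hx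
    have : pack w ∈ (packedWords (σ.1.length + τ.1.length)).filter (fun u => P u ∧
        pack (u.take σ.1.length) = σ.1 ∧ pack (u.drop σ.1.length) = τ.1 ∧
        r (u.take σ.1.length).minimum (u.drop σ.1.length).minimum) ↔
        r (w.take σ.1.length).minimum (w.drop σ.1.length).minimum ∧
        pack (w.take σ.1.length) = σ.1 ∧ pack (w.drop σ.1.length) = τ.1 := by
      rw [Finset.mem_filter, mem_packedWords, pack_take_pack, pack_drop_pack, hr']
      constructor
      · tauto
      · rintro ⟨h1, h2, h3⟩
        refine ⟨⟨isPacked_pack w, ?_⟩, hw, h2, h3, h1⟩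
        have := congrArg List.length h2
        have := congrArg List.length h3
        have := congrArg List.length (List.take_append_drop σ.1.length w)
        simp only [length_pack, List.length_append] at *
        omega
    rw [ind_congr this, ← ind_mul_ind, ← ind_mul_ind, coeff_single, coeff_single]
    ring
  · intro i hi hne
    rw [coeff_single, ind_false (p := pack (w.take i) = σ.1)]
    · ring
    · intro h
      have := congrArg List.length h
      simp at this hi
      omega
  · intro hi
    rw [coeff_single, ind_false (p := pack (w.take _) = σ.1)]
    · ring
    · intro h
      have := congrArg List.length h
      simp at this hi
      omega

end Coefficients

end Bidendriform

namespace Bidendriform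

/-! ### Testing equalities in tensor powers -/

section Tensor

variable (K : Type*) [Field K] (P : List ℕ → Prop)

/-- The product of two linear functionals. -/
def pairing {K A B : Type*} [Field K] [AddCommMonoid A] [Module K A] [AddCommMonoid B]
    [Module K B] (φ : A →ₗ[K] K) (χ : B →ₗ[K] K) : A ⊗[K] B →ₗ[K] K :=
  LinearMap.mul' K K ∘ₗ TensorProduct.map φ χ

@[simp] theorem pairing_tmul {K A B : Type*} [Field K] [AddCommMonoid A] [Module K A]
    [AddCommMonoid B] [Module K B] (φ : A →ₗ[K] K) (χ : B →ₗ[K] K) (a : A) (b : B) :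
    pairing φ χ (a ⊗ₜ b) = φ a * χ b := by
  simp [pairing]

/-- The coefficient of the packings of two words in a tensor square. -/
def coeff₂ (u v : List ℕ) : FreeOn K P ⊗[K] FreeOn K P →ₗ[K] K :=
  pairing (coeff K P u) (coeff K P v)

/-- The coefficient of the packings of three words in a tensor cube. -/
def coeff₃ (u v w : List ℕ) : FreeOn K P ⊗[K] (FreeOn K P ⊗[K] FreeOn K P) →ₗ[K] K :=
  pairing (coeff K P u) (coeff₂ K P v w)

@[simp] theorem coeff₂_tmul (u v : List ℕ) (x y : FreeOn K P) :
    coeff₂ K P u v (x ⊗ₜ y) = coeff K P u x * coeff K P v y := pairing_tmul _ _ _ _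

@[simp] theorem coeff₃_tmul (u v w : List ℕ) (x : FreeOn K P) (t : FreeOn K P ⊗[K] FreeOn K P) :
    coeff₃ K P u v w (x ⊗ₜ t) = coeff K P u x * coeff₂ K P v w t := pairing_tmul _ _ _ _

variable {K P}

/-- A shift of the letters does not change the packing, so coefficients can be tested on words with
arbitrarily large letters. -/
theorem exists_word_above (hP : ∀ w, P w → IsSurj w) (n : ℕ) (σ : {x // P x}) :
    ∃ w : List ℕ, w ≠ [] ∧ (∀ a ∈ w, n < a) ∧ pack w = σ.1 := by
  refine ⟨σ.1.map (· + (n + 1)), by simpa using (hP _ σ.2).1, ?_, ?_⟩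
  · simp only [List.mem_map]
    rintro _ ⟨b, -, rfl⟩
    omega
  · rw [pack_map_of_le_iff (by simp), (hP _ σ.2).2.pack_eq]

theorem coeff_ext (hP : ∀ w, P w → IsSurj w) (n : ℕ) {x y : FreeOn K P}
    (h : ∀ w, w ≠ [] → (∀ a ∈ w, n < a) → coeff K P w x = coeff K P w y) : x = y := by
  ext σ
  obtain ⟨w, hw, hn, hσ⟩ := exists_word_above hP n σ
  rw [← coeff_eq_apply K x σ hσ, ← coeff_eq_apply K y σ hσ, h w hw hn]

/-- A tensor with a free left factor is a finitely supported family in `B` indexed by the basis, and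
the contraction with `coeff K P w` is its coordinate at Pack(w). -/
theorem tensor_ext (hP : ∀ w, P w → IsSurj w) (n : ℕ) {B : Type*} [AddCommMonoid B] [Module K B]
    {s t : FreeOn K P ⊗[K] B}
    (h : ∀ w, w ≠ [] → (∀ a ∈ w, n < a) →
      TensorProduct.lid K B ((coeff K P w).rTensor B s)
        = TensorProduct.lid K B ((coeff K P w).rTensor B t)) : s = t := by
  classical
  apply (TensorProduct.finsuppScalarLeft K B {x // P x}).injective
  ext σ
  obtain ⟨w, hw, hn, hσ⟩ := exists_word_above hP n σ
  have key : ∀ s : FreeOn K P ⊗[K] B, TensorProduct.finsuppScalarLeft K B {x // P x} s σ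
      = TensorProduct.lid K B ((coeff K P w).rTensor B s) := by
    intro s
    induction s using TensorProduct.induction_on with
    | zero => simp
    | tmul x y => simp [TensorProduct.finsuppScalarLeft_apply_tmul_apply, coeff_eq_apply K x σ hσ]
    | add x y hx hy => simp [hx, hy]
  rw [key, key, h w hw hn]

theorem apply_lid_rTensor {A B : Type*} [AddCommMonoid A] [Module K A] [AddCommMonoid B]
    [Module K B] (φ : A →ₗ[K] K) (χ : B →ₗ[K] K) (s : A ⊗[K] B) :
    χ (TensorProduct.lid K B (φ.rTensor B s)) = pairing φ χ s := by
  induction s using TensorProduct.induction_on with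
  | zero => simp
  | tmul x y => simp
  | add x y hx hy => simp only [map_add, hx, hy]

/-- All letters of the first word are smaller than all letters of the second word. -/
def WordLT (u v : List ℕ) : Prop := ∀ a ∈ u, ∀ b ∈ v, a < b

theorem wordLT_of_sup_lt {u v : List ℕ} (h : ∀ b ∈ v, maxLetter u < b) : WordLT u v :=
  fun _ ha b hb => lt_of_le_of_lt (Finset.le_sup (f := id) (List.mem_toFinset.2 ha)) (h b hb)

/-- The second word may be shifted above the largest letter of the first. The lower bound `n` leaves
room for a further word below, as in the version with three words. -/
theorem coeff₂_ext (hP : ∀ w, P w → IsSurj w) (n : ℕ) {s t : FreeOn K P ⊗[K] FreeOn K P}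
    (h : ∀ u v, u ≠ [] → v ≠ [] → WordLT u v → (∀ a ∈ u, n < a) →
      coeff₂ K P u v s = coeff₂ K P u v t) : s = t := by
  refine tensor_ext hP n fun u hu hn => coeff_ext hP (maxLetter u) fun v hv huv => ?_
  rw [apply_lid_rTensor, apply_lid_rTensor]
  exact h u v hu hv (wordLT_of_sup_lt huv) hn

theorem coeff₃_ext (hP : ∀ w, P w → IsSurj w)
    {s t : FreeOn K P ⊗[K] (FreeOn K P ⊗[K] FreeOn K P)}
    (h : ∀ u v w, u ≠ [] → v ≠ [] → w ≠ [] → WordLT u v → WordLT u w → WordLT v w →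
      coeff₃ K P u v w s = coeff₃ K P u v w t) : s = t := by
  refine tensor_ext hP 0 fun u hu _ => coeff₂_ext hP (maxLetter u) fun v w hv hw hvw hn => ?_
  rw [coeff₂, apply_lid_rTensor, apply_lid_rTensor]
  refine h u v w hu hv hw (wordLT_of_sup_lt hn) (fun a ha c hc => ?_) hvw
  obtain ⟨b, hb⟩ := List.exists_mem_of_ne_nil v hv
  exact (wordLT_of_sup_lt hn a ha b hb).trans (hvw b hb c hc)

end Tensor

/-! ### The coefficients of the coproducts -/

section Coproduct

variable {K : Type*} [Field K] {P : List ℕ → Prop}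

/-- Induction step of `shuffleSum_ind` for shuffles whose first letter `a` is small. For empty σ the
default head 0 also satisfies `0 ≤ m`, hence the clause `σ ≠ []`; the next lemma needs none, as `m <
0` is false. -/
theorem shuffleSum_ind_cons_of_le {m a : ℕ} (ha : a ≤ m) {u v : List ℕ}
    (h : ∀ σ, shuffleSum (fun p => ind K (p = σ)) u v
      = ind K (σ.filter (· ≤ m) = u ∧ σ.filter (m < ·) = v)) (σ : List ℕ) :
    shuffleSum (fun p => ind K (a :: p = σ)) u v
      = ind K (σ ≠ [] ∧ σ.headD 0 ≤ m ∧ σ.filter (· ≤ m) = a :: u ∧ σ.filter (m < ·) = v) := by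
  cases σ with
  | nil => simpa [ind] using shuffleSum_mul_left (0 : K) (fun _ => 0) u v
  | cons c σ =>
    have : ∀ p, ind K (a :: p = c :: σ) = ind K (a = c) * ind K (p = σ) := fun p => by
      rw [ind_mul_ind, List.cons.injEq]
    simp only [this]
    rw [shuffleSum_mul_left, h, ind_mul_ind]
    refine ind_congr ?_
    by_cases hc : c ≤ m
    · have hc' : ¬ m < c := by omega
      simp [hc, hc', eq_comm, and_assoc]
    · simp [hc]
      omega

theorem shuffleSum_ind_cons_of_lt {m b : ℕ} (hb : m < b) {u v : List ℕ}
    (h : ∀ σ, shuffleSum (fun p => ind K (p = σ)) u v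
      = ind K (σ.filter (· ≤ m) = u ∧ σ.filter (m < ·) = v)) (σ : List ℕ) :
    shuffleSum (fun p => ind K (b :: p = σ)) u v
      = ind K (m < σ.headD 0 ∧ σ.filter (· ≤ m) = u ∧ σ.filter (m < ·) = b :: v) := by
  cases σ with
  | nil => simpa [ind] using shuffleSum_mul_left (0 : K) (fun _ => 0) u v
  | cons c σ =>
    have : ∀ p, ind K (b :: p = c :: σ) = ind K (b = c) * ind K (p = σ) := fun p => by
      rw [ind_mul_ind, List.cons.injEq]
    simp only [this]
    rw [shuffleSum_mul_left, h, ind_mul_ind]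
    refine ind_congr ?_
    by_cases hc : m < c
    · have hc' : ¬ c ≤ m := by omega
      simp only [List.headD_cons, hc, decide_true, List.filter_cons_of_pos, true_and, hc',
        decide_false, List.filter_cons_of_neg, List.cons.injEq, Bool.false_eq_true,
        not_false_eq_true]
      rw [eq_comm (a := b)]
      tauto
    · simp [hc]
      omega

/-- Because the two alphabets are separated by `m`, each letter of σ betrays the word it came from;
σ is a shuffle of `u` and `v` in at most one way, and `u`, `v` are recovered by filtering. -/
theorem shuffleSum_ind {m : ℕ} {u v : List ℕ} (hu : ∀ a ∈ u, a ≤ m) (hv : ∀ b ∈ v, m < b)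
    (σ : List ℕ) :
    shuffleSum (fun p => ind K (p = σ)) u v
      = ind K (σ.filter (· ≤ m) = u ∧ σ.filter (m < ·) = v) := by
  induction u generalizing v σ with
  | nil =>
    rw [shuffleSum_nil_left]
    refine ind_congr ⟨?_, ?_⟩
    · rintro rfl
      simpa using hv
    · rintro ⟨h1, rfl⟩
      simpa using h1
  | cons a u ihu =>
    induction v generalizing σ with
    | nil =>
      rw [shuffleSum_nil_right]
      refine ind_congr ⟨?_, ?_⟩
      · rintro rfl
        rw [List.filter_eq_self, List.filter_eq_nil_iff]
        simpa using hu
      · rintro ⟨h1, h2⟩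
        rw [← h1, List.filter_eq_self]
        simpa using h2
    | cons b v ihv =>
      rw [shuffleSum_cons_cons,
        shuffleSum_ind_cons_of_le (hu a (by simp)) (ihu (fun x hx => hu x (by simp [hx])) hv),
        shuffleSum_ind_cons_of_lt (hv b (by simp)) (ihv fun x hx => hv x (by simp [hx]))]
      rcases σ with - | ⟨c, σ⟩
      · simp [ind]
      · by_cases hc : c ≤ m
        · have hc' : ¬ m < c := by omega
          simp [hc, hc', ind]
        · have hc' : m < c := by omega
          simp [hc, hc', ind]

theorem leftShuffleSum_ind {m : ℕ} {u v : List ℕ} (hu : ∀ a ∈ u, a ≤ m) (hv : ∀ b ∈ v, m < b)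
    (σ : List ℕ) :
    leftShuffleSum (fun p => ind K (p = σ)) u v
      = ind K (u ≠ [] ∧ σ.headD 0 ≤ m ∧ σ.filter (· ≤ m) = u ∧ σ.filter (m < ·) = v) := by
  cases u with
  | nil => simp [ind]
  | cons a u =>
    rw [leftShuffleSum_cons, shuffleSum_ind_cons_of_le (hu a (by simp))
      (shuffleSum_ind (fun x hx => hu x (by simp [hx])) hv)]
    refine ind_congr ⟨fun h => ⟨by simp, h.2⟩, fun h => ⟨?_, h.2⟩⟩
    rintro rfl
    simp at h

theorem rightShuffleSum_ind {m : ℕ} {u v : List ℕ} (hu : ∀ a ∈ u, a ≤ m) (hv : ∀ b ∈ v, m < b)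
    (hne : v ≠ []) (σ : List ℕ) :
    rightShuffleSum (fun p => ind K (p = σ)) u v
      = ind K (m < σ.headD 0 ∧ σ.filter (· ≤ m) = u ∧ σ.filter (m < ·) = v) := by
  cases v with
  | nil => simp at hne
  | cons b v =>
    rw [rightShuffleSum_cons, shuffleSum_ind_cons_of_lt (hv b (by simp))
      (shuffleSum_ind hu fun x hx => hv x (by simp [hx]))]

/-- The letters of `u ++ v` fill an interval and those of `u` come below those of `v`, so each word
fills a subinterval, with the break at the largest letter of `u`. -/
theorem mem_iff_of_packed_append {u v : List ℕ} (h : WordLT u v) (hp : IsPacked (u ++ v)) :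
    (∀ x, x ∈ u ↔ 0 < x ∧ x ≤ maxLetter u) ∧
      ∃ n, ∀ x, x ∈ v ↔ maxLetter u < x ∧ x ≤ n := by
  obtain ⟨n, hn⟩ := hp
  have hmem := IsPacked.mem_iff hn
  have hle : ∀ x ∈ u, x ≤ maxLetter u := fun x hx =>
    Finset.le_sup (f := id) (List.mem_toFinset.2 hx)
  have hmax : u ≠ [] → maxLetter u ∈ u := fun hu => by
    obtain ⟨x, hx, he⟩ := Finset.exists_mem_eq_sup u.toFinset
      ((List.toFinset_nonempty_iff u).2 hu) id
    rw [maxLetter, he]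
    exact List.mem_toFinset.1 hx
  have hlt : ∀ x ∈ v, maxLetter u < x := fun x hx => by
    by_cases hu : u = []
    · subst hu
      have := (hmem x).1 (by simpa using hx)
      simp [maxLetter]
      omega
    · exact h _ (hmax hu) x hx
  have hn' : maxLetter u ≤ n := by
    by_cases hu : u = []
    · simp [hu, maxLetter]
    · exact ((hmem _).1 (List.mem_append_left _ (hmax hu))).2
  refine ⟨fun x => ⟨fun hx => ⟨((hmem x).1 (by simp [hx])).1, hle x hx⟩, fun hx => ?_⟩,
    n, fun x => ⟨fun hx => ⟨hlt x hx, ((hmem x).1 (by simp [hx])).2⟩, fun hx => ?_⟩⟩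
  · rcases List.mem_append.1 ((hmem x).2 ⟨hx.1, by omega⟩) with h' | h'
    · exact h'
    · have := hlt x h'
      omega
  · rcases List.mem_append.1 ((hmem x).2 ⟨by omega, hx.2⟩) with h' | h'
    · have := hle x h'
      omega
    · exact h'

theorem maxLetter_eq {w : List ℕ} {m : ℕ} (h : w.toFinset = Finset.Icc 1 m) : maxLetter w = m := by
  rw [maxLetter, h]
  apply le_antisymm
  · exact Finset.sup_le fun x hx => (Finset.mem_Icc.1 hx).2
  · rcases Nat.eq_zero_or_pos m with rfl | hm
    · simp
    · exact Finset.le_sup (f := id) (Finset.mem_Icc.2 ⟨hm, le_rfl⟩)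

/-- Only the index `i = max u` can contribute, because `lower σ i` has largest letter `i`. The
predicate `s` stands for the condition that separates Δ_≺ (`σ(1) ≤ i`) from Δ_≻ (`i < σ(1)`). -/
theorem sum_ind_lower_upper {s : ℕ → Prop} {u v σ : List ℕ} (h : WordLT u v)
    (hp : IsPacked (u ++ v)) (hu : u ≠ []) (hv : v ≠ []) (hσ : IsPacked σ)
    {I : Finset ℕ} (hI : ∀ i, i ∈ I ↔ s i ∧ 1 ≤ i ∧ i < maxLetter σ) :
    ∑ i ∈ I, ind K (pack u = lower σ i) * ind K (pack v = upper σ i)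
      = ind K (s (maxLetter u) ∧ σ.filter (· ≤ maxLetter u) = u ∧
          σ.filter (maxLetter u < ·) = v) := by
  classical
  obtain ⟨hmu, n, hmv⟩ := mem_iff_of_packed_append h hp
  obtain ⟨N, hN⟩ := hσ
  have hmem := IsPacked.mem_iff hN
  have hmax := maxLetter_eq hN
  have hpu : IsPacked u := ⟨maxLetter u, by ext x; simp [hmu]; omega⟩
  have hfil : ∀ x, x ∈ σ.filter (maxLetter u < ·) ↔ maxLetter u < x ∧ x ≤ N := fun x => by
    simp [hmem]
    omega
  rw [hpu.pack_eq]
  have key : ∀ i ∈ I, u = lower σ i → i = maxLetter u := by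
    intro i hi e
    have hi' := (hI i).1 hi
    have hm : ∀ x, x ∈ u ↔ 1 ≤ x ∧ x ≤ i := fun x => by
      rw [e]
      simp [lower, hmem]
      omega
    have h1 := (hmu i).1 ((hm i).2 ⟨hi'.2.1, le_rfl⟩)
    have h2 := (hm (maxLetter u)).1 ((hmu _).2 ⟨by omega, le_rfl⟩)
    omega
  simp only [ind_mul_ind]
  have hpos : 1 ≤ maxLetter u := by
    obtain ⟨x, hx⟩ := List.exists_mem_of_ne_nil u hu
    have := (hmu x).1 hx
    omega
  by_cases hm : maxLetter u ∈ I
  · rw [Finset.sum_eq_single_of_mem _ hm fun i hi hne => ind_false fun h => hne (key i hi h.1)]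
    refine ind_congr ⟨fun h => ⟨((hI _).1 hm).1, h.1.symm, (eq_of_pack_eq hmv hfil h.2).symm⟩,
      fun h => ⟨h.2.1.symm, ?_⟩⟩
    rw [upper, h.2.2]
  · have hz : ∀ i ∈ I, ind K (u = lower σ i ∧ pack v = upper σ i) = 0 := fun i hi =>
      ind_false fun h => hm (key i hi h.1 ▸ hi)
    rw [Finset.sum_eq_zero hz, ind_false]
    rintro ⟨h1, h2, h3⟩
    -- A letter of `v` is a letter of σ above `max u`, which gives `max u < max σ` and puts `max u`
    -- in the index set.
    obtain ⟨y, hy⟩ := List.exists_mem_of_ne_nil v hv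
    have h4 := (hmv y).1 hy
    rw [← h3, hfil] at hy
    exact hm ((hI _).2 ⟨h1, hpos, by omega⟩)

theorem wordLT_map_letterRank {u v : List ℕ} (h : WordLT u v) :
    WordLT (u.map (letterRank (u ++ v))) (v.map (letterRank (u ++ v))) := by
  simp only [WordLT, List.mem_map, forall_exists_index, and_imp, forall_apply_eq_imp_iff₂]
  intro a ha b hb
  rw [← not_le, letterRank_le_iff _ (by simp [hb])]
  exact not_le.2 (h a ha b hb)

/-- To compare functions of two words with increasing letters which only depend on the relative
order of the letters, one may suppose that the words have packed concatenation. -/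
theorem coeff₂_eq_of_packed {F : (List ℕ → K) → List ℕ → List ℕ → K}
    (hmap : ∀ (φ : ℕ → ℕ) (f : List ℕ → K) (u v : List ℕ),
      F f (u.map φ) (v.map φ) = F (fun p => f (p.map φ)) u v)
    (hcongr : ∀ (f g : List ℕ → K) (u v : List ℕ), (∀ p, p.Perm (u ++ v) → f p = g p) →
      F f u v = F g u v)
    {x : FreeOn K P} {t : FreeOn K P ⊗[K] FreeOn K P}
    (h : ∀ u v, WordLT u v → u ≠ [] → v ≠ [] → IsPacked (u ++ v) →
      coeff₂ K P u v t = F (fun p => coeff K P p x) u v)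
    {u v : List ℕ} (huv : WordLT u v) (hu : u ≠ []) (hv : v ≠ []) :
    coeff₂ K P u v t = F (fun p => coeff K P p x) u v := by
  have h1 := h _ _ (wordLT_map_letterRank huv) (by simpa using hu) (by simpa using hv) (by
    rw [← List.map_append, ← pack_eq_map]
    exact isPacked_pack _)
  rw [hmap, coeff₂, coeff_congr (pack_map_letterRank (w := u ++ v) (v := u) (by simp +contextual)),
    coeff_congr (pack_map_letterRank (w := u ++ v) (v := v) (by simp +contextual))] at h1
  rw [coeff₂, h1]
  refine hcongr _ _ _ _ fun p hp => ?_
  rw [coeff_congr (pack_map_letterRank fun x hx => hp.mem_iff.1 hx)]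

theorem pairwise_true {α : Type*} (l : List α) : l.Pairwise fun _ _ => True :=
  List.pairwise_of_forall fun _ _ => trivial

theorem perm_packed {p w : List ℕ} (h : p.Perm w) (hw : IsPacked w) : IsPacked p := by
  rwa [IsPacked, List.toFinset_eq_of_perm _ _ h]

/-- Δ_≺ is dual to the shuffles that start in `u`. For packed `u ++ v`, the basis word σ contributes
when its letters up to `max u` spell `u` and the others spell `v`, that is, when σ is a shuffle of
both; the bound `σ(1) ≤ i` says that its first letter comes from `u`. By `hlu`, no `basisVec` in the
coproduct takes its default value 0. -/
theorem coeff₂_wordCoprec (hP : ∀ w, P w → IsSurj w)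
    (hlu : ∀ w, P w → ∀ i, 1 ≤ i → i < maxLetter w → P (lower w i) ∧ P (upper w i))
    {u v : List ℕ} (h : WordLT u v) (hu : u ≠ []) (hv : v ≠ []) (x : FreeOn K P) :
    coeff₂ K P u v (wordCoprec K P x) = leftShuffleSum (fun p => coeff K P p x) u v := by
  refine coeff₂_eq_of_packed (F := leftShuffleSum) leftShuffleSum_map (fun f g u v hfg =>
    leftShuffleSum_congr (fun _ _ => True) (pairwise_true _) (pairwise_true _) (by simp)
      fun p hp _ => hfg p hp) (fun u v h hu hv hp => ?_) h hu hv
  induction x using Finsupp.induction_linear with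
  | zero => simpa using (leftShuffleSum_mul_left (0 : K) (fun _ => 0) u v).symm
  | add x y hx hy => simp only [map_add, hx, hy, leftShuffleSum_add]
  | single σ a =>
  simp only [coeff_single, leftShuffleSum_mul_left]
  rw [wordCoprec, Finsupp.linearCombination_single, map_smul, smul_eq_mul, map_sum]
  -- Letters are positive, so the range starting at σ(1) avoids the index 0, where `hlu` does not
  -- apply.
  have hhead : 1 ≤ σ.1.headD 0 := by
    obtain ⟨hne, m, hm⟩ := hP _ σ.2
    cases hσ : σ.1 with
    | nil => exact absurd hσ hne
    | cons c l => exact ((IsPacked.mem_iff hm c).1 (by simp [hσ])).1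
  rw [Finset.sum_congr rfl fun i hi => show _ = ind K (pack u = lower σ.1 i) *
      ind K (pack v = upper σ.1 i) by
    rw [Finset.mem_Ico] at hi
    have := hlu _ σ.2 i (by omega) hi.2
    rw [coeff₂_tmul, coeff_basisVec _ _ this.1, coeff_basisVec _ _ this.2]]
  rw [sum_ind_lower_upper (s := fun m => σ.1.headD 0 ≤ m) h hp hu hv (hP _ σ.2).2
      (fun i => by rw [Finset.mem_Ico]; omega),
    leftShuffleSum_congr (g := fun p => ind K (p = σ.1)) (fun _ _ => True) (pairwise_true _)
      (pairwise_true _) (by simp) fun p hp' _ => by rw [(perm_packed hp' hp).pack_eq],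
    leftShuffleSum_ind (m := maxLetter u)]
  · simp [hu]
  · exact fun a ha => ((mem_iff_of_packed_append h hp).1 a).1 ha |>.2
  · obtain ⟨-, n, hn⟩ := mem_iff_of_packed_append h hp
    exact fun b hb => ((hn b).1 hb).1

theorem coeff₂_wordCosucc (hP : ∀ w, P w → IsSurj w)
    (hlu : ∀ w, P w → ∀ i, 1 ≤ i → i < maxLetter w → P (lower w i) ∧ P (upper w i))
    {u v : List ℕ} (h : WordLT u v) (hu : u ≠ []) (hv : v ≠ []) (x : FreeOn K P) :
    coeff₂ K P u v (wordCosucc K P x) = rightShuffleSum (fun p => coeff K P p x) u v := by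
  refine coeff₂_eq_of_packed (F := rightShuffleSum) rightShuffleSum_map (fun f g u v hfg =>
    rightShuffleSum_congr (fun _ _ => True) (pairwise_true _) (pairwise_true _) (by simp)
      fun p hp _ => hfg p hp) (fun u v h hu hv hp => ?_) h hu hv
  induction x using Finsupp.induction_linear with
  | zero => simpa using (rightShuffleSum_mul_left (0 : K) (fun _ => 0) u v).symm
  | add x y hx hy => simp only [map_add, hx, hy, rightShuffleSum_add]
  | single σ a =>
  simp only [coeff_single, rightShuffleSum_mul_left]
  rw [wordCosucc, Finsupp.linearCombination_single, map_smul, smul_eq_mul, map_sum]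
  have hhead : σ.1.headD 0 ≤ maxLetter σ.1 := by
    cases hσ : σ.1 with
    | nil => exact absurd hσ (hP _ σ.2).1
    | cons c l => exact Finset.le_sup (f := id) (by simp)
  rw [Finset.sum_congr rfl fun i hi => show _ = ind K (pack u = lower σ.1 i) *
      ind K (pack v = upper σ.1 i) by
    rw [Finset.mem_Ico] at hi
    have := hlu _ σ.2 i hi.1 (by omega)
    rw [coeff₂_tmul, coeff_basisVec _ _ this.1, coeff_basisVec _ _ this.2]]
  rw [sum_ind_lower_upper (s := fun m => m < σ.1.headD 0) h hp hu hv (hP _ σ.2).2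
      (fun i => by rw [Finset.mem_Ico]; omega),
    rightShuffleSum_congr (g := fun p => ind K (p = σ.1)) (fun _ _ => True) (pairwise_true _)
      (pairwise_true _) (by simp) fun p hp' _ => by rw [(perm_packed hp' hp).pack_eq],
    rightShuffleSum_ind (m := maxLetter u) _ _ hv]
  · exact fun a ha => ((mem_iff_of_packed_append h hp).1 a).1 ha |>.2
  · obtain ⟨-, n, hn⟩ := mem_iff_of_packed_append h hp
    exact fun b hb => ((hn b).1 hb).1

end Coproduct

end Bidendriform

namespace Bidendriform

/-! ### The bidendriform bialgebra of packed words -/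

section Packed

variable {K : Type*} [Field K]

/-- The coefficient functionals of `QSh`. -/
abbrev qcoeff (w : List ℕ) : QSh K →ₗ[K] K := coeff K IsSurj w

/-- The coefficient functionals of the tensor square of `QSh`. -/
abbrev qcoeff₂ (u v : List ℕ) : QSh K ⊗[K] QSh K →ₗ[K] K := coeff₂ K IsSurj u v

theorem qcoeff_nil (x : QSh K) : qcoeff [] x = 0 := coeff_nil (fun _ h => h.1) x

theorem qcoeff₂_nil_left (v : List ℕ) (t : QSh K ⊗[K] QSh K) : qcoeff₂ [] v t = 0 := by
  induction t using TensorProduct.induction_on with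
  | zero => simp
  | tmul x y => simp [coeff_nil (P := IsSurj) (fun _ h => h.1)]
  | add x y hx hy => rw [map_add, hx, hy, add_zero]

theorem qcoeff₂_nil_right (u : List ℕ) (t : QSh K ⊗[K] QSh K) : qcoeff₂ u [] t = 0 := by
  induction t using TensorProduct.induction_on with
  | zero => simp
  | tmul x y => simp [coeff_nil (P := IsSurj) (fun _ h => h.1)]
  | add x y hx hy => rw [map_add, hx, hy, add_zero]

theorem qcoeff_prec (w : List ℕ) (x y : QSh K) :
    qcoeff w ((qshOps K).prec x y) = deconcSum (fun p q =>
      ind K (p.minimum ≤ q.minimum) * (qcoeff p x * qcoeff q y)) w := by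
  rw [qshOps, LinearMap.add_apply, LinearMap.add_apply, map_add,
    coeff_wordProd (fun _ h => h.1) minInvariant_lt isSurj_pack,
    coeff_wordProd (fun _ h => h.1) minInvariant_eq isSurj_pack, ← deconcSum_add]
  congr 1
  funext p q
  rw [← add_mul]
  congr 1
  rcases lt_trichotomy p.minimum q.minimum with h | h | h
  · simp [ind, h, h.le, h.ne]
  · simp [ind, h]
  · simp [ind, h.ne', not_le.2 h, not_lt.2 h.le]

theorem qcoeff_succ (w : List ℕ) (x y : QSh K) :
    qcoeff w ((qshOps K).succ x y) = deconcSum (fun p q =>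
      ind K (p.minimum > q.minimum) * (qcoeff p x * qcoeff q y)) w :=
  coeff_wordProd (fun _ h => h.1) minInvariant_gt isSurj_pack x y

theorem qcoeff_star (w : List ℕ) (x y : QSh K) :
    qcoeff w ((qshOps K).star x y) = deconcSum (fun p q => qcoeff p x * qcoeff q y) w := by
  rw [Ops.star, LinearMap.add_apply, LinearMap.add_apply, map_add, qcoeff_prec, qcoeff_succ,
    ← deconcSum_add]
  congr 1
  funext p q
  rw [← add_mul]
  rcases le_or_gt p.minimum q.minimum with h | h
  · simp [ind, h, not_lt.2 h]
  · simp [ind, h, not_le.2 h]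

variable {u v : List ℕ}

theorem qcoeff₂_coprec (h : WordLT u v) (hu : u ≠ []) (hv : v ≠ []) (x : QSh K) :
    qcoeff₂ u v ((qshOps K).coprec x) = leftShuffleSum (fun p => qcoeff p x) u v :=
  coeff₂_wordCoprec (fun _ h => h) (fun _ h _ => h.lower_upper) h hu hv x

theorem qcoeff₂_cosucc (h : WordLT u v) (hu : u ≠ []) (hv : v ≠ []) (x : QSh K) :
    qcoeff₂ u v ((qshOps K).cosucc x) = rightShuffleSum (fun p => qcoeff p x) u v :=
  coeff₂_wordCosucc (fun _ h => h) (fun _ h _ => h.lower_upper) h hu hv x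

theorem qcoeff₂_cotilde (h : WordLT u v) (hu : u ≠ []) (hv : v ≠ []) (x : QSh K) :
    qcoeff₂ u v ((qshOps K).cotilde x) = shuffleSum (fun p => qcoeff p x) u v := by
  rw [Ops.cotilde, LinearMap.add_apply, map_add, qcoeff₂_coprec h hu hv, qcoeff₂_cosucc h hu hv,
    shuffleSum_eq_left_add_right (qcoeff_nil x)]

/-- Extends the duality to empty words, which occur as pieces of a cut. The correction terms here
and in the next two lemmas produce the exceptional terms of the compatibilities. -/
theorem leftShuffleSum_qcoeff (h : WordLT u v) (x : QSh K) :
    leftShuffleSum (fun p => qcoeff p x) u v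
      = qcoeff₂ u v ((qshOps K).coprec x) + ind K (v = []) * qcoeff u x := by
  rcases u with - | ⟨a, u⟩
  · rw [leftShuffleSum_nil, qcoeff₂_nil_left, qcoeff_nil]; simp
  rcases v with - | ⟨b, v⟩
  · rw [qcoeff₂_nil_right, leftShuffleSum_cons, shuffleSum_nil_right]; simp [ind]
  rw [qcoeff₂_coprec h (by simp) (by simp)]; simp [ind]

theorem rightShuffleSum_qcoeff (h : WordLT u v) (x : QSh K) :
    rightShuffleSum (fun p => qcoeff p x) u v
      = qcoeff₂ u v ((qshOps K).cosucc x) + ind K (u = []) * qcoeff v x := by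
  rcases v with - | ⟨b, v⟩
  · rw [rightShuffleSum_nil, qcoeff₂_nil_right, qcoeff_nil]; simp
  rcases u with - | ⟨a, u⟩
  · rw [qcoeff₂_nil_left, rightShuffleSum_cons, shuffleSum_nil_left]; simp [ind]
  rw [qcoeff₂_cosucc h (by simp) (by simp)]; simp [ind]

theorem shuffleSum_qcoeff (h : WordLT u v) (x : QSh K) :
    shuffleSum (fun p => qcoeff p x) u v = qcoeff₂ u v ((qshOps K).cotilde x)
      + ind K (v = []) * qcoeff u x + ind K (u = []) * qcoeff v x := by
  rw [shuffleSum_eq_left_add_right (qcoeff_nil x), leftShuffleSum_qcoeff h,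
    rightShuffleSum_qcoeff h, Ops.cotilde, LinearMap.add_apply, map_add]
  ring

-- Half-coproducts of products with a condition on the minima.

theorem minimum_eq_of_perm {p q : List ℕ} (h : p.Perm q) : p.minimum = q.minimum :=
  le_antisymm (List.minimum_anti h.symm.subset) (List.minimum_anti h.subset)

theorem WordLT.minimum_lt (h : WordLT u v) (hu : u ≠ []) : u.minimum < v.minimum := by
  obtain ⟨a, ha⟩ := List.exists_mem_of_ne_nil u hu
  exact minimum_lt_minimum_iff.2 ⟨a, ha, h a ha⟩

/-- A piece that meets `u` has its minimum there, since the letters of `v` are larger. If `u₁` is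
empty then `u₂` is not and both comparisons fail; if `u₂` is empty both hold. -/
theorem minimum_le_minimum_iff_of_perm {u₁ u₂ v₁ v₂ p q : List ℕ}
    (h : WordLT (u₁ ++ u₂) (v₁ ++ v₂)) (hu : u₁ ++ u₂ ≠ []) (hp : p.Perm (u₁ ++ v₁))
    (hq : q.Perm (u₂ ++ v₂)) : p.minimum ≤ q.minimum ↔ u₁.minimum ≤ u₂.minimum := by
  rw [minimum_eq_of_perm hp, minimum_eq_of_perm hq, List.minimum_append, List.minimum_append]
  have h11 : WordLT u₁ v₁ := fun a ha b hb => h a (by simp [ha]) b (by simp [hb])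
  have h12 : WordLT u₁ v₂ := fun a ha b hb => h a (by simp [ha]) b (by simp [hb])
  have h21 : WordLT u₂ v₁ := fun a ha b hb => h a (by simp [ha]) b (by simp [hb])
  have h22 : WordLT u₂ v₂ := fun a ha b hb => h a (by simp [ha]) b (by simp [hb])
  by_cases h1 : u₁ = []
  · have h2 : u₂ ≠ [] := by simpa [h1] using hu
    have := h21.minimum_lt h2
    have h3 := h22.minimum_lt h2
    have h4 : u₂.minimum ≠ ⊤ := by simpa using h2
    rw [min_eq_left h3.le, h1, List.minimum_nil]
    simp [h4, this]
  · rw [min_eq_left (h11.minimum_lt h1).le]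
    by_cases h2 : u₂ = []
    · simp [h2, (h12.minimum_lt h1).le]
    · rw [min_eq_left (h22.minimum_lt h2).le]

/-- A relation is determined by the comparison of its arguments. -/
def OrderDetermined (r : WithTop ℕ → WithTop ℕ → Prop) : Prop :=
  ∀ a b c d : WithTop ℕ, (a ≤ b ↔ c ≤ d) → (r a b ↔ r c d)

/-- `m` is the part of the concatenation product for which the minima satisfy `r`. -/
def IsMinProd (r : WithTop ℕ → WithTop ℕ → Prop) (m : QSh K →ₗ[K] QSh K →ₗ[K] QSh K) : Prop :=
  ∀ w x y, qcoeff w (m x y) = deconcSum (fun p q =>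
    ind K (r p.minimum q.minimum) * (qcoeff p x * qcoeff q y)) w

variable {r : WithTop ℕ → WithTop ℕ → Prop} {m : QSh K →ₗ[K] QSh K →ₗ[K] QSh K}

/-- The condition on the minima depends only on how `u` is cut, so it is constant along the shuffles
and comes out of the sum. -/
theorem shuffleSum_const_mul_mul {r : WithTop ℕ → WithTop ℕ → Prop} (hr : OrderDetermined r)
    (h : WordLT u v) (hu : u ≠ []) (f g : List ℕ → K) {u₁ u₂ v₁ v₂ p : List ℕ}
    (hu' : u₁ ++ u₂ = u) (hv' : v₁ ++ v₂ = v) (hp : p.Perm (u₁ ++ v₁)) :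
    shuffleSum (fun q => ind K (r p.minimum q.minimum) * (f p * g q)) u₂ v₂
      = ind K (r u₁.minimum u₂.minimum) * shuffleSum g u₂ v₂ * f p := by
  subst hu' hv'
  rw [shuffleSum_congr (g := fun q => (ind K (r u₁.minimum u₂.minimum) * f p) * g q)
    (fun _ _ => True) (pairwise_true _) (pairwise_true _) (by simp), shuffleSum_mul_left]
  · ring
  · intro q hq _
    rw [ind_congr (hr _ _ _ _ (minimum_le_minimum_iff_of_perm h hu hp hq))]
    ring

theorem leftShuffleSum_minProd (hr : OrderDetermined r) (hm : IsMinProd r m) (h : WordLT u v)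
    (hu : u ≠ []) (x y : QSh K) :
    leftShuffleSum (fun p => qcoeff p (m x y)) u v = deconcSum (fun u₁ u₂ => deconcSum
      (fun v₁ v₂ => ind K (r u₁.minimum u₂.minimum) *
        (leftShuffleSum (fun p => qcoeff p x) u₁ v₁ * shuffleSum (fun q => qcoeff q y) u₂ v₂)) v)
        u := by
  have : (fun p => qcoeff p (m x y)) = deconcSum (fun p q =>
    ind K (r p.minimum q.minimum) * (qcoeff p x * qcoeff q y)) := funext fun w => hm w x y
  rw [this, leftShuffleSum_deconcSum (fun q => by rw [qcoeff_nil]; ring)]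
  refine deconcSum_congr fun u₁ u₂ hu' => deconcSum_congr fun v₁ v₂ hv' => ?_
  rw [leftShuffleSum_congr (fun _ _ => True) (pairwise_true _) (pairwise_true _) (by simp)
    fun p hp _ => shuffleSum_const_mul_mul hr h hu
      (fun p => qcoeff p x) (fun q => qcoeff q y) hu' hv' hp, leftShuffleSum_mul_left]
  ring

theorem rightShuffleSum_minProd (hr : OrderDetermined r) (hm : IsMinProd r m) (h : WordLT u v)
    (hu : u ≠ []) (x y : QSh K) :
    rightShuffleSum (fun p => qcoeff p (m x y)) u v = deconcSum (fun u₁ u₂ => deconcSum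
      (fun v₁ v₂ => ind K (r u₁.minimum u₂.minimum) *
        (rightShuffleSum (fun p => qcoeff p x) u₁ v₁ * shuffleSum (fun q => qcoeff q y) u₂ v₂)) v)
        u := by
  have : (fun p => qcoeff p (m x y)) = deconcSum (fun p q =>
    ind K (r p.minimum q.minimum) * (qcoeff p x * qcoeff q y)) := funext fun w => hm w x y
  rw [this, rightShuffleSum_deconcSum (fun q => by rw [qcoeff_nil]; ring)]
  refine deconcSum_congr fun u₁ u₂ hu' => deconcSum_congr fun v₁ v₂ hv' => ?_
  rw [rightShuffleSum_congr (fun _ _ => True) (pairwise_true _) (pairwise_true _) (by simp)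
    fun p hp _ => shuffleSum_const_mul_mul hr h hu
      (fun p => qcoeff p x) (fun q => qcoeff q y) hu' hv' hp, rightShuffleSum_mul_left]
  ring

/-- Cut both words. A left shuffle of the fronts is a coefficient of Δ_≺(x) or has `v₁` empty; a
shuffle of the backs is a coefficient of the total coproduct of y or has `u₂` or `v₂` empty. Of the
six combinations, `v₁ = v₂ = []` is excluded because `v` is nonempty. An empty `u₂` has minimum ⊤,
whence the factor `r u.minimum ⊤`. -/
theorem qcoeff₂_coprec_minProd (hr : OrderDetermined r) (hm : IsMinProd r m) (h : WordLT u v)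
    (hu : u ≠ []) (hv : v ≠ []) (x y : QSh K) :
    qcoeff₂ u v ((qshOps K).coprec (m x y)) =
      deconcSum (fun u₁ u₂ => deconcSum (fun v₁ v₂ => ind K (r u₁.minimum u₂.minimum) *
        (qcoeff₂ u₁ v₁ ((qshOps K).coprec x) * qcoeff₂ u₂ v₂ ((qshOps K).cotilde y))) v) u
      + deconcSum (fun u₁ u₂ => ind K (r u₁.minimum u₂.minimum) *
        (qcoeff u₁ x * qcoeff₂ u₂ v ((qshOps K).cotilde y))) u
      + deconcSum (fun u₁ u₂ => ind K (r u₁.minimum u₂.minimum) *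
        (qcoeff₂ u₁ v ((qshOps K).coprec x) * qcoeff u₂ y)) u
      + ind K (r u.minimum ⊤) * deconcSum (fun v₁ v₂ =>
        qcoeff₂ u v₁ ((qshOps K).coprec x) * qcoeff v₂ y) v
      + ind K (r u.minimum ⊤) * (qcoeff u x * qcoeff v y) := by
  rw [qcoeff₂_coprec h hu hv, leftShuffleSum_minProd hr hm h hu]
  have e : ∀ u₁ u₂, u₁ ++ u₂ = u → deconcSum (fun v₁ v₂ => ind K (r u₁.minimum u₂.minimum) *
        (leftShuffleSum (fun p => qcoeff p x) u₁ v₁ * shuffleSum (fun q => qcoeff q y) u₂ v₂)) v =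
      deconcSum (fun v₁ v₂ => ind K (r u₁.minimum u₂.minimum) *
        (qcoeff₂ u₁ v₁ ((qshOps K).coprec x) * qcoeff₂ u₂ v₂ ((qshOps K).cotilde y))) v
      + ind K (r u₁.minimum u₂.minimum) * (qcoeff u₁ x * qcoeff₂ u₂ v ((qshOps K).cotilde y))
      + ind K (r u₁.minimum u₂.minimum) * (qcoeff₂ u₁ v ((qshOps K).coprec x) * qcoeff u₂ y)
      + ind K (u₂ = []) * (ind K (r u₁.minimum u₂.minimum) * deconcSum (fun v₁ v₂ =>
        qcoeff₂ u₁ v₁ ((qshOps K).coprec x) * qcoeff v₂ y) v)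
      + ind K (u₂ = []) * (ind K (r u₁.minimum u₂.minimum) * (qcoeff u₁ x * qcoeff v y)) := by
    rintro u₁ u₂ rfl
    have : ∀ v₁ v₂, v₁ ++ v₂ = v → ind K (r u₁.minimum u₂.minimum) *
        (leftShuffleSum (fun p => qcoeff p x) u₁ v₁ * shuffleSum (fun q => qcoeff q y) u₂ v₂) =
      ind K (r u₁.minimum u₂.minimum) *
        (qcoeff₂ u₁ v₁ ((qshOps K).coprec x) * qcoeff₂ u₂ v₂ ((qshOps K).cotilde y))
      + ind K (v₁ = []) * (ind K (r u₁.minimum u₂.minimum) *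
        (qcoeff u₁ x * qcoeff₂ u₂ v₂ ((qshOps K).cotilde y)))
      + ind K (v₂ = []) * (ind K (r u₁.minimum u₂.minimum) *
        (qcoeff₂ u₁ v₁ ((qshOps K).coprec x) * qcoeff u₂ y))
      + ind K (u₂ = []) * ind K (r u₁.minimum u₂.minimum) *
        (qcoeff₂ u₁ v₁ ((qshOps K).coprec x) * qcoeff v₂ y)
      + ind K (v₁ = []) * (ind K (u₂ = []) * ind K (r u₁.minimum u₂.minimum) *
          (qcoeff u₁ x * qcoeff v₂ y))
      + ind K (v₁ = []) * (ind K (v₂ = []) * ind K (r u₁.minimum u₂.minimum) *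
          (qcoeff u₁ x * qcoeff u₂ y)) := by
      rintro v₁ v₂ rfl
      rw [leftShuffleSum_qcoeff, shuffleSum_qcoeff]
      · ring
      all_goals exact fun a ha b hb => h a (by simp [ha]) b (by simp [hb])
    rw [deconcSum_congr this]
    simp only [deconcSum_add, deconcSum_ind_left, deconcSum_ind_right, deconcSum_mul_left,
      ind_false hv]
    ring
  rw [deconcSum_congr e]
  simp only [deconcSum_add, deconcSum_ind_right, List.minimum_nil]

/-- Same expansion for right shuffles of the fronts, where the exceptional case is `u₁` empty. Now
`u₁ = u₂ = []` is the excluded combination, and an empty `u₁` yields the factor `r ⊤ u.minimum`. -/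
theorem qcoeff₂_cosucc_minProd (hr : OrderDetermined r) (hm : IsMinProd r m) (h : WordLT u v)
    (hu : u ≠ []) (hv : v ≠ []) (x y : QSh K) :
    qcoeff₂ u v ((qshOps K).cosucc (m x y)) =
      deconcSum (fun u₁ u₂ => deconcSum (fun v₁ v₂ => ind K (r u₁.minimum u₂.minimum) *
        (qcoeff₂ u₁ v₁ ((qshOps K).cosucc x) * qcoeff₂ u₂ v₂ ((qshOps K).cotilde y))) v) u
      + deconcSum (fun u₁ u₂ => ind K (r u₁.minimum u₂.minimum) *
        (qcoeff₂ u₁ v ((qshOps K).cosucc x) * qcoeff u₂ y)) u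
      + ind K (r u.minimum ⊤) * deconcSum (fun v₁ v₂ =>
        qcoeff₂ u v₁ ((qshOps K).cosucc x) * qcoeff v₂ y) v
      + ind K (r ⊤ u.minimum) * deconcSum (fun v₁ v₂ =>
        qcoeff v₁ x * qcoeff₂ u v₂ ((qshOps K).cotilde y)) v
      + ind K (r ⊤ u.minimum) * (qcoeff v x * qcoeff u y) := by
  rw [qcoeff₂_cosucc h hu hv, rightShuffleSum_minProd hr hm h hu]
  have e : ∀ u₁ u₂, u₁ ++ u₂ = u → deconcSum (fun v₁ v₂ => ind K (r u₁.minimum u₂.minimum) *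
        (rightShuffleSum (fun p => qcoeff p x) u₁ v₁ * shuffleSum (fun q => qcoeff q y) u₂ v₂)) v =
      deconcSum (fun v₁ v₂ => ind K (r u₁.minimum u₂.minimum) *
        (qcoeff₂ u₁ v₁ ((qshOps K).cosucc x) * qcoeff₂ u₂ v₂ ((qshOps K).cotilde y))) v
      + ind K (r u₁.minimum u₂.minimum) * (qcoeff₂ u₁ v ((qshOps K).cosucc x) * qcoeff u₂ y)
      + ind K (u₂ = []) * (ind K (r u₁.minimum u₂.minimum) * deconcSum (fun v₁ v₂ =>
        qcoeff₂ u₁ v₁ ((qshOps K).cosucc x) * qcoeff v₂ y) v)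
      + ind K (u₁ = []) * (ind K (r u₁.minimum u₂.minimum) * deconcSum (fun v₁ v₂ =>
        qcoeff v₁ x * qcoeff₂ u₂ v₂ ((qshOps K).cotilde y)) v)
      + ind K (u₁ = []) * (ind K (r u₁.minimum u₂.minimum) * (qcoeff v x * qcoeff u₂ y))
      + ind K (u₁ = []) * (ind K (u₂ = []) * (ind K (r u₁.minimum u₂.minimum) *
          deconcSum (fun v₁ v₂ => qcoeff v₁ x * qcoeff v₂ y) v)) := by
    rintro u₁ u₂ rfl
    have : ∀ v₁ v₂, v₁ ++ v₂ = v → ind K (r u₁.minimum u₂.minimum) *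
        (rightShuffleSum (fun p => qcoeff p x) u₁ v₁ * shuffleSum (fun q => qcoeff q y) u₂ v₂) =
      ind K (r u₁.minimum u₂.minimum) *
        (qcoeff₂ u₁ v₁ ((qshOps K).cosucc x) * qcoeff₂ u₂ v₂ ((qshOps K).cotilde y))
      + ind K (v₂ = []) * (ind K (r u₁.minimum u₂.minimum) *
        (qcoeff₂ u₁ v₁ ((qshOps K).cosucc x) * qcoeff u₂ y))
      + ind K (u₂ = []) * ind K (r u₁.minimum u₂.minimum) *
        (qcoeff₂ u₁ v₁ ((qshOps K).cosucc x) * qcoeff v₂ y)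
      + ind K (u₁ = []) * ind K (r u₁.minimum u₂.minimum) *
        (qcoeff v₁ x * qcoeff₂ u₂ v₂ ((qshOps K).cotilde y))
      + ind K (v₂ = []) * (ind K (u₁ = []) * ind K (r u₁.minimum u₂.minimum) *
          (qcoeff v₁ x * qcoeff u₂ y))
      + ind K (u₁ = []) * ind K (u₂ = []) * ind K (r u₁.minimum u₂.minimum) *
          (qcoeff v₁ x * qcoeff v₂ y) := by
      rintro v₁ v₂ rfl
      rw [rightShuffleSum_qcoeff, shuffleSum_qcoeff]
      · ring
      all_goals exact fun a ha b hb => h a (by simp [ha]) b (by simp [hb])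
    rw [deconcSum_congr this]
    simp only [deconcSum_add, deconcSum_ind_right, deconcSum_mul_left]
    ring
  rw [deconcSum_congr e]
  simp only [deconcSum_add, deconcSum_ind_right, deconcSum_ind_left, List.minimum_nil,
    ind_false hu]
  ring

/-! The values of the right hand sides of the compatibilities, for the opposite operations. -/

variable (s t : QSh K ⊗[K] QSh K) (x : QSh K)

theorem qcoeff₂_comm (s : QSh K ⊗[K] QSh K) :
    qcoeff₂ v u (TensorProduct.comm K _ _ s) = qcoeff₂ u v s := by
  induction s using TensorProduct.induction_on with
  | zero => simp
  | tmul a b => simp [mul_comm]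
  | add a b ha hb => simp only [map_add, ha, hb]

theorem qcoeff₂_map₂ (hm : IsMinProd r m) :
    qcoeff₂ v u (TensorProduct.map₂ (qshOps K).star.flip m.flip (TensorProduct.comm K _ _ s)
      (TensorProduct.comm K _ _ t)) =
      deconcSum (fun u₁ u₂ => deconcSum (fun v₁ v₂ => ind K (r u₁.minimum u₂.minimum) *
        (qcoeff₂ u₁ v₁ t * qcoeff₂ u₂ v₂ s)) v) u := by
  induction s using TensorProduct.induction_on with
  | zero => simp
  | add a b ha hb => simp only [map_add, LinearMap.add_apply, ha, hb, mul_add, deconcSum_add]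
  | tmul a b =>
  induction t using TensorProduct.induction_on with
  | zero => simp
  | add c d hc hd => simp only [map_add, hc, hd, add_mul, mul_add, deconcSum_add]
  | tmul c d =>
  simp only [TensorProduct.comm_tmul, TensorProduct.map₂_apply_tmul, TensorProduct.map_tmul,
    coeff₂_tmul, LinearMap.flip_apply]
  rw [qcoeff_star, hm, mul_comm, ← deconcSum_mul_right]
  congr 1
  funext u₁ u₂
  rw [← deconcSum_mul_left]
  congr 1
  funext v₁ v₂
  ring

theorem qcoeff₂_lTensor (hm : IsMinProd r m) :
    qcoeff₂ v u ((m x).lTensor _ (TensorProduct.comm K _ _ s)) =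
      deconcSum (fun u₁ u₂ => ind K (r u₁.minimum u₂.minimum) *
        (qcoeff u₁ x * qcoeff₂ u₂ v s)) u := by
  induction s using TensorProduct.induction_on with
  | zero => simp
  | add a b ha hb => simp only [map_add, ha, hb, mul_add, deconcSum_add]
  | tmul a b =>
  simp only [TensorProduct.comm_tmul, LinearMap.lTensor_tmul, coeff₂_tmul]
  rw [hm, ← deconcSum_mul_left]
  congr 1
  funext u₁ u₂
  ring

theorem qcoeff₂_lTensor_flip (hm : IsMinProd r m) :
    qcoeff₂ v u ((m.flip x).lTensor _ (TensorProduct.comm K _ _ t)) =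
      deconcSum (fun u₁ u₂ => ind K (r u₁.minimum u₂.minimum) *
        (qcoeff₂ u₁ v t * qcoeff u₂ x)) u := by
  induction t using TensorProduct.induction_on with
  | zero => simp
  | add a b ha hb => simp only [map_add, ha, hb, mul_add, add_mul, deconcSum_add]
  | tmul a b =>
  simp only [TensorProduct.comm_tmul, LinearMap.lTensor_tmul, coeff₂_tmul, LinearMap.flip_apply]
  rw [hm, ← deconcSum_mul_left]
  congr 1
  funext u₁ u₂
  ring

theorem qcoeff₂_rTensor :
    qcoeff₂ v u (((qshOps K).star x).rTensor _ (TensorProduct.comm K _ _ s)) =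
      deconcSum (fun v₁ v₂ => qcoeff v₁ x * qcoeff₂ u v₂ s) v := by
  induction s using TensorProduct.induction_on with
  | zero => simp
  | add a b ha hb => simp only [map_add, ha, hb, mul_add, deconcSum_add]
  | tmul a b =>
  simp only [TensorProduct.comm_tmul, LinearMap.rTensor_tmul, coeff₂_tmul]
  rw [qcoeff_star, ← deconcSum_mul_right]
  congr 1
  funext v₁ v₂
  ring

theorem qcoeff₂_rTensor_flip :
    qcoeff₂ v u (((qshOps K).star.flip x).rTensor _ (TensorProduct.comm K _ _ t)) =
      deconcSum (fun v₁ v₂ => qcoeff₂ u v₁ t * qcoeff v₂ x) v := by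
  induction t using TensorProduct.induction_on with
  | zero => simp
  | add a b ha hb => simp only [map_add, ha, hb, add_mul, deconcSum_add]
  | tmul a b =>
  simp only [TensorProduct.comm_tmul, LinearMap.rTensor_tmul, coeff₂_tmul, LinearMap.flip_apply]
  rw [qcoeff_star, ← deconcSum_mul_right]
  congr 1
  funext v₁ v₂
  ring

end Packed

end Bidendriform

namespace Bidendriform

-- The bidendriform axioms for the opposite of `QSh`.

section PackedAxioms

variable {K : Type*} [Field K]

theorem isMinProd_prec : IsMinProd (· ≤ ·) (qshOps K).prec := qcoeff_prec

theorem isMinProd_succ : IsMinProd (· > ·) (qshOps K).succ := qcoeff_succ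

theorem orderDetermined_le : OrderDetermined (· ≤ ·) := fun _ _ _ _ h => h

theorem orderDetermined_gt : OrderDetermined (· > ·) := fun _ _ _ _ h => by
  simpa using not_congr h

theorem Ops.opposite_star {A : Type*} [AddCommGroup A] [Module K A] (S : Ops K A) :
    S.opposite.star = S.star.flip := by
  ext a b
  simp [Ops.star, Ops.opposite, add_comm]

theorem Ops.opposite_cotilde {A : Type*} [AddCommGroup A] [Module K A] (S : Ops K A) :
    S.opposite.cotilde = (TensorProduct.comm K A A).toLinearMap ∘ₗ S.cotilde := by
  ext a
  simp [Ops.cotilde, Ops.opposite, add_comm]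

theorem QSh.ext {x y : QSh K} (h : ∀ w, qcoeff w x = qcoeff w y) : x = y :=
  coeff_ext (fun _ h => h) 0 fun w _ _ => h w

/-- An identity of two compositions of products of three elements follows from the equality of the
corresponding conditions on the minima of three consecutive words. -/
theorem minProd_assoc {r₁ r₂ r₃ r₄ : WithTop ℕ → WithTop ℕ → Prop}
    {m₁ m₂ m₃ m₄ : QSh K →ₗ[K] QSh K →ₗ[K] QSh K} (h₁ : IsMinProd r₁ m₁) (h₂ : IsMinProd r₂ m₂)
    (h₃ : IsMinProd r₃ m₃) (h₄ : IsMinProd r₄ m₄)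
    (hr : ∀ a b c, (r₁ (min a b) c ∧ r₂ a b) ↔ (r₃ a (min b c) ∧ r₄ b c)) (x y z : QSh K) :
    m₁ (m₂ x y) z = m₃ x (m₄ y z) := by
  refine QSh.ext fun w => ?_
  have e1 : qcoeff w (m₁ (m₂ x y) z) = deconcSum (fun p r => deconcSum (fun p₁ p₂ =>
      ind K (r₁ (min p₁.minimum p₂.minimum) r.minimum ∧ r₂ p₁.minimum p₂.minimum) *
        (qcoeff p₁ x * qcoeff p₂ y * qcoeff r z)) p) w := by
    rw [h₁]
    refine deconcSum_congr fun p q _ => ?_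
    rw [h₂, ← deconcSum_mul_right, ← deconcSum_mul_left]
    refine deconcSum_congr fun p₁ p₂ hp => ?_
    rw [← hp, List.minimum_append, ← ind_mul_ind]
    ring
  have e2 : qcoeff w (m₃ x (m₄ y z)) = deconcSum (fun p r => deconcSum (fun q₁ q₂ =>
      ind K (r₃ p.minimum (min q₁.minimum q₂.minimum) ∧ r₄ q₁.minimum q₂.minimum) *
        (qcoeff p x * qcoeff q₁ y * qcoeff q₂ z)) r) w := by
    rw [h₃]
    refine deconcSum_congr fun p q _ => ?_
    rw [h₄, ← deconcSum_mul_left, ← deconcSum_mul_left]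
    refine deconcSum_congr fun q₁ q₂ hq => ?_
    rw [← hq, List.minimum_append, ← ind_mul_ind]
    ring
  rw [e1, e2, deconcSum_assoc]
  simp only [hr]

theorem isMinProd_star : IsMinProd (fun _ _ => True) (qshOps K).star := fun w x y => by
  simp only [qcoeff_star, ind_true, one_mul]

-- Codendriform axioms, from the associativity of shuffling.

section Coassociativity

variable {u v w : List ℕ}

/-- Reversal of the three factors of a tensor cube. -/
def tensorRev (A : Type*) [AddCommGroup A] [Module K A] :
    A ⊗[K] (A ⊗[K] A) ≃ₗ[K] A ⊗[K] (A ⊗[K] A) :=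
  (TensorProduct.comm K A (A ⊗[K] A)).trans
    ((TensorProduct.congr (TensorProduct.comm K A A) (LinearEquiv.refl K A)).trans
      (TensorProduct.assoc K A A A))

theorem coeff₃_tensorRev (t : QSh K ⊗[K] (QSh K ⊗[K] QSh K)) :
    coeff₃ K IsSurj u v w (tensorRev (QSh K) t) = coeff₃ K IsSurj w v u t := by
  induction t using TensorProduct.induction_on with
  | zero => simp
  | add a b ha hb => simp only [map_add, ha, hb]
  | tmul a b =>
  induction b using TensorProduct.induction_on with
  | zero => simp
  | add b c hb hc => simp only [TensorProduct.tmul_add, map_add, hb, hc]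
  | tmul b c => simp [tensorRev]; ring

/-- The opposite coproducts exchange the tensor factors, so increasing triples of words have to be
read from right to left. -/
theorem QSh.ext₃ {s t : QSh K ⊗[K] (QSh K ⊗[K] QSh K)}
    (h : ∀ u v w, u ≠ [] → v ≠ [] → w ≠ [] → WordLT u v → WordLT u w → WordLT v w →
      coeff₃ K IsSurj w v u s = coeff₃ K IsSurj w v u t) : s = t := by
  apply (tensorRev (K := K) (QSh K)).injective
  refine coeff₃_ext (fun _ h => h) fun u v w hu hv hw huv huw hvw => ?_
  rw [coeff₃_tensorRev, coeff₃_tensorRev]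
  exact h u v w hu hv hw huv huw hvw

theorem QSh.ext₂ {s t : QSh K ⊗[K] QSh K}
    (h : ∀ u v, u ≠ [] → v ≠ [] → WordLT u v → qcoeff₂ v u s = qcoeff₂ v u t) : s = t := by
  apply (TensorProduct.comm K (QSh K) (QSh K)).injective
  refine coeff₂_ext (fun _ h => h) 0 fun u v hu hv huv _ => ?_
  rw [qcoeff₂_comm, qcoeff₂_comm]
  exact h u v hu hv huv

/-- A linear functional on functions of words. -/
def IsLinearSum (G : (List ℕ → K) → K) : Prop :=
  (∀ f g, G (fun p => f p + g p) = G f + G g) ∧ ∀ c f, G (fun p => c * f p) = c * G f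

/-- Splitting one tensor factor by Δ replaces its test word by the sum `G` over shuffles of two
words. Keeping `G` abstract treats left, right and full shuffles, hence all the coproducts, at once.
-/
theorem coeff₃_assoc_rTensor {Δ : QSh K →ₗ[K] QSh K ⊗[K] QSh K} {G : (List ℕ → K) → K}
    (hG : IsLinearSum G)
    (hΔ : ∀ x, qcoeff₂ w v ((TensorProduct.comm K _ _) (Δ x)) = G fun p => qcoeff p x)
    (t : QSh K ⊗[K] QSh K) :
    coeff₃ K IsSurj w v u (TensorProduct.assoc K _ _ _
      (((TensorProduct.comm K _ _).toLinearMap ∘ₗ Δ).rTensor _ (TensorProduct.comm K _ _ t)))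
      = G fun p => qcoeff₂ u p t := by
  induction t using TensorProduct.induction_on with
  | zero => simpa using (hG.2 0 fun _ => 0).symm
  | add a b ha hb => simp only [map_add, ha, hb, hG.1]
  | tmul a b =>
    simp only [TensorProduct.comm_tmul, LinearMap.rTensor_tmul, LinearMap.comp_apply,
      LinearEquiv.coe_coe, coeff₂_tmul, hG.2, ← hΔ]
    induction Δ b using TensorProduct.induction_on with
    | zero => simp
    | add c d hc hd => simp only [map_add, TensorProduct.add_tmul, hc, hd, mul_add]
    | tmul c d => simp; ring

theorem coeff₃_lTensor {Δ : QSh K →ₗ[K] QSh K ⊗[K] QSh K} {G : (List ℕ → K) → K}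
    (hG : IsLinearSum G)
    (hΔ : ∀ x, qcoeff₂ v u ((TensorProduct.comm K _ _) (Δ x)) = G fun p => qcoeff p x)
    (t : QSh K ⊗[K] QSh K) :
    coeff₃ K IsSurj w v u
      (((TensorProduct.comm K _ _).toLinearMap ∘ₗ Δ).lTensor _ (TensorProduct.comm K _ _ t))
      = G fun p => qcoeff₂ p w t := by
  induction t using TensorProduct.induction_on with
  | zero => simpa using (hG.2 0 fun _ => 0).symm
  | add a b ha hb => simp only [map_add, ha, hb, hG.1]
  | tmul a b =>
    simp only [TensorProduct.comm_tmul, LinearMap.lTensor_tmul, LinearMap.comp_apply,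
      LinearEquiv.coe_coe, coeff₂_tmul, coeff₃_tmul, hΔ]
    rw [mul_comm, mul_comm, ← hG.2]
    congr 1
    funext p
    ring

theorem isLinearSum_left : IsLinearSum (K := K) fun f => leftShuffleSum f u v :=
  ⟨fun f g => leftShuffleSum_add f g u v, fun c f => leftShuffleSum_mul_left c f u v⟩

theorem isLinearSum_right : IsLinearSum (K := K) fun f => rightShuffleSum f u v :=
  ⟨fun f g => rightShuffleSum_add f g u v, fun c f => rightShuffleSum_mul_left c f u v⟩

theorem isLinearSum_shuffle : IsLinearSum (K := K) fun f => shuffleSum f u v :=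
  ⟨fun f g => shuffleSum_add f g u v, fun c f => shuffleSum_mul_left c f u v⟩

theorem wordLT_of_perm_right {p : List ℕ} (h : p.Perm (v ++ w)) (huv : WordLT u v)
    (huw : WordLT u w) : WordLT u p := fun a ha b hb => by
  rcases List.mem_append.1 (h.mem_iff.1 hb) with hb | hb
  · exact huv a ha b hb
  · exact huw a ha b hb

theorem wordLT_of_perm_left {p : List ℕ} (h : p.Perm (u ++ v)) (huw : WordLT u w)
    (hvw : WordLT v w) : WordLT p w := fun a ha b hb => by
  rcases List.mem_append.1 (h.mem_iff.1 ha) with ha | ha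
  · exact huw a ha b hb
  · exact hvw a ha b hb

theorem ne_nil_of_perm {p : List ℕ} (h : p.Perm (u ++ v)) (hu : u ≠ []) : p ≠ [] := by
  rintro rfl
  simp [hu] at h

end Coassociativity

/-- Since `opposite` exchanges Δ_≺ and Δ_≻, both sides sum x over the shuffles of `u`, `v`, `w`
whose first letter comes from `w`. In the next two axioms it comes from `v`, then from `u`. -/
theorem qsh_coprec_coprec :
    (TensorProduct.assoc K _ _ _).toLinearMap ∘ₗ (qshOps K).opposite.coprec.rTensor _ ∘ₗ
      (qshOps K).opposite.coprec
    = (qshOps K).opposite.cotilde.lTensor _ ∘ₗ (qshOps K).opposite.coprec := by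
  refine LinearMap.ext fun x => QSh.ext₃ fun u v w hu hv hw huv huw hvw => ?_
  rw [Ops.opposite_cotilde]
  simp only [Ops.opposite, LinearMap.comp_apply, LinearEquiv.coe_coe]
  rw [coeff₃_assoc_rTensor isLinearSum_right fun x =>
      (qcoeff₂_comm _).trans (qcoeff₂_cosucc hvw hv hw x),
    coeff₃_lTensor isLinearSum_shuffle fun x =>
      (qcoeff₂_comm _).trans (qcoeff₂_cotilde huv hu hv x)]
  rw [rightShuffleSum_congr (fun _ _ => True) (pairwise_true _) (pairwise_true _) (by simp)
      fun p hp _ => qcoeff₂_cosucc (wordLT_of_perm_right hp huv huw) hu (ne_nil_of_perm hp hv) x,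
    shuffleSum_congr (fun _ _ => True) (pairwise_true _) (pairwise_true _) (by simp)
      fun p hp _ => qcoeff₂_cosucc (wordLT_of_perm_left hp huw hvw) (ne_nil_of_perm hp hu) hw x,
    shuffleSum_right]

theorem qsh_cosucc_coprec :
    (TensorProduct.assoc K _ _ _).toLinearMap ∘ₗ (qshOps K).opposite.cosucc.rTensor _ ∘ₗ
      (qshOps K).opposite.coprec
    = (qshOps K).opposite.coprec.lTensor _ ∘ₗ (qshOps K).opposite.cosucc := by
  refine LinearMap.ext fun x => QSh.ext₃ fun u v w hu hv hw huv huw hvw => ?_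
  simp only [Ops.opposite, LinearMap.comp_apply, LinearEquiv.coe_coe]
  rw [coeff₃_assoc_rTensor isLinearSum_left fun x =>
      (qcoeff₂_comm _).trans (qcoeff₂_coprec hvw hv hw x),
    coeff₃_lTensor isLinearSum_right fun x =>
      (qcoeff₂_comm _).trans (qcoeff₂_cosucc huv hu hv x)]
  rw [leftShuffleSum_congr (fun _ _ => True) (pairwise_true _) (pairwise_true _) (by simp)
      fun p hp _ => qcoeff₂_cosucc (wordLT_of_perm_right hp huv huw) hu (ne_nil_of_perm hp hv) x,
    rightShuffleSum_congr (fun _ _ => True) (pairwise_true _) (pairwise_true _) (by simp)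
      fun p hp _ => qcoeff₂_coprec (wordLT_of_perm_left hp huw hvw) (ne_nil_of_perm hp hu) hw x,
    rightShuffleSum_left]

theorem qsh_cotilde_cosucc :
    (TensorProduct.assoc K _ _ _).toLinearMap ∘ₗ (qshOps K).opposite.cotilde.rTensor _ ∘ₗ
      (qshOps K).opposite.cosucc
    = (qshOps K).opposite.cosucc.lTensor _ ∘ₗ (qshOps K).opposite.cosucc := by
  refine LinearMap.ext fun x => QSh.ext₃ fun u v w hu hv hw huv huw hvw => ?_
  rw [Ops.opposite_cotilde]
  simp only [Ops.opposite, LinearMap.comp_apply, LinearEquiv.coe_coe]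
  rw [coeff₃_assoc_rTensor isLinearSum_shuffle fun x =>
      (qcoeff₂_comm _).trans (qcoeff₂_cotilde hvw hv hw x),
    coeff₃_lTensor isLinearSum_left fun x =>
      (qcoeff₂_comm _).trans (qcoeff₂_coprec huv hu hv x)]
  rw [shuffleSum_congr (fun _ _ => True) (pairwise_true _) (pairwise_true _) (by simp)
      fun p hp _ => qcoeff₂_coprec (wordLT_of_perm_right hp huv huw) hu (ne_nil_of_perm hp hv) x,
    leftShuffleSum_congr (fun _ _ => True) (pairwise_true _) (pairwise_true _) (by simp)
      fun p hp _ => qcoeff₂_coprec (wordLT_of_perm_left hp huw hvw) (ne_nil_of_perm hp hu) hw x,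
    leftShuffleSum_left]

theorem minimum_lt_top {u : List ℕ} (hu : u ≠ []) : u.minimum < ⊤ :=
  lt_top_iff_ne_top.2 (List.minimum_ne_top_of_ne_nil hu)

/-- The opposite of `QSh` is a bidendriform bialgebra. -/
theorem qsh_opposite : (qshOps K).opposite.IsBidendriformBialgebra where
  prec_prec a b c := by
    rw [Ops.opposite_star]
    -- The opposite products reverse the arguments, hence the order c, b, a. What remains is that
    -- `min x y > z` is equivalent to `x > min y z` and `y > z`; the next two axioms reduce to
    -- similar facts.
    refine (minProd_assoc isMinProd_succ isMinProd_star isMinProd_succ isMinProd_succ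
      (fun x y z => ?_) c b a).symm
    grind
  succ_prec a b c := by
    refine (minProd_assoc isMinProd_prec isMinProd_succ isMinProd_succ isMinProd_prec
      (fun x y z => ?_) c b a).symm
    grind
  star_succ a b c := by
    rw [Ops.opposite_star]
    refine (minProd_assoc isMinProd_prec isMinProd_prec isMinProd_prec isMinProd_star
      (fun x y z => ?_) c b a).symm
    grind
  coprec_coprec := qsh_coprec_coprec
  cosucc_coprec := qsh_cosucc_coprec
  cotilde_cosucc := qsh_cotilde_cosucc
  cosucc_succ a b := by
    refine QSh.ext₂ fun u v hu hv h => ?_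
    rw [Ops.opposite_star, Ops.opposite_cotilde]
    simp only [Ops.opposite, LinearMap.comp_apply, LinearEquiv.coe_coe, LinearMap.flip_apply,
      LinearMap.flip_flip, map_add]
    -- The opposite of ≻ is ⪯ and that of Δ_≻ is Δ_≺. Both terms with `u₂` empty survive because
    -- `min u ≤ ⊤`.
    rw [qcoeff₂_comm, qcoeff₂_coprec_minProd orderDetermined_le isMinProd_prec h hu hv,
      qcoeff₂_map₂ _ _ isMinProd_prec, qcoeff₂_lTensor _ _ isMinProd_prec,
      qcoeff₂_lTensor_flip _ _ isMinProd_prec, qcoeff₂_rTensor_flip, coeff₂_tmul,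
      ind_true le_top]
    ring
  cosucc_prec a b := by
    refine QSh.ext₂ fun u v hu hv h => ?_
    rw [Ops.opposite_star, Ops.opposite_cotilde]
    simp only [Ops.opposite, LinearMap.comp_apply, LinearEquiv.coe_coe, LinearMap.flip_apply,
      LinearMap.flip_flip, map_add]
    -- With ≻ the terms with `u₂` empty drop out, `min u > ⊤` being false; this is why the formula
    -- has two terms fewer.
    rw [qcoeff₂_comm, qcoeff₂_coprec_minProd orderDetermined_gt isMinProd_succ h hu hv,
      qcoeff₂_map₂ _ _ isMinProd_succ, qcoeff₂_lTensor _ _ isMinProd_succ,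
      qcoeff₂_lTensor_flip _ _ isMinProd_succ, ind_false (not_lt.2 le_top)]
    ring
  coprec_succ a b := by
    refine QSh.ext₂ fun u v hu hv h => ?_
    rw [Ops.opposite_star, Ops.opposite_cotilde]
    simp only [Ops.opposite, LinearMap.comp_apply, LinearEquiv.coe_coe, LinearMap.flip_apply,
      map_add]
    -- The term with `u₂` empty survives; those with `u₁` empty would need `⊤ ≤ min u`, impossible
    -- for nonempty `u`.
    rw [qcoeff₂_comm, qcoeff₂_cosucc_minProd orderDetermined_le isMinProd_prec h hu hv,
      qcoeff₂_map₂ _ _ isMinProd_prec, qcoeff₂_lTensor_flip _ _ isMinProd_prec,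
      qcoeff₂_rTensor_flip, ind_true le_top, ind_false (not_le.2 (minimum_lt_top hu))]
    ring
  coprec_prec a b := by
    refine QSh.ext₂ fun u v hu hv h => ?_
    rw [Ops.opposite_star, Ops.opposite_cotilde]
    simp only [Ops.opposite, LinearMap.comp_apply, LinearEquiv.coe_coe, LinearMap.flip_apply,
      LinearMap.flip_flip, map_add]
    -- Conversely, the terms with `u₁` empty survive here and the one with `u₂` empty vanishes.
    rw [qcoeff₂_comm, qcoeff₂_cosucc_minProd orderDetermined_gt isMinProd_succ h hu hv,
      qcoeff₂_map₂ _ _ isMinProd_succ, qcoeff₂_lTensor_flip _ _ isMinProd_succ,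
      qcoeff₂_rTensor, coeff₂_tmul, ind_true (minimum_lt_top hu), ind_false (not_lt.2 le_top)]
    ring

end PackedAxioms

end Bidendriform

namespace Bidendriform

/-! ### Transfer of the axioms along injective morphisms -/

namespace Ops

section Transfer

variable {K : Type*} [Field K] {A B : Type*} [AddCommGroup A] [Module K A] [AddCommGroup B]
  [Module K B] {S : Ops K A} {T : Ops K B} {f : A →ₗ[K] B}

theorem IsBidendriformHom.opposite (h : IsBidendriformHom S T f) :
    IsBidendriformHom S.opposite T.opposite f where
  map_prec a b := h.map_succ b a
  map_succ a b := h.map_prec b a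
  map_coprec := by
    simp only [Ops.opposite, LinearMap.comp_assoc, h.map_cosucc]
    simp only [← LinearMap.comp_assoc]
    congr 1
    ext x y
    simp
  map_cosucc := by
    simp only [Ops.opposite, LinearMap.comp_assoc, h.map_coprec]
    simp only [← LinearMap.comp_assoc]
    congr 1
    ext x y
    simp

theorem IsBidendriformHom.map_star (h : IsBidendriformHom S T f) (a b : A) :
    f (S.star a b) = T.star (f a) (f b) := by
  simp [star, h.map_prec, h.map_succ]

theorem IsBidendriformHom.map_cotilde (h : IsBidendriformHom S T f) :
    T.cotilde ∘ₗ f = TensorProduct.map f f ∘ₗ S.cotilde := by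
  simp only [cotilde, LinearMap.add_comp, LinearMap.comp_add, h.map_coprec, h.map_cosucc]

theorem map_assoc_rTensor {Δ : A →ₗ[K] A ⊗[K] A} {Δ' : B →ₗ[K] B ⊗[K] B}
    (h : Δ' ∘ₗ f = TensorProduct.map f f ∘ₗ Δ) (t : A ⊗[K] A) :
    TensorProduct.map f (TensorProduct.map f f) (TensorProduct.assoc K A A A (Δ.rTensor A t))
      = TensorProduct.assoc K B B B (Δ'.rTensor B (TensorProduct.map f f t)) := by
  induction t using TensorProduct.induction_on with
  | zero => simp
  | add x y hx hy => simp only [map_add, hx, hy]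
  | tmul x y =>
    have := LinearMap.congr_fun h x
    simp only [LinearMap.comp_apply] at this
    simp only [LinearMap.rTensor_tmul, TensorProduct.map_tmul, this]
    induction Δ x using TensorProduct.induction_on with
    | zero => simp
    | add x y hx hy => simp only [map_add, TensorProduct.add_tmul, hx, hy]
    | tmul x y => simp

theorem map_lTensor {Δ : A →ₗ[K] A ⊗[K] A} {Δ' : B →ₗ[K] B ⊗[K] B}
    (h : Δ' ∘ₗ f = TensorProduct.map f f ∘ₗ Δ) (t : A ⊗[K] A) :
    TensorProduct.map f (TensorProduct.map f f) (Δ.lTensor A t)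
      = Δ'.lTensor B (TensorProduct.map f f t) := by
  induction t using TensorProduct.induction_on with
  | zero => simp
  | add x y hx hy => simp only [map_add, hx, hy]
  | tmul x y =>
    have := LinearMap.congr_fun h y
    simp only [LinearMap.comp_apply] at this
    simp only [LinearMap.lTensor_tmul, TensorProduct.map_tmul, this]

theorem map_map₂ {m n : A →ₗ[K] A →ₗ[K] A} {m' n' : B →ₗ[K] B →ₗ[K] B}
    (hm : ∀ a b, f (m a b) = m' (f a) (f b)) (hn : ∀ a b, f (n a b) = n' (f a) (f b))
    (s t : A ⊗[K] A) :
    TensorProduct.map f f (TensorProduct.map₂ m n s t)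
      = TensorProduct.map₂ m' n' (TensorProduct.map f f s) (TensorProduct.map f f t) := by
  induction s using TensorProduct.induction_on with
  | zero => simp
  | add x y hx hy => simp only [map_add, LinearMap.add_apply, hx, hy]
  | tmul x y =>
  induction t using TensorProduct.induction_on with
  | zero => simp
  | add x y hx hy => simp only [map_add, hx, hy]
  | tmul x' y' => simp [hm, hn]

theorem map_rTensor_apply {g : A →ₗ[K] A} {g' : B →ₗ[K] B} (h : ∀ a, f (g a) = g' (f a))
    (t : A ⊗[K] A) :
    TensorProduct.map f f (g.rTensor A t) = g'.rTensor B (TensorProduct.map f f t) := by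
  induction t using TensorProduct.induction_on with
  | zero => simp
  | add x y hx hy => simp only [map_add, hx, hy]
  | tmul x y => simp [h]

theorem map_lTensor_apply {g : A →ₗ[K] A} {g' : B →ₗ[K] B} (h : ∀ a, f (g a) = g' (f a))
    (t : A ⊗[K] A) :
    TensorProduct.map f f (g.lTensor A t) = g'.lTensor B (TensorProduct.map f f t) := by
  induction t using TensorProduct.induction_on with
  | zero => simp
  | add x y hx hy => simp only [map_add, hx, hy]
  | tmul x y => simp [h]

/-- A structure which embeds in a bidendriform bialgebra is a bidendriform bialgebra. -/
theorem IsBidendriformBialgebra.of_injective (hT : T.IsBidendriformBialgebra)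
    (h : IsBidendriformHom S T f) (hf : Function.Injective f) : S.IsBidendriformBialgebra := by
  -- Over a field all modules are flat, so the tensor square and cube of `f` stay injective and
  -- identities may be checked in the target.
  have hff : Function.Injective (TensorProduct.map f f) :=
    TensorProduct.map_injective_of_flat_flat _ _ hf hf
  have hfff : Function.Injective (TensorProduct.map f (TensorProduct.map f f)) :=
    TensorProduct.map_injective_of_flat_flat _ _ hf hff
  have hp := LinearMap.congr_fun h.map_coprec
  have hs := LinearMap.congr_fun h.map_cosucc
  have ht := LinearMap.congr_fun h.map_cotilde
  simp only [LinearMap.comp_apply] at hp hs ht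
  constructor
  · exact fun a b c => hf (by simp only [h.map_prec, h.map_star, hT.prec_prec])
  · exact fun a b c => hf (by simp only [h.map_prec, h.map_succ, hT.succ_prec])
  · exact fun a b c => hf (by simp only [h.map_succ, h.map_star, hT.star_succ])
  · refine LinearMap.ext fun x => hfff ?_
    simp only [LinearMap.comp_apply, LinearEquiv.coe_coe, map_assoc_rTensor h.map_coprec,
      map_lTensor h.map_cotilde, ← hp]
    exact LinearMap.congr_fun hT.coprec_coprec (f x)
  · refine LinearMap.ext fun x => hfff ?_
    simp only [LinearMap.comp_apply, LinearEquiv.coe_coe, map_assoc_rTensor h.map_cosucc,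
      map_lTensor h.map_coprec, ← hp, ← hs]
    exact LinearMap.congr_fun hT.cosucc_coprec (f x)
  · refine LinearMap.ext fun x => hfff ?_
    simp only [LinearMap.comp_apply, LinearEquiv.coe_coe, map_assoc_rTensor h.map_cotilde,
      map_lTensor h.map_cosucc, ← hs]
    exact LinearMap.congr_fun hT.cotilde_cosucc (f x)
  · intro a b
    apply hff
    rw [← hs, h.map_succ, hT.cosucc_succ]
    simp only [map_add, map_map₂ h.map_star h.map_succ, TensorProduct.map_tmul, ht, hs,
      map_lTensor_apply (h.map_succ a), map_rTensor_apply (h.map_star a),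
      map_lTensor_apply (g := S.succ.flip b) (g' := T.succ.flip (f b)) fun x => h.map_succ x b]
  · intro a b
    apply hff
    rw [← hs, h.map_prec, hT.cosucc_prec]
    simp only [map_add, map_map₂ h.map_star h.map_prec, ht, hs,
      map_lTensor_apply (h.map_prec a),
      map_lTensor_apply (g := S.prec.flip b) (g' := T.prec.flip (f b)) fun x => h.map_prec x b]
  · intro a b
    apply hff
    rw [← hp, h.map_succ, hT.coprec_succ]
    simp only [map_add, map_map₂ h.map_star h.map_succ, ht, hp,
      map_lTensor_apply (h.map_succ a), map_rTensor_apply (h.map_star a)]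
  · intro a b
    apply hff
    rw [← hp, h.map_prec, hT.coprec_prec]
    simp only [map_add, map_map₂ h.map_star h.map_prec, TensorProduct.map_tmul, ht, hp,
      map_lTensor_apply (h.map_prec a),
      map_rTensor_apply (g := S.star.flip b) (g' := T.star.flip (f b)) fun x => h.map_star x b]

end Transfer

end Ops

/-! ### Standardization and the morphism `Ψ` -/

/-- `y` is on the right of `x`; the second component refines the order of the first one, ties being
broken from left to right. -/
def StdRel (x y : ℕ × ℕ) : Prop := (x.1 ≤ y.1 ↔ x.2 < y.2) ∧ x.2 ≠ y.2

/-- The second components form a word in the same relative order as the standardization of the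
word of first components. -/
def IsStd (z : List (ℕ × ℕ)) : Prop := z.Pairwise StdRel

theorem exists_isStd (w : List ℕ) : ∃ z, IsStd z ∧ z.map Prod.fst = w := by
  -- Encodes the lexicographic order on (letter, position): positions are smaller than `w.length`,
  -- so they only break ties between equal letters.
  refine ⟨w.zipIdx.map fun x => (x.1, x.1 * w.length + x.2), ?_, ?_⟩
  · rw [IsStd, List.pairwise_iff_getElem]
    intro i j hi hj hij
    simp only [List.length_map, List.length_zipIdx] at hi hj
    simp only [List.getElem_map, List.getElem_zipIdx, zero_add, StdRel]
    generalize w[i] = a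
    generalize w[j] = b
    rcases le_or_gt a b with h | h
    · have := Nat.mul_le_mul_right w.length h
      exact ⟨by simp [h]; omega, by omega⟩
    · have := Nat.mul_le_mul_right w.length (Nat.succ_le_of_lt h)
      rw [Nat.succ_mul] at this
      exact ⟨by simp [not_le.2 h]; omega, by omega⟩
  · rw [List.map_map]
    exact List.zipIdx_map_fst 0 w

theorem IsStd.nodup {z : List (ℕ × ℕ)} (h : IsStd z) : (z.map Prod.snd).Nodup := by
  rw [List.Nodup, List.pairwise_map]
  exact h.imp fun h => h.2

theorem isStd_diag {w : List ℕ} (h : w.Nodup) : IsStd (w.map fun a => (a, a)) := by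
  rw [IsStd, List.pairwise_map]
  exact h.imp fun {a b} h => ⟨by simp; omega, h⟩

theorem getElem_pack (w : List ℕ) (i : ℕ) (h : i < (pack w).length) :
    (pack w)[i] = letterRank w (w[i]'(by simpa using h)) := by
  simp [pack_eq_map]

theorem getElem_pack_le_iff (w : List ℕ) {i j : ℕ} (hi : i < w.length) (hj : j < w.length) :
    (pack w)[i]'(by simpa using hi) ≤ (pack w)[j]'(by simpa using hj) ↔ w[i] ≤ w[j] := by
  rw [getElem_pack, getElem_pack, letterRank_le_iff _ (List.getElem_mem hi)]

/-- As σ has no ties, the two clauses of τ ≤ σ say that for i < j one has σ(i) < σ(j) exactly when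
τ(i) ≤ τ(j). This fixes the relative order of σ: it is the standardization of τ. -/
theorem IsStd.wordLE_iff {z : List (ℕ × ℕ)} (h : IsStd z) {σ : List ℕ} (hσ : IsPerm σ) :
    WordLE (pack (z.map Prod.fst)) σ ↔ pack (z.map Prod.snd) = σ := by
  have hz := List.pairwise_iff_getElem.1 h
  have hf : ∀ i j (hi : i < z.length) (hj : j < z.length),
      ((pack (z.map Prod.fst)).getD i 0 ≤ (pack (z.map Prod.fst)).getD j 0 ↔ z[i].1 ≤ z[j].1) := by
    intro i j hi hj
    rw [List.getD_eq_getElem _ _ (by simpa), List.getD_eq_getElem _ _ (by simpa),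
      getElem_pack_le_iff _ (by simpa) (by simpa)]
    simp
  have hs : ∀ i j (hi : i < z.length) (hj : j < z.length),
      ((pack (z.map Prod.snd)).getD i 0 ≤ (pack (z.map Prod.snd)).getD j 0 ↔ z[i].2 ≤ z[j].2) := by
    intro i j hi hj
    rw [List.getD_eq_getElem _ _ (by simpa), List.getD_eq_getElem _ _ (by simpa),
      getElem_pack_le_iff _ (by simpa) (by simpa)]
    simp
  constructor
  · rintro ⟨hl, hle⟩
    simp only [length_pack, List.length_map] at hl
    rw [← hσ.2.1.pack_eq]
    -- Both words are viewed as functions of the position, so that `pack_map_congr` compares them.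
    have e1 : z.map Prod.snd = (List.finRange z.length).map fun i => z[i].2 := by
      apply List.ext_getElem <;> simp
    have e2 : σ = (List.finRange z.length).map fun i : Fin z.length => σ.getD i 0 := by
      apply List.ext_getElem
      · simp [hl]
      · intro i h1 h2
        simp [h1]
    rw [e1]
    conv_rhs => rw [e2]
    refine pack_map_congr _ _ _ fun i _ j _ => ?_
    have key : ∀ i j, i < j → j < z.length → σ.getD i 0 ≠ σ.getD j 0 := by
      intro i j hij hj
      rw [List.getD_eq_getElem _ _ (by omega), List.getD_eq_getElem _ _ (by omega)]
      exact List.pairwise_iff_getElem.1 hσ.2.2 i j _ _ hij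
    rcases lt_trichotomy (i : ℕ) j with hij | hij | hij
    · have h1 := hz i j i.2 j.2 hij
      have h2 := hle i (by omega) j (by omega)
      have h3 := key i j hij j.2
      have h4 := hf i j i.2 j.2
      unfold StdRel at h1
      simp only [Fin.getElem_fin]
      omega
    · obtain rfl := Fin.ext hij
      simp
    · have h1 := hz j i j.2 i.2 hij
      have h2 := hle j (by omega) i (by omega)
      have h3 := key j i hij i.2
      have h4 := hf j i j.2 i.2
      unfold StdRel at h1
      simp only [Fin.getElem_fin]
      omega
  · rintro rfl
    refine ⟨by simp, fun i hi j hj => ?_⟩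
    simp only [length_pack, List.length_map] at hi hj
    have hf1 := hf i j hi hj
    have hs1 := hs i j hi hj
    have hs2 := hs j i hj hi
    have hf2 := hf j i hj hi
    rcases lt_trichotomy i j with hij | rfl | hij
    · have h1 := hz i j hi hj hij
      unfold StdRel at h1
      omega
    · omega
    · have h1 := hz j i hj hi hij
      unfold StdRel at h1
      omega

-- Ψ as composition with standardization; injectivity and morphism property.

section PsiMap

variable {K : Type*} [Field K]

/-- In terms of functions on words, Ψ is composition with standardization: Ψ(x)(w) = x(std w). -/
theorem IsStd.coeff_Psi {z : List (ℕ × ℕ)} (h : IsStd z) (x : Sh K) :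
    qcoeff (z.map Prod.fst) (Psi K x) = coeff K IsPerm (z.map Prod.snd) x := by
  classical
  induction x using Finsupp.induction_linear with
  | zero => simp
  | add x y hx hy => simp only [map_add, hx, hy]
  | single σ a =>
    rw [coeff_single, Psi, Finsupp.linearCombination_single, map_smul, smul_eq_mul,
      coeff_sum_basisVec]
    · congr 1
      refine ind_congr ?_
      rw [Finset.mem_filter, mem_packedWords, h.wordLE_iff σ.2]
      refine ⟨fun h => h.2, fun e => ⟨⟨isPacked_pack _, ?_⟩, e⟩⟩
      rw [← e]
      simp
    · intro u hu
      rw [Finset.mem_filter, mem_packedWords] at hu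
      refine ⟨?_, hu.1.1⟩
      rintro rfl
      exact σ.2.1 (List.length_eq_zero_iff.1 hu.1.2.symm)

/-- A permutation is its own standardization, so the values of Ψ(x) at permutations are those of x.
-/
theorem Psi_injective : Function.Injective (Psi K) := by
  intro x y e
  ext σ
  have h := isStd_diag σ.2.2.2
  have hx := h.coeff_Psi x
  have hy := h.coeff_Psi y
  simp only [List.map_map, Function.comp_def, List.map_id'] at hx hy
  rw [← coeff_eq_apply K x σ σ.2.2.1.pack_eq, ← coeff_eq_apply K y σ σ.2.2.1.pack_eq, ← hx, ← hy, e]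

theorem deconcSum_map {α β : Type*} (φ : α → β) (F : List β → List β → K) (z : List α) :
    deconcSum F (z.map φ) = deconcSum (fun p q => F (p.map φ) (q.map φ)) z := by
  simp [deconcSum_eq_sum]

theorem minimum_le_minimum_iff {p q : List ℕ} (hp : p ≠ []) :
    p.minimum ≤ q.minimum ↔ ∃ a ∈ p, ∀ b ∈ q, a ≤ b := by
  constructor
  · intro h
    obtain ⟨a, ha⟩ := WithTop.ne_top_iff_exists.1 (List.minimum_ne_top_of_ne_nil hp)
    refine ⟨a, List.minimum_mem ha.symm, fun b hb => ?_⟩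
    have := List.minimum_le_of_mem' hb
    rw [← ha] at h
    exact WithTop.coe_le_coe.1 (h.trans this)
  · rintro ⟨a, ha, h⟩
    exact List.le_minimum_of_forall_le fun b hb =>
      (List.minimum_le_of_mem' ha).trans (WithTop.coe_le_coe.2 (h b hb))

variable {p q : List (ℕ × ℕ)}

/-- A letter of `p` stands to the left of one of `q`, so a tie between them is resolved in its
favour: a strict comparison after standardization is a weak one before. This is why Ψ sends ≺ to ⪯.
If both words were empty, ⊤ ≤ ⊤ would hold but not ⊤ < ⊤. -/
theorem IsStd.minimum_lt_iff (h : IsStd (p ++ q)) (hp : p ≠ []) :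
    (p.map Prod.snd).minimum < (q.map Prod.snd).minimum ↔
      (p.map Prod.fst).minimum ≤ (q.map Prod.fst).minimum := by
  rw [minimum_lt_minimum_iff, minimum_le_minimum_iff (by simpa using hp)]
  have h' := (List.pairwise_append.1 h).2.2
  simp only [List.mem_map, exists_exists_and_eq_and, forall_exists_index, and_imp,
    forall_apply_eq_imp_iff₂]
  exact exists_congr fun a => and_congr_right fun ha => forall₂_congr fun b hb =>
    (h' a ha b hb).1.symm

theorem IsStd.minimum_gt_iff (h : IsStd (p ++ q)) :
    (p.map Prod.snd).minimum > (q.map Prod.snd).minimum ↔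
      (p.map Prod.fst).minimum > (q.map Prod.fst).minimum := by
  rw [gt_iff_lt, gt_iff_lt, minimum_lt_minimum_iff, minimum_lt_minimum_iff]
  have h' := (List.pairwise_append.1 h).2.2
  simp only [List.mem_map, exists_exists_and_eq_and, forall_exists_index, and_imp,
    forall_apply_eq_imp_iff₂]
  refine exists_congr fun b => and_congr_right fun hb => forall₂_congr fun a ha => ?_
  have := h' a ha b hb
  unfold StdRel at this
  omega

theorem shcoeff_wordProd {r : WithTop ℕ → WithTop ℕ → Prop} (hr : MinInvariant r)
    {z : List (ℕ × ℕ)} (hz : IsStd z) (x y : Sh K) :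
    coeff K IsPerm (z.map Prod.snd) (wordProd K IsPerm r x y) = deconcSum (fun p q =>
      ind K (r (p.map Prod.snd).minimum (q.map Prod.snd).minimum) *
        (qcoeff (p.map Prod.fst) (Psi K x) * qcoeff (q.map Prod.fst) (Psi K y))) z := by
  rw [coeff_wordProd (fun _ h => h.1) hr (fun h => isPerm_pack h hz.nodup), deconcSum_map]
  refine deconcSum_congr fun p q hpq => ?_
  subst hpq
  have h' := List.pairwise_append.1 hz
  rw [IsStd.coeff_Psi h'.1, IsStd.coeff_Psi h'.2.1]

theorem Psi_prec (x y : Sh K) :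
    Psi K ((shOps K).prec x y) = (qshOps K).prec (Psi K x) (Psi K y) := by
  refine QSh.ext fun w => ?_
  obtain ⟨z, hz, rfl⟩ := exists_isStd w
  rw [hz.coeff_Psi, qcoeff_prec, deconcSum_map, shOps, shcoeff_wordProd minInvariant_lt hz]
  refine deconcSum_congr fun p q hpq => ?_
  subst hpq
  -- The comparison of minima may differ for an empty front, but such a cut contributes zero on both
  -- sides.
  rcases eq_or_ne p [] with rfl | hp
  · simp only [List.map_nil, qcoeff_nil, zero_mul, mul_zero]
  · rw [ind_congr (hz.minimum_lt_iff hp)]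

theorem Psi_succ (x y : Sh K) :
    Psi K ((shOps K).succ x y) = (qshOps K).succ (Psi K x) (Psi K y) := by
  refine QSh.ext fun w => ?_
  obtain ⟨z, hz, rfl⟩ := exists_isStd w
  rw [hz.coeff_Psi, qcoeff_succ, deconcSum_map, shOps, shcoeff_wordProd minInvariant_gt hz]
  refine deconcSum_congr fun p q hpq => ?_
  subst hpq
  rw [ind_congr hz.minimum_gt_iff]

theorem IsStd.wordLT (h : IsStd (p ++ q)) (h' : WordLT (p.map Prod.fst) (q.map Prod.fst)) :
    WordLT (p.map Prod.snd) (q.map Prod.snd) := by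
  have hpq := (List.pairwise_append.1 h).2.2
  simp only [WordLT, List.mem_map, forall_exists_index, and_imp, forall_apply_eq_imp_iff₂] at h' ⊢
  exact fun a ha b hb => (hpq a ha b hb).1.1 (h' a ha b hb).le

/-- There is no tie between `p` and `q`, so their relative position is irrelevant; hence every
shuffle of `p` and `q` is again standardized by its second components. -/
theorem IsStd.stdRel_swap (h : IsStd (p ++ q)) (h' : WordLT (p.map Prod.fst) (q.map Prod.fst)) :
    ∀ a ∈ p, ∀ b ∈ q, StdRel a b ∧ StdRel b a := by
  have hpq := (List.pairwise_append.1 h).2.2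
  simp only [WordLT, List.mem_map, forall_exists_index, and_imp, forall_apply_eq_imp_iff₂] at h'
  intro a ha b hb
  have h1 := hpq a ha b hb
  have h2 := h' a ha b hb
  unfold StdRel at h1 ⊢
  omega

theorem coeff₂_map_Psi (hp : IsStd p) (hq : IsStd q) (t : Sh K ⊗[K] Sh K) :
    qcoeff₂ (p.map Prod.fst) (q.map Prod.fst) (TensorProduct.map (Psi K) (Psi K) t)
      = coeff₂ K IsPerm (p.map Prod.snd) (q.map Prod.snd) t := by
  induction t using TensorProduct.induction_on with
  | zero => simp
  | add x y hx hy => simp only [map_add, hx, hy]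
  | tmul x y => rw [TensorProduct.map_tmul, coeff₂_tmul, coeff₂_tmul, hp.coeff_Psi, hq.coeff_Psi]

theorem Psi_coprec :
    (qshOps K).coprec ∘ₗ Psi K = TensorProduct.map (Psi K) (Psi K) ∘ₗ (shOps K).coprec := by
  refine LinearMap.ext fun x => coeff₂_ext (fun _ h => h) 0 fun u v hu hv huv _ => ?_
  -- The two words are standardized jointly, which keeps the standardized letters of `u` below those
  -- of `v`.
  obtain ⟨z, hz, hzw⟩ := exists_isStd (u ++ v)
  obtain ⟨p, q, rfl, rfl, rfl⟩ := List.map_eq_append_iff.1 hzw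
  have hpq := List.pairwise_append.1 hz
  rw [LinearMap.comp_apply, LinearMap.comp_apply, qcoeff₂_coprec huv hu hv,
    coeff₂_map_Psi hpq.1 hpq.2.1, shOps,
    coeff₂_wordCoprec (fun _ h => ⟨h.1, h.2.1⟩) (fun _ h _ => h.lower_upper) (hz.wordLT huv)
      (by simpa using hu) (by simpa using hv), leftShuffleSum_map, leftShuffleSum_map]
  exact leftShuffleSum_congr StdRel hpq.1 hpq.2.1 (hz.stdRel_swap huv) fun _ _ h =>
    IsStd.coeff_Psi h x

theorem Psi_cosucc :
    (qshOps K).cosucc ∘ₗ Psi K = TensorProduct.map (Psi K) (Psi K) ∘ₗ (shOps K).cosucc := by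
  refine LinearMap.ext fun x => coeff₂_ext (fun _ h => h) 0 fun u v hu hv huv _ => ?_
  obtain ⟨z, hz, hzw⟩ := exists_isStd (u ++ v)
  obtain ⟨p, q, rfl, rfl, rfl⟩ := List.map_eq_append_iff.1 hzw
  have hpq := List.pairwise_append.1 hz
  rw [LinearMap.comp_apply, LinearMap.comp_apply, qcoeff₂_cosucc huv hu hv,
    coeff₂_map_Psi hpq.1 hpq.2.1, shOps,
    coeff₂_wordCosucc (fun _ h => ⟨h.1, h.2.1⟩) (fun _ h _ => h.lower_upper) (hz.wordLT huv)
      (by simpa using hu) (by simpa using hv), rightShuffleSum_map, rightShuffleSum_map]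
  exact rightShuffleSum_congr StdRel hpq.1 hpq.2.1 (hz.stdRel_swap huv) fun _ _ h =>
    IsStd.coeff_Psi h x

theorem Psi_isBidendriformHom : Ops.IsBidendriformHom (shOps K) (qshOps K) (Psi K) where
  map_prec := Psi_prec
  map_succ := Psi_succ
  map_coprec := Psi_coprec
  map_cosucc := Psi_cosucc

/-- The opposite of `Sh` is a bidendriform bialgebra. -/
theorem sh_opposite : (shOps K).opposite.IsBidendriformBialgebra :=
  qsh_opposite.of_injective Psi_isBidendriformHom.opposite Psi_injective

end PsiMap

end Bidendriform

namespace Bidendriform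

open PlanarTree

/-! ### The trees of packed words -/

theorem splitOn_map {m : ℕ} {φ : ℕ → ℕ} (w : List ℕ) (h : ∀ x ∈ w, φ x = φ m ↔ x = m) :
    (w.map φ).splitOn (φ m) = (w.splitOn m).map (List.map φ) := by
  induction w with
  | nil => simp
  | cons x w ih =>
    have hx := h x (by simp)
    rw [List.map_cons, List.splitOn_cons_eq_if_modifyHead, List.splitOn_cons_eq_if_modifyHead,
      ih fun y hy => h y (by simp [hy])]
    by_cases hxm : x = m
    · simp [hxm]
    · have hxm' : ¬ φ x = φ m := fun e => hxm (hx.1 e)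
      simp only [beq_iff_eq, hxm, hxm', if_false]
      cases w.splitOn m <;> simp

theorem mem_of_mem_splitOn {m : ℕ} {w b : List ℕ} (hb : b ∈ w.splitOn m) {x : ℕ} (hx : x ∈ b) :
    x ∈ w := by
  induction w generalizing b with
  | nil => simp at hb; simp [hb] at hx
  | cons y w ih =>
    rw [List.splitOn_cons_eq_if_modifyHead] at hb
    split_ifs at hb
    · rcases List.mem_cons.1 hb with rfl | hb
      · simp at hx
      · exact List.mem_cons_of_mem _ (ih hb hx)
    · cases hs : w.splitOn m with
      | nil => simp [hs] at hb
      | cons c l =>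
        rw [hs] at hb ih
        rcases List.mem_cons.1 hb with rfl | hb
        · rcases List.mem_cons.1 hx with rfl | hx
          · simp
          · exact List.mem_cons_of_mem _ (ih (by simp) hx)
        · exact List.mem_cons_of_mem _ (ih (by simp [hb]) hx)

theorem sum_length_splitOn (m : ℕ) (w : List ℕ) :
    ((w.splitOn m).map fun b => b.length + 1).sum = w.length + 1 := by
  induction w with
  | nil => simp
  | cons y w ih =>
    rw [List.splitOn_cons_eq_if_modifyHead]
    split_ifs
    · simp [ih]; omega
    · cases hs : w.splitOn m with
      | nil => exact absurd hs (List.splitOn_ne_nil _ _)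
      | cons c l =>
        rw [hs] at ih
        simp at ih ⊢
        omega

/-- The tree of the packing of a word. -/
def packedTree (w : List ℕ) : PlanarTree := rho (pack w)

theorem rho_of_mem {w : List ℕ} (h : 1 ∈ w) : rho w = node ((w.splitOn 1).map packedTree) := by
  rw [rho, dif_pos h]
  conv_rhs => rw [← List.attach_map_subtype_val (w.splitOn 1), List.map_map]
  rfl

theorem rho_nil : rho [] = leaf := by
  rw [rho, dif_neg (by simp)]

theorem packedTree_nil : packedTree [] = leaf := rho_nil

/-- Packing sends the minimum to 1, and a block of Pack(w) packs to the same word as the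
corresponding block of w. The recursion can thus cut at the minimal letter of an arbitrary word,
without packing at each level. -/
theorem packedTree_eq {w : List ℕ} {m : ℕ} (hm : m ∈ w) (hle : ∀ x ∈ w, m ≤ x) :
    packedTree w = node ((w.splitOn m).map packedTree) := by
  have h1 : letterRank w m = 1 := by
    have : w.toFinset.filter (· ≤ m) = {m} := by
      ext y
      simp only [Finset.mem_filter, List.mem_toFinset, Finset.mem_singleton]
      constructor
      · exact fun h => le_antisymm h.2 (hle y h.1)
      · rintro rfl
        exact ⟨hm, le_rfl⟩
    rw [letterRank, this, Finset.card_singleton]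
  rw [packedTree, rho_of_mem (by rw [pack_eq_map, ← h1]; exact List.mem_map_of_mem hm),
    pack_eq_map]
  conv_lhs => rw [← h1]
  rw [splitOn_map, List.map_map]
  · congr 1
    refine List.map_congr_left fun b hb => ?_
    rw [Function.comp_apply, packedTree, packedTree,
      pack_map_letterRank fun x hx => mem_of_mem_splitOn hb hx]
  · intro x hx
    constructor
    · exact fun e => le_antisymm ((letterRank_le_iff w hx).1 e.le) (hle x hx)
    · rintro rfl
      rfl

/-- The cut is made at the leftmost minimum, strict on the left and weak on the right, in accordance
with the tie-breaking of standardization. -/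
theorem exists_min_split {α : Type*} (f : α → ℕ) {z : List α} (hz : z ≠ []) :
    ∃ z₁ a z₂, z = z₁ ++ a :: z₂ ∧ (∀ b ∈ z₁, f a < f b) ∧ ∀ b ∈ z₂, f a ≤ f b := by
  induction z with
  | nil => exact absurd rfl hz
  | cons c z ih =>
    rcases eq_or_ne z [] with rfl | hne
    · exact ⟨[], c, [], rfl, by simp, by simp⟩
    obtain ⟨z₁, a, z₂, rfl, h1, h2⟩ := ih hne
    rcases le_or_gt (f c) (f a) with h | h
    · refine ⟨[], c, z₁ ++ a :: z₂, rfl, by simp, fun b hb => ?_⟩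
      rcases List.mem_append.1 hb with hb | hb
      · exact h.trans (h1 b hb).le
      · rcases List.mem_cons.1 hb with rfl | hb
        · exact h
        · exact h.trans (h2 b hb)
    · exact ⟨c :: z₁, a, z₂, rfl, by simpa [h] using h1, h2⟩

theorem numLeavesList_eq (ts : List PlanarTree) :
    numLeavesList ts = (ts.map numLeaves).sum := by
  induction ts with
  | nil => rw [numLeavesList]; simp
  | cons t ts ih => rw [numLeavesList, ih]; simp

/-- Cutting at k occurrences of the minimum leaves k + 1 blocks, so the sum of (length + 1) over the
blocks is |w| + 1. Consequently the packed words with tree t all have length equal to the degree of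
t, and Ω misses none. -/
theorem numLeaves_packedTree (w : List ℕ) : (packedTree w).numLeaves = w.length + 1 := by
  induction h : w.length using Nat.strong_induction_on generalizing w with
  | _ n ih =>
  subst h
  rcases eq_or_ne w [] with rfl | hne
  · rw [packedTree_nil, numLeaves]; rfl
  obtain ⟨w₁, m, w₂, rfl, h1, h2⟩ := exists_min_split id hne
  simp only [id_eq] at h1 h2
  have hm : m ∈ w₁ ++ m :: w₂ := by simp
  rw [packedTree_eq hm fun x hx => by
    rcases List.mem_append.1 hx with hx | hx
    · exact (h1 x hx).le
    · rcases List.mem_cons.1 hx with rfl | hx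
      · exact le_rfl
      · exact h2 x hx]
  have key : ∀ ts : List PlanarTree, ts ≠ [] → (node ts).numLeaves = (ts.map numLeaves).sum := by
    intro ts hts
    cases ts with
    | nil => exact absurd rfl hts
    | cons t ts => rw [numLeaves, numLeavesList_eq]; simp
  rw [key _ (by simp [List.splitOn_ne_nil]), List.map_map, ← sum_length_splitOn m]
  congr 1
  refine List.map_congr_left fun b hb => ?_
  rw [Function.comp_apply, ih _ (length_lt_of_mem_splitOn hm hb) b rfl]

theorem degree_rho {w : List ℕ} (h : IsPacked w) : (rho w).degree = w.length := by
  have := numLeaves_packedTree w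
  rw [packedTree, h.pack_eq] at this
  rw [degree, this]
  omega

/-! ### The trees below a binary tree -/

theorem mem_treesBelow_iff_set {t t' : PlanarTree} :
    t' ∈ t.treesBelow ↔ ∃ I : Set (List ℕ), (∀ p ∈ I, p ∈ t.rightEdges) ∧ t' = t.contract I := by
  classical
  rw [mem_treesBelow]
  constructor
  · rintro ⟨I, hI, rfl⟩
    exact ⟨I, fun p hp => hI hp, rfl⟩
  · rintro ⟨I, hI, rfl⟩
    refine ⟨t.rightEdges.filter (· ∈ I), Finset.filter_subset _ _, ?_⟩
    congr 1
    ext p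
    simp
    exact hI p

theorem treesBelow_leaf : leaf.treesBelow = {leaf} := by
  ext t
  rw [mem_treesBelow_iff_set, Finset.mem_singleton]
  constructor
  · rintro ⟨I, -, rfl⟩
    simp [contract, contractList]
  · rintro rfl
    exact ⟨∅, by simp, by simp [contract, contractList]⟩

theorem nil_notMem_rightEdges (t : PlanarTree) : [] ∉ t.rightEdges := by
  cases t with
  | node ts =>
    intro h
    rw [rightEdges] at h
    obtain ⟨k, q, e, -⟩ := exists_of_mem_rightEdgesList ts _ _ h
    simp at e

theorem mem_rightEdges_pair {l r : PlanarTree} {p : List ℕ} :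
    p ∈ (node [l, r]).rightEdges ↔ (∃ q ∈ l.rightEdges, p = 0 :: q) ∨
      (∃ q ∈ r.rightEdges, p = 1 :: q) ∨ (r ≠ leaf ∧ p = [1]) := by
  classical
  simp only [rightEdges, rightEdgesList, Finset.mem_union, Finset.mem_image]
  by_cases hr : r = leaf <;> simp [hr, eq_comm]

/-- The empty address designates the root, above which there is no edge, so its membership is never
consulted. -/
theorem contractList_congr {I J : Set (List ℕ)} (h : ∀ k p, k :: p ∈ I ↔ k :: p ∈ J)
    (ts : List PlanarTree) (i : ℕ) : contractList ts i I = contractList ts i J := by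
  induction ts generalizing i with
  | nil => rw [contractList, contractList]
  | cons t ts ih =>
    have e : {p | i :: p ∈ I} = {p | i :: p ∈ J} := Set.ext fun p => h i p
    rw [contractList, contractList, ih, e]
    by_cases hj : [i] ∈ J
    · rw [if_pos ((h i []).2 hj), if_pos hj]
    · rw [if_neg fun hi => hj ((h i []).1 hi), if_neg hj]

theorem contract_congr {I J : Set (List ℕ)} (h : ∀ k p, k :: p ∈ I ↔ k :: p ∈ J)
    (t : PlanarTree) : t.contract I = t.contract J := by
  cases t with
  | node ts => rw [contract, contract, contractList_congr h]

open Classical in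
theorem contract_pair (l r : PlanarTree) {I : Set (List ℕ)} (h : [0] ∉ I) :
    (node [l, r]).contract I = node (l.contract {p | 0 :: p ∈ I} ::
      if [1] ∈ I then (r.contract {p | 1 :: p ∈ I}).children
      else [r.contract {p | 1 :: p ∈ I}]) := by
  simp [contract, contractList, h]

/-- The right edges of the tree are those of `l`, those of `r` and, if `r` is not a leaf, the edge
to `r`; each may be contracted independently. Contracting the last one grafts the children of `b`
directly on the root. -/
theorem mem_treesBelow_pair {l r t : PlanarTree} :
    t ∈ (node [l, r]).treesBelow ↔ ∃ a ∈ l.treesBelow, ∃ b ∈ r.treesBelow,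
      t = node [a, b] ∨ (r ≠ leaf ∧ t = node (a :: b.children)) := by
  classical
  simp only [mem_treesBelow_iff_set]
  constructor
  · rintro ⟨I, hI, rfl⟩
    have hI' := fun p hp => mem_rightEdges_pair.1 (hI p hp)
    have h0 : [0] ∉ I := fun h => by
      rcases hI' _ h with ⟨q, hq, e⟩ | ⟨q, hq, e⟩ | ⟨-, e⟩
      · simp only [List.cons.injEq, true_and] at e
        exact nil_notMem_rightEdges l (e ▸ hq)
      · simp at e
      · simp at e
    -- If the edge `[1]` is contracted, the trace of `I` on `r` contains the empty address, which is
    -- not a right edge of `r`; removing it does not affect the contraction.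
    have e : r.contract {p | 1 :: p ∈ I ∧ p ≠ []} = r.contract {p | 1 :: p ∈ I} :=
      contract_congr (by simp) r
    refine ⟨_, ⟨{p | 0 :: p ∈ I}, fun p hp => ?_, rfl⟩, _, ⟨{p | 1 :: p ∈ I ∧ p ≠ []},
      fun p hp => ?_, rfl⟩, ?_⟩
    · rcases hI' _ hp with ⟨q, hq, e⟩ | ⟨q, hq, e⟩ | ⟨-, e⟩
      · simp only [List.cons.injEq, true_and] at e
        exact e ▸ hq
      · simp at e
      · simp at e
    · rcases hI' _ hp.1 with ⟨q, hq, e⟩ | ⟨q, hq, e⟩ | ⟨-, e⟩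
      · simp at e
      · simp only [List.cons.injEq, true_and] at e
        exact e ▸ hq
      · simp only [List.cons.injEq, true_and] at e
        exact absurd e hp.2
    · rw [e, contract_pair l r h0]
      by_cases h1 : [1] ∈ I
      · right
        refine ⟨?_, by rw [if_pos h1]⟩
        rcases hI' _ h1 with ⟨q, hq, e⟩ | ⟨q, hq, e⟩ | ⟨hr, -⟩
        · simp at e
        · simp only [List.cons.injEq, true_and] at e
          exact absurd (e ▸ hq) (nil_notMem_rightEdges r)
        · exact hr
      · left
        rw [if_neg h1]
  · rintro ⟨_, ⟨I, hI, rfl⟩, _, ⟨J, hJ, rfl⟩, h⟩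
    -- The proposition `c` records whether the edge to `r` is contracted, so that both cases share
    -- one witness.
    obtain ⟨c, hc, ht⟩ : ∃ c : Prop, (c → r ≠ leaf) ∧ t = node (l.contract I ::
        if c then (r.contract J).children else [r.contract J]) := by
      rcases h with h | h
      · exact ⟨False, by simp, by simpa using h⟩
      · exact ⟨True, by simpa using h.1, by simpa using h.2⟩
    have hI0 : [] ∉ I := fun h => nil_notMem_rightEdges l (hI _ h)
    have hJ0 : [] ∉ J := fun h => nil_notMem_rightEdges r (hJ _ h)
    refine ⟨{p | (∃ q ∈ I, p = 0 :: q) ∨ (∃ q ∈ J, p = 1 :: q) ∨ (c ∧ p = [1])},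
      fun p hp => mem_rightEdges_pair.2 ?_, ?_⟩
    · rcases hp with ⟨q, hq, e⟩ | ⟨q, hq, e⟩ | ⟨hr, e⟩
      · exact Or.inl ⟨q, hI q hq, e⟩
      · exact Or.inr (Or.inl ⟨q, hJ q hq, e⟩)
      · exact Or.inr (Or.inr ⟨hc hr, e⟩)
    · rw [contract_pair _ _ (by simp [hI0]), ht,
        contract_congr (I := {p | _}) (J := I) (by simp) l,
        contract_congr (I := {p | _}) (J := J) (by simp) r]
      by_cases h : c <;> simp [h, hJ0]

/-- Cut at the leftmost minimum a. After standardization it is the only minimum, so the tree of the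
standardized word has a binary root over the trees of `z₁` and `z₂`. Before it, the root carries the
tree of `z₁`, then the blocks of `z₂` cut at a. If a recurs in `z₂`, these blocks are the children
of the root of the tree of `z₂` and the right edge has been contracted; otherwise they form that
tree itself. Induction applies to `z₁` and `z₂`. -/
theorem IsStd.packedTree_mem_treesBelow_iff {z : List (ℕ × ℕ)} (hz : IsStd z) {t : PlanarTree}
    (ht : t.Binary) :
    packedTree (z.map Prod.fst) ∈ t.treesBelow ↔ packedTree (z.map Prod.snd) = t := by
  induction h : z.length using Nat.strong_induction_on generalizing z t with
  | _ n ih =>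
  subst h
  rcases eq_or_ne z [] with rfl | hne
  · simp only [List.map_nil, packedTree_nil]
    cases ht with
    | leaf => simp [treesBelow_leaf]
    | node l r hl hr =>
      simp only [mem_treesBelow_pair]
      simp [leaf]
  obtain ⟨z₁, a, z₂, rfl, h1, h2⟩ := exists_min_split Prod.fst hne
  obtain ⟨hz₁, hz₂, hz₁₂⟩ := List.pairwise_append.1 hz
  obtain ⟨ha, hz₂⟩ := List.pairwise_cons.1 hz₂
  have h1' : ∀ b ∈ z₁, a.2 < b.2 := fun b hb => by
    have h3 := h1 b hb
    have h4 := hz₁₂ b hb a (by simp)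
    unfold StdRel at h4
    omega
  have h2' : ∀ b ∈ z₂, a.2 < b.2 := fun b hb => (ha b hb).1.1 (h2 b hb)
  have e1 : packedTree ((z₁ ++ a :: z₂).map Prod.fst) = node (packedTree (z₁.map Prod.fst) ::
      ((z₂.map Prod.fst).splitOn a.1).map packedTree) := by
    rw [packedTree_eq (m := a.1) (by simp), List.map_append, List.map_cons,
      List.splitOn_append_cons_self_of_not_mem, List.map_cons]
    · simp only [List.mem_map, not_exists, not_and]
      exact fun b hb => (h1 b hb).ne'
    · simp only [List.mem_map, List.mem_append, List.mem_cons, forall_exists_index, and_imp]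
      rintro _ b (hb | rfl | hb) rfl
      · exact (h1 b hb).le
      · exact le_rfl
      · exact h2 b hb
  have e2 : packedTree ((z₁ ++ a :: z₂).map Prod.snd) = node [packedTree (z₁.map Prod.snd),
      packedTree (z₂.map Prod.snd)] := by
    rw [packedTree_eq (m := a.2) (by simp), List.map_append, List.map_cons,
      List.splitOn_append_cons_self_of_not_mem, List.splitOn_eq_singleton]
    · rfl
    · simp only [List.mem_map, not_exists, not_and]
      exact fun b hb => (h2' b hb).ne'
    · simp only [List.mem_map, not_exists, not_and]
      exact fun b hb => (h1' b hb).ne'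
    · simp only [List.mem_map, List.mem_append, List.mem_cons, forall_exists_index, and_imp]
      rintro _ b (hb | rfl | hb) rfl
      · exact (h1' b hb).le
      · exact le_rfl
      · exact (h2' b hb).le
  rw [e1, e2]
  cases ht with
  | leaf => simp [treesBelow_leaf, leaf]
  | node l r hl hr =>
    have ih1 := ih _ (by simp) hz₁ hl rfl
    have ih2 := ih _ (by simp; omega) hz₂ hr rfl
    have key : node (packedTree (z₁.map Prod.fst) ::
        ((z₂.map Prod.fst).splitOn a.1).map packedTree) ∈ (node [l, r]).treesBelow ↔
        packedTree (z₁.map Prod.fst) ∈ l.treesBelow ∧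
          packedTree (z₂.map Prod.fst) ∈ r.treesBelow := by
      rw [mem_treesBelow_pair]
      by_cases hmem : a.1 ∈ z₂.map Prod.fst
      · have e3 : packedTree (z₂.map Prod.fst)
            = node (((z₂.map Prod.fst).splitOn a.1).map packedTree) := by
          refine packedTree_eq hmem ?_
          simpa using fun x y hxy => h2 (x, y) hxy
        -- A recurring minimum gives at least two blocks, which excludes the uncontracted form with
        -- a binary root.
        have hlen : 2 ≤ (((z₂.map Prod.fst).splitOn a.1).map packedTree).length := by
          obtain ⟨xs, ys, e⟩ := List.append_of_mem hmem
          rw [e, List.splitOn_append_cons_self, List.length_map, List.length_append]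
          have := List.length_pos_iff.2 (List.splitOn_ne_nil a.1 xs)
          have := List.length_pos_iff.2 (List.splitOn_ne_nil a.1 ys)
          omega
        rw [e3]
        constructor
        · rintro ⟨A, hA, B, hB, h | ⟨hr', h⟩⟩
          · simp only [node.injEq, List.cons.injEq] at h
            rw [h.2] at hlen
            simp at hlen
          · simp only [node.injEq, List.cons.injEq] at h
            rw [h.1, h.2]
            cases B
            exact ⟨hA, hB⟩
        · rintro ⟨hA, hB⟩
          refine ⟨_, hA, _, hB, Or.inr ⟨?_, rfl⟩⟩
          -- Only the leaf lies below the leaf, whereas the tree of `z₂` has at least two children;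
          -- the edge to `r` is therefore internal.
          rintro rfl
          rw [treesBelow_leaf, Finset.mem_singleton, leaf, node.injEq] at hB
          rw [hB] at hlen
          simp at hlen
      · rw [List.splitOn_eq_singleton hmem, List.map_singleton]
        constructor
        · rintro ⟨A, hA, B, hB, h | ⟨hr', h⟩⟩
          · simp only [node.injEq, List.cons.injEq, and_true] at h
            rw [h.1, h.2]
            exact ⟨hA, hB⟩
          -- Contraction would require a tree below `r` whose root has exactly one child, which
          -- reducedness forbids.
          · have hred := (IsBin.isSchroder ⟨hr, hr'⟩ hB).1
            simp only [node.injEq, List.cons.injEq] at h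
            cases hred with
            | node ts hts _ =>
              exact absurd (by simpa [children] using congrArg List.length h.2.symm) hts
        · rintro ⟨hA, hB⟩
          exact ⟨_, hA, _, hB, Or.inl rfl⟩
    rw [key, ih1, ih2]
    simp

/-! ### The square `Ψ ∘ Ω' = Ω ∘ ψ` -/

section Square

variable {K : Type*} [Field K]

theorem qcoeff_Omega_basisVec {t : PlanarTree} (ht : t.IsSchroder) (w : List ℕ) :
    qcoeff w (Omega K (basisVec K IsSchroder t)) = ind K (packedTree w = t) := by
  classical
  rw [basisVec_of K ht, Omega, Finsupp.linearCombination_single, one_smul, coeff_sum_basisVec]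
  · refine ind_congr ?_
    rw [Finset.mem_filter, mem_packedWords]
    refine ⟨fun h => h.2, fun h => ⟨⟨isPacked_pack w, ?_⟩, h⟩⟩
    exact (degree_rho (isPacked_pack w)).symm.trans (congrArg degree h)
  · intro σ hσ
    rw [Finset.mem_filter, mem_packedWords] at hσ
    refine ⟨?_, hσ.1.1⟩
    rintro rfl
    exact ht.2 (hσ.2.symm.trans rho_nil)

theorem coeff_Omega'_single (t : {t // IsBin t}) (a : K) {w : List ℕ} (hw : w.Nodup) :
    coeff K IsPerm w (Omega' K (Finsupp.single t a)) = a * ind K (packedTree w = t.1) := by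
  classical
  rw [Omega', Finsupp.linearCombination_single, map_smul, smul_eq_mul, coeff_sum_basisVec]
  · congr 1
    refine ind_congr ?_
    rw [Finset.mem_filter, mem_packedWords]
    refine ⟨fun h => h.2.2, fun h => ⟨⟨isPacked_pack w, ?_⟩, isPerm_pack ?_ hw, h⟩⟩
    · exact (degree_rho (isPacked_pack w)).symm.trans (congrArg degree h)
    · rintro rfl
      exact t.2.2 (h.symm.trans packedTree_nil)
  · intro σ hσ
    exact (Finset.mem_filter.1 hσ).2.1

/-- At a word w and a binary tree t, the left side tests ϱ(std w) = t and the right side tests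
whether ϱ(w) is one of the trees below t. -/
theorem Psi_comp_Omega' : Psi K ∘ₗ Omega' K = Omega K ∘ₗ psi K := by
  classical
  refine Finsupp.lhom_ext fun t a => QSh.ext fun w => ?_
  obtain ⟨z, hz, rfl⟩ := exists_isStd w
  rw [LinearMap.comp_apply, LinearMap.comp_apply, hz.coeff_Psi, coeff_Omega'_single t a hz.nodup,
    psi, Finsupp.linearCombination_single, map_smul, map_smul, smul_eq_mul, map_sum, map_sum,
    Finset.sum_congr rfl fun t' ht' => qcoeff_Omega_basisVec (t.2.isSchroder ht') _,
    ← ind_congr (hz.packedTree_mem_treesBelow_iff t.2.1)]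
  congr 1
  simp only [ind]
  convert (Finset.sum_ite_eq t.1.treesBelow (packedTree (z.map Prod.fst))
    fun _ => (1 : K)).symm

end Square

end Bidendriform

end

theorem mainTheorem11 (K : Type*) [Field K] :
    (Bidendriform.shOps K).opposite.IsBidendriformBialgebra ∧
    (Bidendriform.qshOps K).opposite.IsBidendriformBialgebra ∧
    Bidendriform.Ops.IsBidendriformHom (Bidendriform.shOps K) (Bidendriform.qshOps K) (Bidendriform.Psi K) ∧
    Bidendriform.Psi K ∘ₗ Bidendriform.Omega' K = Bidendriform.Omega K ∘ₗ Bidendriform.psi K :=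
  ⟨Bidendriform.sh_opposite, Bidendriform.qsh_opposite, Bidendriform.Psi_isBidendriformHom,
    Bidendriform.Psi_comp_Omega'⟩
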